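/- Let $\alpha\in(0,3/2)$, $\gamma>0$, $c>0$ and $d>0$ be fixed real numbers, and let $G=G(n,d/n)$ be the binomial random graph on $n$ vertices with edge probability $d/n$. Write $\Delta(u)$ for the degree of the vertex $u$ and give $u$ the weight $W(u)=(1+\gamma)^{-1}$ if $\Delta(u)\le(1+\alpha)d$, and $W(u)=d^{c}\,\Delta(u)$ otherwise. The influence on a vertex $v$ is $E(v)=\max_{L}\prod_{u\in L}W(u)$, where $L$ ranges over all simple paths that start from $v$ and have at most $\ln n/d^{2/5}$ edges (the path consisting of $v$ alone included). A vertex $v$ is a break-point if $E(v)\le 1$. An influence path is a simple path that contains no break-point. The set of blocks $\mathcal B=\mathcal B(G)$ is the following set of vertex sets. (1) For each cycle $C$ of $G$ of length at most $4\ln n/\ln^5 d$ there is the block consisting of all vertices $v\in C$ and all vertices reachable from some $v\in C$ through an influence path. (2) For each vertex $v$ that lies in no block of kind (1) there is the block $\{v\}$, if $v$ is a break-point, and otherwise the block consisting of $v$ and all vertices reachable from $v$ through an influence path. (In (1) one may adopt either of two conventions: the first vertex $v$ of the influence path must itself not be a break-point, or only the vertices after $v$ must not be break-points. The theorem holds for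 each of them.) Steps are those of a unit-cost random access machine which has an array of natural numbers and an array of real numbers with direct and indirect addressing, and whose unit-cost operations are addition and truncated subtraction of natural numbers, the four arithmetic operations and fixed constants on reals, copies, conversion of a natural number to a real, comparisons, and queries to the adjacency matrix of the input graph. **Theorem.** There is a fixed $s>0$ such that for all $\alpha\in(0,3/2)$, $\gamma>0$, $c>0$ there is a $d_0$ such that for every real $d\ge d_0$ there are a program of this machine (not depending on $n$) and a constant $K$ with the following properties. On every finite input graph $G$ on vertex set $\{0,\dots,n-1\}$ the program halts and outputs the list, without repetition, of the members of $\mathcal B(G)$. With probability tending to $1$ as $n\to\infty$, for $G=G(n,d/n)$ the program halts after at most $K n^{s}$ steps, and every block $B\in\mathcal B(G)$ induces a subgraph of $G$ that is either a tree or unicyclic (connected, with as many edges as vertices). -/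

import Mathlib

open Filter Topology

noncomputable section

namespace BlockCreation

/-! ### The weighting schema, influence and break-points -/

/-- The real parameters: `d` is the expected degree of the random graph, and `α`, `γ`, `c` are the
parameters of the weighting schema. -/
structure Params where
  α : ℝ
  γ : ℝ
  c : ℝ
  d : ℝ

section Blocks

variable {n : ℕ} (θ : Params) (G : SimpleGraph (Fin n))

/-- The degree `Δ(u)` of a vertex. -/
def deg (u : Fin n) : ℕ := (G.neighborSet u).ncard

open Classical in
/-- The weight `W(u)` of a vertex: `(1 + γ)⁻¹` if `Δ(u) ≤ (1 + α) d`, and `d ^ c * Δ(u)` otherwise. -/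
def weight (u : Fin n) : ℝ :=
  if (deg G u : ℝ) ≤ (1 + θ.α) * θ.d then (1 + θ.γ)⁻¹ else θ.d ^ θ.c * (deg G u : ℝ)

/-- The product of the weights of the vertices of a path (both ends included). -/
def pathWeight {u v : Fin n} (p : G.Walk u v) : ℝ := (p.support.map (weight θ G)).prod

/-- The weights of the (simple) paths that start from `v` and have length (number of edges) at most
`ln n / d ^ (2/5)`; the path of length zero is one of them. -/
def localPathWeights (v : Fin n) : Set ℝ :=
  {x | ∃ (u : Fin n) (p : G.Walk v u), p.IsPath ∧
    (p.length : ℝ) ≤ Real.log n / θ.d ^ ((2 : ℝ) / 5) ∧ x = pathWeight θ G p}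

/-- The influence `E(v)` on the vertex `v`. -/
def influence (v : Fin n) : ℝ := sSup (localPathWeights θ G v)

theorem localPathWeights_finite (v : Fin n) : (localPathWeights θ G v).Finite := by
  classical
  have : localPathWeights θ G v ⊆
      Set.range (fun q : (Σ u : Fin n, G.Path v u) => pathWeight θ G q.2.1) := by
    rintro x ⟨u, p, hp, -, rfl⟩
    exact ⟨⟨u, ⟨p, hp⟩⟩, rfl⟩
  exact (Set.finite_range _).subset this

/-- The supremum in the definition of `E(v)` is a maximum, for `d ≥ 0`. -/
theorem influence_isGreatest (hd : 0 ≤ θ.d) (v : Fin n) :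
    IsGreatest (localPathWeights θ G v) (influence θ G v) := by
  have hne : (localPathWeights θ G v).Nonempty := by
    refine ⟨_, v, SimpleGraph.Walk.nil, SimpleGraph.Walk.IsPath.nil, ?_, rfl⟩
    have h1 : 0 ≤ Real.log n := Real.log_natCast_nonneg n
    have h2 : 0 ≤ θ.d ^ ((2 : ℝ) / 5) := Real.rpow_nonneg hd _
    simpa using div_nonneg h1 h2
  exact ⟨hne.csSup_mem (localPathWeights_finite θ G v),
    fun x hx => le_csSup (localPathWeights_finite θ G v).bddAbove hx⟩

/-- Break-points: the vertices `v` with `E(v) ≤ 1`. -/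
def IsBreakPoint (v : Fin n) : Prop := influence θ G v ≤ 1

/-- Influence paths: the paths that do not contain break-points. -/
def IsInfluencePath {u v : Fin n} (p : G.Walk u v) : Prop :=
  p.IsPath ∧ ∀ x ∈ p.support, ¬ IsBreakPoint θ G x

/-! ### The blocks -/

/-- The two ways of reading "reachable from a vertex `v` of the cycle through an influence path":
`included` requires of all the vertices of the path, `v` included, not to be break-points, while
`exempt` requires it only of the vertices after `v`. -/
inductive StartRule
  | included
  | exempt

/-- The path `p` leads from its first vertex, which lies on a short cycle, into the block of the
cycle. -/
def LeavesCycle (ρ : StartRule) {u v : Fin n} (p : G.Walk u v) : Prop :=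
  match ρ with
  | .included => IsInfluencePath θ G p
  | .exempt => p.IsPath ∧ ∀ x ∈ p.support.tail, ¬ IsBreakPoint θ G x

/-- The block of the cycle `C`: the vertices of `C` and the vertices reachable from them through
influence paths. -/
def cycleBlock (ρ : StartRule) {a : Fin n} (C : G.Walk a a) : Set (Fin n) :=
  {u | ∃ v ∈ C.support, u = v ∨ ∃ p : G.Walk v u, LeavesCycle θ G ρ p}

/-- The blocks of the first kind: those of the cycles of length at most `4 ln n / ln ^ 5 d`. -/
def cycleBlocks (ρ : StartRule) : Set (Set (Fin n)) :=
  {B | ∃ (a : Fin n) (C : G.Walk a a), C.IsCycle ∧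
    (C.length : ℝ) ≤ 4 * (Real.log n / Real.log θ.d ^ 5) ∧ B = cycleBlock θ G ρ C}

open Classical in
/-- The block of a vertex `v` that is in no block of the first kind: `{v}` if `v` is a break-point,
otherwise `v` together with all the vertices reachable from `v` through an influence path. -/
def vertexBlock (v : Fin n) : Set (Fin n) :=
  if IsBreakPoint θ G v then {v}
  else {u | u = v ∨ ∃ p : G.Walk v u, IsInfluencePath θ G p}

/-- The set of blocks `𝓑`. -/
def blocks (ρ : StartRule) : Set (Set (Fin n)) :=
  cycleBlocks θ G ρ ∪
    {B | ∃ v : Fin n, (∀ B' ∈ cycleBlocks θ G ρ, v ∉ B') ∧ B = vertexBlock θ G v}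

/-- The subgraph induced by `B` is unicyclic, i.e. a tree with one extra edge: connected, with as
many edges as vertices. -/
def IsUnicyclic (B : Set (Fin n)) : Prop :=
  (G.induce B).Connected ∧ (G.induce B).edgeSet.ncard = B.ncard

end Blocks

/-! ### The random graph -/

/-- The law of `G(n, d/n)`; the edge probability `d/n` is truncated to `[0, 1]`, which changes
nothing as soon as `n ≥ d ≥ 0`. -/
def gnp (d : ℝ) (n : ℕ) : MeasureTheory.Measure (SimpleGraph (Fin n)) :=
  SimpleGraph.binomialRandom (Fin n) (Set.projIcc 0 1 zero_le_one (d / n))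

/-- An event holds w.h.p. over `G(n, d/n)`. -/
def WHP (d : ℝ) (A : ∀ n : ℕ, SimpleGraph (Fin n) → Prop) : Prop :=
  Tendsto (fun n : ℕ => gnp d n {G | A n G}) atTop (𝓝 1)

/-! ### The machine model

A unit-cost random access machine: an array of natural numbers (for indices and counters) and an
array of real numbers, both with direct and indirect addressing by natural numbers. The elementary
operations are addition and truncated subtraction of natural numbers, the four arithmetic operations
on reals, copies, constants, the conversion of a natural number to a real, comparisons, and
queries to the adjacency matrix of the input graph. Every operation and every test costs one step. -/

/-- The memory. -/
structure Mem where
  nat : ℕ → ℕ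
  real : ℕ → ℝ

/-- The address of a cell: a constant, or the content of a cell of the array of natural numbers. -/
inductive Addr
  | dir (k : ℕ)
  | ind (k : ℕ)

def Addr.eval (m : Mem) : Addr → ℕ
  | .dir k => k
  | .ind k => m.nat k

/-- The elementary operations; the first address is that of the result. -/
inductive Op
  | nconst (a : Addr) (k : ℕ)
  | ncopy (a b : Addr)
  | nadd (a b b' : Addr)
  | nsub (a b b' : Addr)
  | edge (a b b' : Addr)
  | rconst (a : Addr) (x : ℝ)
  | rcopy (a b : Addr)
  | radd (a b b' : Addr)
  | rsub (a b b' : Addr)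
  | rmul (a b b' : Addr)
  | rdiv (a b b' : Addr)
  | cast (a b : Addr)

/-- The tests: comparison of two cells of the array of natural numbers, or of the array of reals. -/
inductive Test
  | nle (a b : Addr)
  | rle (a b : Addr)

def Mem.setNat (m : Mem) (i k : ℕ) : Mem := { m with nat := Function.update m.nat i k }

def Mem.setReal (m : Mem) (i : ℕ) (x : ℝ) : Mem := { m with real := Function.update m.real i x }

open Classical in
/-- The entry `(i, j)` of the adjacency matrix of the input graph. -/
def adjEntry {n : ℕ} (G : SimpleGraph (Fin n)) (i j : ℕ) : ℕ :=
  if ∃ (hi : i < n) (hj : j < n), G.Adj ⟨i, hi⟩ ⟨j, hj⟩ then 1 else 0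

def Op.run {n : ℕ} (G : SimpleGraph (Fin n)) (m : Mem) : Op → Mem
  | .nconst a k => m.setNat (a.eval m) k
  | .ncopy a b => m.setNat (a.eval m) (m.nat (b.eval m))
  | .nadd a b b' => m.setNat (a.eval m) (m.nat (b.eval m) + m.nat (b'.eval m))
  | .nsub a b b' => m.setNat (a.eval m) (m.nat (b.eval m) - m.nat (b'.eval m))
  | .edge a b b' => m.setNat (a.eval m) (adjEntry G (m.nat (b.eval m)) (m.nat (b'.eval m)))
  | .rconst a x => m.setReal (a.eval m) x
  | .rcopy a b => m.setReal (a.eval m) (m.real (b.eval m))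
  | .radd a b b' => m.setReal (a.eval m) (m.real (b.eval m) + m.real (b'.eval m))
  | .rsub a b b' => m.setReal (a.eval m) (m.real (b.eval m) - m.real (b'.eval m))
  | .rmul a b b' => m.setReal (a.eval m) (m.real (b.eval m) * m.real (b'.eval m))
  | .rdiv a b b' => m.setReal (a.eval m) (m.real (b.eval m) / m.real (b'.eval m))
  | .cast a b => m.setReal (a.eval m) (m.nat (b.eval m) : ℝ)

def Test.Holds (m : Mem) : Test → Prop
  | .nle a b => m.nat (a.eval m) ≤ m.nat (b.eval m)
  | .rle a b => m.real (a.eval m) ≤ m.real (b.eval m)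

/-- Programs. -/
inductive Prog
  | skip
  | op (o : Op)
  | seq (P Q : Prog)
  | ite (b : Test) (P Q : Prog)
  | while (b : Test) (P : Prog)

/-- `Exec G P m t m'`: on the input graph `G`, the program `P` started in the memory `m` halts after
exactly `t` steps in the memory `m'`. -/
inductive Exec {n : ℕ} (G : SimpleGraph (Fin n)) : Prog → Mem → ℕ → Mem → Prop
  | skip (m : Mem) : Exec G .skip m 0 m
  | op (o : Op) (m : Mem) : Exec G (.op o) m 1 (o.run G m)
  | seq {P Q : Prog} {m m' m'' : Mem} {t t' : ℕ} :
      Exec G P m t m' → Exec G Q m' t' m'' → Exec G (.seq P Q) m (t + t') m''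
  | ite_true {b : Test} {P Q : Prog} {m m' : Mem} {t : ℕ} :
      b.Holds m → Exec G P m t m' → Exec G (.ite b P Q) m (t + 1) m'
  | ite_false {b : Test} {P Q : Prog} {m m' : Mem} {t : ℕ} :
      ¬ b.Holds m → Exec G Q m t m' → Exec G (.ite b P Q) m (t + 1) m'
  | while_true {b : Test} {P : Prog} {m m' m'' : Mem} {t t' : ℕ} :
      b.Holds m → Exec G P m t m' → Exec G (.while b P) m' t' m'' →
      Exec G (.while b P) m (t + t' + 1) m''
  | while_false {b : Test} {P : Prog} {m : Mem} :
      ¬ b.Holds m → Exec G (.while b P) m 1 m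

/-- The initial memory: the number `n` of vertices in cell `0`, and zero everywhere else. -/
def initMem (n : ℕ) : Mem where
  nat := Function.update (fun _ => 0) 0 n
  real := fun _ => 0

/-- The `j`-th set of the list of sets written in the memory `m`, row by row as a 0-1 matrix with `n`
columns that starts at the cell whose address is in cell `1`. -/
def listedSet (n : ℕ) (m : Mem) (j : ℕ) : Set (Fin n) :=
  {v | m.nat (m.nat 1 + j * n + (v : ℕ)) = 1}

/-- The memory `m` holds the family `F`: the sets number `0, …, N - 1` of the list, with `N` in cell
`0`, are the members of `F`, each listed exactly once. -/
def Holds (n : ℕ) (m : Mem) (F : Set (Set (Fin n))) : Prop :=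
  Set.BijOn (listedSet n m) (Set.Iio (m.nat 0)) F

/-- On the input graph `G`, the program `P` halts after `t` steps with output `F`. -/
def Constructs {n : ℕ} (P : Prog) (G : SimpleGraph (Fin n)) (t : ℕ) (F : Set (Set (Fin n))) :
    Prop :=
  ∃ m : Mem, Exec G P (initMem n) t m ∧ Holds n m F

end BlockCreation

end

open BlockCreation

noncomputable section

namespace BlockCreation

/-! ### Expectations over the binomial random graph -/

section Moments

open MeasureTheory Classical

/-! Structure of the blocks. Three properties of the random graph suffice, collected in `Typical`:
no set of at most `20 ln n / ln ^ 5 d` vertices spans more edges than it has vertices; no connected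
set of at least `3 ln n / ln ^ 5 d` vertices has a thirteenth of its vertices with product of
weights above one; and there are at most `n ^ 3` paths with at most `4 ln n / ln ^ 5 d` edges. Each
holds w.h.p. by a first moment bound. For the second, a power `⌊√d⌋` of the weight is dominated by a
constant plus a small multiple of `exp (l Δ)`; independence of the edges bounds the expectation of
products of such exponentials (`expect_edges_exp_deg_le`), and a Chernoff computation makes the
expected factor of one vertex smaller than any fixed power of `1/d`, which beats the number of
connected sets.

The key deterministic fact is `influencePath_length_lt`. Every vertex of a path without break-points
starts a short path of weight above one. In the absence of small dense sets these witness paths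
seldom meet (`card_meeting_le`), so a Vitali type selection gives disjoint ones that cover a fixed
proportion of the union. A long influence path together with the selected witnesses would then be a
heavy set. Hence influence paths have fewer than `3 ln n / ln ^ 5 d` edges. Consequently a second
cycle in the block of a short cycle yields a small dense set (`isUnicyclic_cycleBlock`), and any
cycle in a vertex block would be short, so that the vertex would lie in the block of that cycle
(`isTree_vertexBlock`).

Algorithm. Break-points and short cycles can both be read off a list of all simple paths with at
most `4 ln n / ln ^ 5 d` edges; blocks are closures under a one-step relation. The program is
correct on every graph and takes time of order `(P + n + 1) ^ 4`, with `P` the number of such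
directed paths (`constructs_program`). Since `P ≤ n ^ 3` w.h.p., the exponent 12 works. The program
is verified in a small language with named arrays, which is compiled to the machine with a constant
factor loss (`cmd_compile`). -/

instance measurableSingletonClass_simpleGraph {n : ℕ} :
    MeasurableSingletonClass (SimpleGraph (Fin n)) := by
  refine ⟨fun G => ?_⟩
  have h : ({G} : Set (SimpleGraph (Fin n))) = SimpleGraph.edgeSet ⁻¹' {G.edgeSet} := by
    ext H; simp
  rw [h]
  exact SimpleGraph.measurableEmbedding_edgeSet.measurable (Set.toFinite _).measurableSet

/-- The edge probability of `gnp d n`. -/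
def edgeProb (d : ℝ) (n : ℕ) : ℝ := (Set.projIcc (0 : ℝ) 1 zero_le_one (d / n) : ℝ)

theorem edgeProb_nonneg (d : ℝ) (n : ℕ) : 0 ≤ edgeProb d n :=
  (Set.projIcc (0 : ℝ) 1 zero_le_one (d / n)).2.1

theorem edgeProb_le_one (d : ℝ) (n : ℕ) : edgeProb d n ≤ 1 :=
  (Set.projIcc (0 : ℝ) 1 zero_le_one (d / n)).2.2

theorem edgeProb_le {d : ℝ} (hd : 0 ≤ d) (n : ℕ) : edgeProb d n ≤ d / n := by
  have h : 0 ≤ d / n := by positivity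
  rw [edgeProb, Set.coe_projIcc]
  exact max_le h (min_le_right _ _)

theorem edgeProb_mul_le {d : ℝ} (hd : 0 ≤ d) (n : ℕ) : edgeProb d n * n ≤ d := by
  rcases Nat.eq_zero_or_pos n with rfl | hn
  · simpa using hd
  · have := edgeProb_le hd n
    rwa [le_div_iff₀ (by exact_mod_cast hn)] at this

instance (d : ℝ) (n : ℕ) : IsProbabilityMeasure (gnp d n) := by
  unfold gnp; infer_instance

/-- Expectation over `gnp d n`. -/
def expect (d : ℝ) (n : ℕ) (f : SimpleGraph (Fin n) → ℝ) : ℝ :=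
  ∑ G, (gnp d n).real {G} * f G

theorem expect_mono {d : ℝ} {n : ℕ} {f g : SimpleGraph (Fin n) → ℝ} (h : ∀ G, f G ≤ g G) :
    expect d n f ≤ expect d n g :=
  Finset.sum_le_sum fun G _ => mul_le_mul_of_nonneg_left (h G) measureReal_nonneg

theorem expect_sum {d : ℝ} {n : ℕ} {ι : Type*} (s : Finset ι) (f : ι → SimpleGraph (Fin n) → ℝ) :
    expect d n (fun G => ∑ i ∈ s, f i G) = ∑ i ∈ s, expect d n (f i) := by
  simp only [expect, Finset.mul_sum]
  exact Finset.sum_comm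

theorem expect_const_mul {d : ℝ} {n : ℕ} (c : ℝ) (f : SimpleGraph (Fin n) → ℝ) :
    expect d n (fun G => c * f G) = c * expect d n f := by
  simp only [expect, Finset.mul_sum]
  exact Finset.sum_congr rfl fun G _ => by ring

theorem prob_eq_expect (d : ℝ) (n : ℕ) (A : Set (SimpleGraph (Fin n))) :
    (gnp d n).real A = expect d n (fun G => if G ∈ A then 1 else 0) := by
  have h : A = ((Finset.univ.filter (· ∈ A) : Finset (SimpleGraph (Fin n))) : Set _) := by
    ext; simp
  rw [h, ← sum_measureReal_singleton, Finset.sum_filter]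
  simp [expect]

/-- The edges of the complete graph. -/
def allEdges (n : ℕ) : Finset (Sym2 (Fin n)) := Finset.univ.filter (fun e => ¬ e.IsDiag)

theorem card_allEdges (n : ℕ) : (allEdges n).card = n.choose 2 := by
  have := Sym2.card_diagSet_compl (α := Fin n)
  rw [Fintype.card_fin] at this
  rw [← this, allEdges, Fintype.card_subtype]
  congr 1

theorem gnp_singleton (d : ℝ) (n : ℕ) (G : SimpleGraph (Fin n)) :
    (gnp d n).real {G} =
      ∏ e ∈ allEdges n, if e ∈ G.edgeSet then edgeProb d n else 1 - edgeProb d n := by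
  have h1 : (allEdges n).filter (· ∈ G.edgeSet) = G.edgeFinset := by
    ext e
    simp only [allEdges, Finset.mem_filter, Finset.mem_univ, true_and, SimpleGraph.mem_edgeFinset]
    exact ⟨fun h => h.2, fun h => ⟨G.not_isDiag_of_mem_edgeSet h, h⟩⟩
  have h2 : ((allEdges n).filter (¬ · ∈ G.edgeSet)).card = n.choose 2 - G.edgeSet.ncard := by
    have := Finset.card_filter_add_card_filter_not (s := allEdges n) (· ∈ G.edgeSet)
    rw [h1, card_allEdges] at this
    rw [Set.ncard_eq_toFinset_card' G.edgeSet, ← this]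
    exact (Nat.add_sub_cancel_left _ _).symm
  rw [Finset.prod_ite, Finset.prod_const, Finset.prod_const, h1, h2, Measure.real, gnp,
    SimpleGraph.binomialRandom_singleton]
  have h3 : G.edgeSet.ncard = G.edgeFinset.card := by
    rw [Set.ncard_eq_toFinset_card' G.edgeSet]; rfl
  rw [h3]
  simp only [Nat.card_eq_fintype_card, Fintype.card_fin, ENNReal.toReal_mul, ENNReal.toReal_pow,
    ENNReal.coe_toReal, unitInterval.coe_toNNReal, unitInterval.coe_symm_eq]
  rfl

/-- The edges are independent. -/
theorem expect_prod (d : ℝ) (n : ℕ) (a b : Sym2 (Fin n) → ℝ) :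
    expect d n (fun G => ∏ e ∈ allEdges n, if e ∈ G.edgeSet then a e else b e) =
      ∏ e ∈ allEdges n, (edgeProb d n * a e + (1 - edgeProb d n) * b e) := by
  -- Expanding the product of sums gives one term for each subset of `allEdges n`, and these subsets
  -- correspond to the graphs.
  rw [Finset.prod_add, expect]
  refine Finset.sum_bij' (fun G _ => G.edgeFinset)
    (fun t _ => SimpleGraph.fromEdgeSet (t : Set (Sym2 (Fin n)))) ?_ ?_ ?_ ?_ ?_
  · intro G _
    rw [Finset.mem_powerset]
    intro e he
    simp only [allEdges, Finset.mem_filter, Finset.mem_univ, true_and]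
    exact G.not_isDiag_of_mem_edgeSet (SimpleGraph.mem_edgeFinset.1 he)
  · intros; simp
  · intro G _; simp
  · intro t ht
    ext e
    simp only [SimpleGraph.mem_edgeFinset, SimpleGraph.edgeSet_fromEdgeSet, Set.mem_sdiff,
      Finset.mem_coe]
    constructor
    · exact fun h => h.1
    · intro h
      have := Finset.mem_powerset.1 ht h
      simp only [allEdges, Finset.mem_filter, Finset.mem_univ, true_and] at this
      exact ⟨h, by simpa using this⟩
  · intro G _
    rw [gnp_singleton, ← Finset.prod_mul_distrib]
    have hs : G.edgeFinset ⊆ allEdges n := by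
      intro e he
      simp only [allEdges, Finset.mem_filter, Finset.mem_univ, true_and]
      exact G.not_isDiag_of_mem_edgeSet (SimpleGraph.mem_edgeFinset.1 he)
    rw [← Finset.prod_sdiff hs, mul_comm]
    congr 1
    · refine Finset.prod_congr rfl fun e he => ?_
      rw [if_pos (SimpleGraph.mem_edgeFinset.1 he), if_pos (SimpleGraph.mem_edgeFinset.1 he)]
    · refine Finset.prod_congr rfl fun e he => ?_
      have : e ∉ G.edgeSet := fun h => (Finset.mem_sdiff.1 he).2 (SimpleGraph.mem_edgeFinset.2 h)
      rw [if_neg this, if_neg this]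

/-- The number of endpoints of `e` in `T`. -/
def endsIn {n : ℕ} (T : Finset (Fin n)) (e : Sym2 (Fin n)) : ℕ := (T.filter (· ∈ e)).card

theorem endsIn_le_two {n : ℕ} (T : Finset (Fin n)) (e : Sym2 (Fin n)) : endsIn T e ≤ 2 := by
  induction e with
  | _ x y =>
    have h : T.filter (· ∈ s(x, y)) ⊆ {x, y} := by
      intro z hz
      simpa using (Finset.mem_filter.1 hz).2
    exact (Finset.card_le_card h).trans Finset.card_le_two

theorem deg_eq_card {n : ℕ} (G : SimpleGraph (Fin n)) (u : Fin n) :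
    deg G u = ((allEdges n).filter (fun e => e ∈ G.edgeSet ∧ u ∈ e)).card := by
  have h1 : deg G u = G.degree u := by
    rw [deg, ← SimpleGraph.card_neighborFinset_eq_degree, Set.ncard_eq_toFinset_card']; rfl
  rw [h1, ← SimpleGraph.card_incidenceFinset_eq_degree]
  congr 1
  ext e
  simp only [SimpleGraph.mem_incidenceFinset, allEdges, Finset.mem_filter, Finset.mem_univ,
    true_and, SimpleGraph.incidenceSet, Set.mem_ofPred_eq]
  exact ⟨fun h => ⟨G.not_isDiag_of_mem_edgeSet h.1, h⟩, fun h => h.2⟩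

/-- Double counting. It turns an exponential of the degrees in `T` into a product of factors that
depend on single edges. -/
theorem sum_deg_eq {n : ℕ} (G : SimpleGraph (Fin n)) (T : Finset (Fin n)) :
    ∑ u ∈ T, deg G u = ∑ e ∈ allEdges n, if e ∈ G.edgeSet then endsIn T e else 0 := by
  simp only [deg_eq_card, Finset.card_filter, endsIn]
  rw [Finset.sum_comm]
  refine Finset.sum_congr rfl fun e _ => ?_
  by_cases h : e ∈ G.edgeSet <;> simp [h]

/-- The same double counting in the complete graph, where all degrees are at most `n`. -/
theorem sum_endsIn_le {n : ℕ} (T : Finset (Fin n)) :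
    ∑ e ∈ allEdges n, endsIn T e ≤ T.card * n := by
  have h := sum_deg_eq (⊤ : SimpleGraph (Fin n)) T
  have h2 : ∑ e ∈ allEdges n, endsIn T e = ∑ u ∈ T, deg (⊤ : SimpleGraph (Fin n)) u := by
    rw [h]
    refine Finset.sum_congr rfl fun e he => ?_
    have : e ∈ (⊤ : SimpleGraph (Fin n)).edgeSet := by
      simpa [allEdges] using he
    rw [if_pos this]
  rw [h2]
  refine (Finset.sum_le_card_nsmul T _ n fun u _ => ?_).trans (by simp)
  rw [deg]
  exact (Set.ncard_le_ncard (Set.subset_univ _)).trans (by simp [Set.ncard_univ])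

/-- By convexity `exp (l k) - 1` lies below its chord from `k = 0` to `k = 2`; then `1 + x ≤ exp x`.
The exponent is linear in `k`, so the bounds of all edges combine through the total number of their
ends in the set. -/
theorem one_add_mul_exp_le {p l : ℝ} (hp : 0 ≤ p) {k : ℕ} (hk : k ≤ 2) :
    p * Real.exp (l * k) + (1 - p) ≤ Real.exp (p * k * ((Real.exp (2 * l) - 1) / 2)) := by
  have h1 : Real.exp (l * k) - 1 ≤ k * ((Real.exp (2 * l) - 1) / 2) := by
    have h2 : Real.exp (2 * l) = Real.exp l ^ 2 := by rw [← Real.exp_nat_mul]; simp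
    interval_cases k
    · simp
    · rw [h2]; simp only [Nat.cast_one, mul_one]; nlinarith [sq_nonneg (Real.exp l - 1)]
    · push_cast; rw [mul_comm l 2]; linarith
  have h3 := Real.add_one_le_exp (p * k * ((Real.exp (2 * l) - 1) / 2))
  nlinarith [mul_le_mul_of_nonneg_left h1 hp]

/-- The expectation factorizes over the edges. A prescribed edge is present with probability `p` and
has at most two ends in `T`, hence the factor `p exp (2 l)`; the other pairs have at most `|T| n`
ends in `T` altogether, and `p n ≤ d`. -/
theorem expect_edges_exp_deg_le {d : ℝ} (hd : 0 ≤ d) {n : ℕ} {l : ℝ} (hl : 0 ≤ l)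
    {F : Finset (Sym2 (Fin n))} (hF : F ⊆ allEdges n) (T : Finset (Fin n)) :
    expect d n (fun G => (if (F : Set _) ⊆ G.edgeSet then 1 else 0) *
        ∏ u ∈ T, Real.exp (l * deg G u)) ≤
      (edgeProb d n * Real.exp (2 * l)) ^ F.card *
        Real.exp (d * ((Real.exp (2 * l) - 1) / 2)) ^ T.card := by
  set p := edgeProb d n with hp
  have hp0 : 0 ≤ p := edgeProb_nonneg d n
  set M := (Real.exp (2 * l) - 1) / 2 with hM
  have hM0 : 0 ≤ M := by
    have := Real.one_le_exp (show 0 ≤ 2 * l by positivity)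
    rw [hM]; linarith
  have h1 : ∀ G : SimpleGraph (Fin n), (if (F : Set _) ⊆ G.edgeSet then (1 : ℝ) else 0) *
      ∏ u ∈ T, Real.exp (l * deg G u) = ∏ e ∈ allEdges n, if e ∈ G.edgeSet then
        Real.exp (l * endsIn T e) else (if e ∈ F then 0 else 1) := by
    intro G
    rw [← Real.exp_sum, ← Finset.mul_sum, ← Nat.cast_sum, sum_deg_eq]
    -- A missing edge of `F` contributes the factor zero, so the product carries the indicator of `F
    -- ⊆ G`.
    have : ∀ e, (if e ∈ G.edgeSet then Real.exp (l * endsIn T e) else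
        (if e ∈ F then 0 else 1)) = (if e ∈ F ∧ e ∉ G.edgeSet then 0 else 1) *
          Real.exp (l * ((if e ∈ G.edgeSet then endsIn T e else 0 : ℕ) : ℝ)) := by
      intro e
      by_cases h : e ∈ G.edgeSet <;> by_cases h' : e ∈ F <;> simp [h, h']
    simp only [this]
    rw [Finset.prod_mul_distrib, ← Real.exp_sum, ← Finset.mul_sum, ← Nat.cast_sum]
    congr 1
    split_ifs with h
    · rw [Finset.prod_congr rfl fun e _ => if_neg fun he => he.2 (h he.1)]
      simp
    · obtain ⟨e, he, he'⟩ := Set.not_subset.1 h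
      refine (Finset.prod_eq_zero (hF (Finset.mem_coe.1 he)) ?_).symm
      exact if_pos ⟨Finset.mem_coe.1 he, he'⟩
  simp only [h1]
  rw [expect_prod, ← Finset.prod_sdiff hF, mul_comm]
  refine mul_le_mul ?_ ?_ (Finset.prod_nonneg fun e he => ?_) (by positivity)
  · rw [← Finset.prod_const]
    refine Finset.prod_le_prod (fun e he => ?_) fun e he => ?_
    · rw [if_pos he, mul_zero, add_zero]; positivity
    · rw [if_pos he, mul_zero, add_zero]
      refine mul_le_mul_of_nonneg_left (Real.exp_le_exp.2 ?_) hp0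
      rw [mul_comm]
      exact mul_le_mul_of_nonneg_right (by exact_mod_cast endsIn_le_two T e) hl
  · calc ∏ e ∈ allEdges n \ F, (p * Real.exp (l * endsIn T e) + (1 - p) * if e ∈ F then 0 else 1)
        ≤ ∏ e ∈ allEdges n \ F, Real.exp (p * endsIn T e * M) := by
          refine Finset.prod_le_prod (fun e he => ?_) fun e he => ?_
          · have := edgeProb_le_one d n
            have : 0 ≤ 1 - p := by linarith
            have : (0 : ℝ) ≤ if e ∈ F then 0 else 1 := by split_ifs <;> norm_num
            positivity
          · rw [if_neg (Finset.mem_sdiff.1 he).2, mul_one]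
            exact one_add_mul_exp_le hp0 (endsIn_le_two T e)
      _ = Real.exp (p * M * ∑ e ∈ allEdges n \ F, (endsIn T e : ℝ)) := by
          rw [← Real.exp_sum, Finset.mul_sum]
          exact congrArg _ (Finset.sum_congr rfl fun e _ => by ring)
      _ ≤ Real.exp (T.card * (d * M)) := by
          refine Real.exp_le_exp.2 ?_
          have h2 : ∑ e ∈ allEdges n \ F, (endsIn T e : ℝ) ≤ T.card * n := by
            refine (Finset.sum_le_sum_of_subset_of_nonneg Finset.sdiff_subset
              fun _ _ _ => Nat.cast_nonneg _).trans ?_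
            exact_mod_cast sum_endsIn_le T
          have h3 := edgeProb_mul_le hd n
          calc p * M * ∑ e ∈ allEdges n \ F, (endsIn T e : ℝ) ≤ p * M * (T.card * n) :=
                mul_le_mul_of_nonneg_left h2 (by positivity)
            _ = (p * n) * (M * T.card) := by ring
            _ ≤ d * (M * T.card) := mul_le_mul_of_nonneg_right h3 (by positivity)
            _ = T.card * (d * M) := by ring
      _ = _ := by rw [Real.exp_nat_mul]
  · have := edgeProb_le_one d n
    have : 0 ≤ 1 - p := by linarith
    have : (0 : ℝ) ≤ if e ∈ F then 0 else 1 := by split_ifs <;> norm_num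
    positivity

theorem prob_edges_le {d : ℝ} (hd : 0 ≤ d) {n : ℕ}
    {F : Finset (Sym2 (Fin n))} (hF : F ⊆ allEdges n) :
    expect d n (fun G => if (F : Set _) ⊆ G.edgeSet then 1 else 0) ≤ edgeProb d n ^ F.card := by
  simpa using expect_edges_exp_deg_le hd (le_refl 0) hF ∅

/-- If a power of the weight is dominated by `κ + A * exp (l * Δ)`, the expectation of a product of
weights on the event that certain edges are present is bounded by a power. -/
theorem expect_edges_prod_weight_le {θ : Params} (hd : 0 ≤ θ.d) {n : ℕ} {l κ A q : ℝ} {t : ℕ}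
    (hl : 0 ≤ l) (hκ : 0 ≤ κ) (hA : 0 ≤ A)
    (hw : ∀ (G : SimpleGraph (Fin n)) u, 0 ≤ weight θ G u ∧
      weight θ G u ^ t ≤ κ + A * Real.exp (l * deg G u))
    (hq : κ + A * Real.exp (θ.d * ((Real.exp (2 * l) - 1) / 2)) ≤ q)
    {F : Finset (Sym2 (Fin n))} (hF : F ⊆ allEdges n) (U : Finset (Fin n)) :
    expect θ.d n (fun G => (if (F : Set _) ⊆ G.edgeSet then 1 else 0) *
        ∏ u ∈ U, weight θ G u ^ t) ≤
      (edgeProb θ.d n * Real.exp (2 * l)) ^ F.card * q ^ U.card := by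
  set X := Real.exp (θ.d * ((Real.exp (2 * l) - 1) / 2)) with hX
  have hp0 := edgeProb_nonneg θ.d n
  calc _ ≤ expect θ.d n (fun G => (if (F : Set _) ⊆ G.edgeSet then 1 else 0) *
        ∏ u ∈ U, (A * Real.exp (l * deg G u) + κ)) := by
        refine expect_mono fun G => mul_le_mul_of_nonneg_left ?_ (by split_ifs <;> norm_num)
        refine Finset.prod_le_prod (fun u _ => pow_nonneg (hw G u).1 _) fun u _ => ?_
        rw [add_comm]; exact (hw G u).2
    -- Expansion over the set `T` of vertices that take the exponential term; after the expectation
    -- has been bounded, the same expansion is folded back.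
    _ = ∑ T ∈ U.powerset, A ^ T.card * κ ^ (U \ T).card *
          expect θ.d n (fun G => (if (F : Set _) ⊆ G.edgeSet then 1 else 0) *
            ∏ u ∈ T, Real.exp (l * deg G u)) := by
        simp only [Finset.prod_add, Finset.mul_sum]
        rw [expect_sum]
        refine Finset.sum_congr rfl fun T _ => ?_
        rw [← expect_const_mul]
        refine congrArg _ (funext fun G => ?_)
        rw [Finset.prod_mul_distrib, Finset.prod_const, Finset.prod_const]
        ring
    _ ≤ ∑ T ∈ U.powerset, A ^ T.card * κ ^ (U \ T).card *
          ((edgeProb θ.d n * Real.exp (2 * l)) ^ F.card * X ^ T.card) := by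
        refine Finset.sum_le_sum fun T _ => mul_le_mul_of_nonneg_left ?_ (by positivity)
        exact expect_edges_exp_deg_le hd hl hF T
    _ = (edgeProb θ.d n * Real.exp (2 * l)) ^ F.card * (A * X + κ) ^ U.card := by
        rw [← Finset.prod_const (s := U), Finset.prod_add, Finset.mul_sum]
        refine Finset.sum_congr rfl fun T _ => ?_
        rw [Finset.prod_const, Finset.prod_const, mul_pow]
        ring
    _ ≤ _ := by
        refine mul_le_mul_of_nonneg_left ?_ (by positivity)
        have : 0 ≤ X := Real.exp_nonneg _
        exact pow_le_pow_left₀ (by positivity) (by linarith) _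

end Moments

/-! ### Union bounds for small dense sets, heavy connected sets and paths -/

section UnionBounds

open MeasureTheory Classical

variable {n : ℕ}

/-- The pairs of distinct elements of `S`. -/
def pairsIn (S : Finset (Fin n)) : Finset (Sym2 (Fin n)) :=
  (allEdges n).filter (fun e => ∀ x ∈ e, x ∈ S)

/-- The number of edges spanned by `S`. -/
def spanned (G : SimpleGraph (Fin n)) (S : Finset (Fin n)) : ℕ :=
  ((pairsIn S).filter (· ∈ G.edgeSet)).card

theorem pairsIn_subset (S : Finset (Fin n)) : pairsIn S ⊆ allEdges n := Finset.filter_subset _ _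

theorem card_pairsIn_le (S : Finset (Fin n)) : (pairsIn S).card ≤ S.card ^ 2 := by
  have h : pairsIn S ⊆ (S ×ˢ S).image (fun x => s(x.1, x.2)) := by
    intro e
    induction e with
    | _ x y =>
      intro h
      have h2 := (Finset.mem_filter.1 h).2
      exact Finset.mem_image.2 ⟨(x, y), Finset.mem_product.2 ⟨h2 x (by simp), h2 y (by simp)⟩, rfl⟩
  refine (Finset.card_le_card h).trans (Finset.card_image_le.trans ?_)
  rw [Finset.card_product, sq]

theorem prob_le_of_forall {d : ℝ} {A : Set (SimpleGraph (Fin n))} {f : SimpleGraph (Fin n) → ℝ}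
    (hf : ∀ G, 0 ≤ f G) (h : ∀ G ∈ A, 1 ≤ f G) : (gnp d n).real A ≤ expect d n f := by
  rw [prob_eq_expect]
  refine expect_mono fun G => ?_
  split_ifs with hG
  · exact h G hG
  · exact hf G

theorem exists_edges_of_le_spanned {G : SimpleGraph (Fin n)} {S : Finset (Fin n)} {k : ℕ}
    (h : k ≤ spanned G S) :
    ∃ F ∈ (pairsIn S).powersetCard k, (F : Set (Sym2 (Fin n))) ⊆ G.edgeSet := by
  obtain ⟨F, hF, hk⟩ := Finset.exists_subset_card_eq h
  refine ⟨F, Finset.mem_powersetCard.2 ⟨hF.trans (Finset.filter_subset _ _), hk⟩, fun e he => ?_⟩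
  exact (Finset.mem_filter.1 (hF he)).2

theorem choose_card_pairsIn_le (S : Finset (Fin n)) (j : ℕ) :
    ((((pairsIn S).powersetCard j).card : ℕ) : ℝ) ≤ ((S.card : ℝ) ^ 2) ^ j / j.factorial := by
  rw [Finset.card_powersetCard]
  refine (Nat.choose_le_pow_div j _).trans ?_
  gcongr
  exact_mod_cast card_pairsIn_le S

theorem pow_div_factorial_le (k : ℕ) : (k : ℝ) ^ k / k.factorial ≤ Real.exp 1 ^ k := by
  rw [← Real.exp_nat_mul, mul_one]
  exact Real.pow_div_factorial_le_exp _ (Nat.cast_nonneg k) k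

/-- A set is dense if it spans more edges than it has vertices. -/
def HasDenseSet (G : SimpleGraph (Fin n)) (m : ℝ) : Prop :=
  ∃ S : Finset (Fin n), (S.card : ℝ) ≤ m ∧ S.card + 1 ≤ spanned G S

/-- The `k + 1` edges against about `n ^ k` sets leave one factor `d / n`. The factorials turn the
powers of `k` into two factors `e ^ k`, and the one remaining `k` is at most `e ^ k` as well. -/
theorem dense_term_le {d : ℝ} (hd : 1 ≤ d) (hn : 0 < n) (k : ℕ) :
    (n.choose k : ℝ) * (((k : ℝ) ^ 2) ^ (k + 1) / (k + 1).factorial * edgeProb d n ^ (k + 1)) ≤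
      d / n * (Real.exp 1 ^ 3 * d) ^ k := by
  have hd0 : 0 ≤ d := by linarith
  have hp0 := edgeProb_nonneg d n
  have hp1 := edgeProb_le hd0 n
  have hpn := edgeProb_mul_le hd0 n
  have h1 : (n.choose k : ℝ) ≤ (n : ℝ) ^ k / k.factorial := Nat.choose_le_pow_div k n
  have hk := pow_div_factorial_le k
  have hk2 : (k : ℝ) ^ (k + 1) / (k + 1).factorial ≤ Real.exp 1 ^ k := by
    have : (k : ℝ) ^ (k + 1) / (k + 1).factorial ≤ (k : ℝ) ^ k / k.factorial := by
      rw [Nat.factorial_succ, pow_succ, div_le_div_iff₀ (by positivity) (by positivity)]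
      push_cast
      have : (k : ℝ) ^ k * k.factorial * k ≤ (k : ℝ) ^ k * k.factorial * (k + 1) :=
        mul_le_mul_of_nonneg_left (by linarith) (by positivity)
      nlinarith
    exact this.trans hk
  have hk3 : (k : ℝ) ≤ Real.exp 1 ^ k := by
    rw [← Real.exp_nat_mul, mul_one]
    linarith [Real.add_one_le_exp (k : ℝ)]
  calc _ ≤ (n : ℝ) ^ k / k.factorial *
        (((k : ℝ) ^ 2) ^ (k + 1) / (k + 1).factorial * edgeProb d n ^ (k + 1)) := by gcongr
    _ = ((k : ℝ) ^ k / k.factorial) * ((k : ℝ) ^ (k + 1) / (k + 1).factorial) * k *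
          ((edgeProb d n * n) ^ k * edgeProb d n) := by
        rw [← pow_mul, show 2 * (k + 1) = k + (k + 1) + 1 by ring]
        simp only [pow_add, pow_one, mul_pow]
        field_simp
    _ ≤ Real.exp 1 ^ k * Real.exp 1 ^ k * Real.exp 1 ^ k * (d ^ k * (d / n)) := by gcongr
    _ = _ := by rw [mul_pow, ← pow_mul, mul_comm 3 k, pow_mul']; ring

theorem prob_hasDenseSet_le {d : ℝ} (hd : 1 ≤ d) (hn : 0 < n) (m : ℝ) :
    (gnp d n).real {G | HasDenseSet G m} ≤
      (⌊m⌋₊ + 1) * (d / n * (Real.exp 1 ^ 3 * d) ^ ⌊m⌋₊) := by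
  have hd0 : 0 ≤ d := by linarith
  calc _ ≤ expect d n (fun G => ∑ k ∈ Finset.range (⌊m⌋₊ + 1),
        ∑ S ∈ (Finset.univ : Finset (Fin n)).powersetCard k,
          ∑ F ∈ (pairsIn S).powersetCard (k + 1), if (F : Set _) ⊆ G.edgeSet then 1 else 0) := by
        have hnn : ∀ (G : SimpleGraph (Fin n)) (F : Finset (Sym2 (Fin n))),
            (0 : ℝ) ≤ if (F : Set _) ⊆ G.edgeSet then 1 else 0 := by
          intro G F; split_ifs <;> norm_num
        refine prob_le_of_forall (fun G => ?_) fun G hG => ?_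
        · exact Finset.sum_nonneg fun _ _ => Finset.sum_nonneg fun _ _ => Finset.sum_nonneg
            fun F _ => hnn G F
        · obtain ⟨S, hS, hS2⟩ := hG
          obtain ⟨F, hF, hFG⟩ := exists_edges_of_le_spanned hS2
          refine le_trans ?_ (Finset.single_le_sum (a := S.card) (fun _ _ => Finset.sum_nonneg
            fun _ _ => Finset.sum_nonneg fun F _ => hnn G F)
            (Finset.mem_range.2 (Nat.lt_succ_of_le (Nat.le_floor hS))))
          refine le_trans ?_ (Finset.single_le_sum (a := S) (fun _ _ => Finset.sum_nonneg
            fun F _ => hnn G F) (Finset.mem_powersetCard.2 ⟨Finset.subset_univ _, rfl⟩))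
          refine le_trans ?_ (Finset.single_le_sum (a := F) (fun F _ => hnn G F) hF)
          rw [if_pos hFG]
    _ = ∑ k ∈ Finset.range (⌊m⌋₊ + 1), ∑ S ∈ (Finset.univ : Finset (Fin n)).powersetCard k,
          ∑ F ∈ (pairsIn S).powersetCard (k + 1),
            expect d n (fun G => if (F : Set _) ⊆ G.edgeSet then 1 else 0) := by
        simp only [expect_sum]
    _ ≤ ∑ k ∈ Finset.range (⌊m⌋₊ + 1), ∑ S ∈ (Finset.univ : Finset (Fin n)).powersetCard k,
          ((k : ℝ) ^ 2) ^ (k + 1) / (k + 1).factorial * edgeProb d n ^ (k + 1) := by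
        refine Finset.sum_le_sum fun k _ => Finset.sum_le_sum fun S hS => ?_
        have hk := (Finset.mem_powersetCard.1 hS).2
        refine (Finset.sum_le_card_nsmul _ _ (edgeProb d n ^ (k + 1)) fun F hF => ?_).trans ?_
        · have hF := Finset.mem_powersetCard.1 hF
          have := prob_edges_le hd0 (hF.1.trans (pairsIn_subset S))
          rwa [hF.2] at this
        · rw [nsmul_eq_mul]
          have := choose_card_pairsIn_le S (k + 1)
          rw [hk] at this
          exact mul_le_mul_of_nonneg_right this (pow_nonneg (edgeProb_nonneg d n) _)
    _ ≤ ∑ k ∈ Finset.range (⌊m⌋₊ + 1), d / n * (Real.exp 1 ^ 3 * d) ^ ⌊m⌋₊ := by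
        refine Finset.sum_le_sum fun k hk => ?_
        rw [Finset.sum_const, Finset.card_powersetCard, Finset.card_univ, Fintype.card_fin,
          nsmul_eq_mul]
        refine (dense_term_le hd hn k).trans ?_
        have h1 : 1 ≤ Real.exp 1 ^ 3 * d := by
          have : 1 ≤ Real.exp 1 ^ 3 := one_le_pow₀ (Real.one_le_exp zero_le_one)
          nlinarith
        exact mul_le_mul_of_nonneg_left (pow_le_pow_right₀ h1
          (Nat.lt_succ_iff.1 (Finset.mem_range.1 hk))) (by positivity)
    _ = _ := by simp

/-- A large set that spans almost as many edges as a tree and has a large part whose weights have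
product greater than one. -/
def HasHeavySet (θ : Params) (G : SimpleGraph (Fin n)) (m : ℝ) : Prop :=
  ∃ S U : Finset (Fin n), m ≤ S.card ∧ 0 < S.card ∧ S.card ≤ spanned G S + 1 ∧ U ⊆ S ∧
    S.card ≤ 13 * U.card ∧ 1 < ∏ u ∈ U, weight θ G u

/-- Only `k - 1` edges are available against `n ^ k` sets, which leaves a factor `n`. The constant
`2 e ^ 3` consists of the choices of the heavy part, of `e ^ 2` from the two factorials, and of `e`
from the factors `exp (2 l)` of the edges. -/
theorem heavy_term_le {d l r : ℝ} (hd : 1 ≤ d) (hl : 2 * l ≤ 1) (hr : 0 ≤ r)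
    {k : ℕ} (hk : 0 < k) :
    (n.choose k : ℝ) * (((k : ℝ) ^ 2) ^ (k - 1) / (k - 1).factorial *
      (2 ^ k * ((edgeProb d n * Real.exp (2 * l)) ^ (k - 1) * r ^ k))) ≤
      n * (2 * Real.exp 1 ^ 3 * d * r) ^ k := by
  have hd0 : 0 ≤ d := by linarith
  have hp0 := edgeProb_nonneg d n
  have hpn := edgeProb_mul_le hd0 n
  have h1 : (n.choose k : ℝ) ≤ (n : ℝ) ^ k / k.factorial := Nat.choose_le_pow_div k n
  have hk1 := pow_div_factorial_le k
  obtain ⟨j, rfl⟩ : ∃ j, k = j + 1 := ⟨k - 1, by omega⟩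
  simp only [Nat.add_sub_cancel] at *
  have hk2 : ((j + 1 : ℕ) : ℝ) ^ j / j.factorial ≤ Real.exp 1 ^ (j + 1) := by
    have : ((j + 1 : ℕ) : ℝ) ^ j / j.factorial = ((j + 1 : ℕ) : ℝ) ^ (j + 1) / (j + 1).factorial := by
      rw [Nat.factorial_succ, pow_succ]
      push_cast
      field_simp
    rw [this]; exact hk1
  have hk3 : (1 : ℝ) ≤ (j + 1 : ℕ) := by exact_mod_cast Nat.succ_le_succ (Nat.zero_le j)
  have he : Real.exp (2 * l) ≤ Real.exp 1 := Real.exp_le_exp.2 hl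
  have he1 : 1 ≤ Real.exp 1 := Real.one_le_exp zero_le_one
  generalize hK : ((j + 1 : ℕ) : ℝ) = K at *
  calc _ ≤ (n : ℝ) ^ (j + 1) / (j + 1).factorial * ((K ^ 2) ^ j / j.factorial *
      (2 ^ (j + 1) * ((edgeProb d n * Real.exp (2 * l)) ^ j * r ^ (j + 1)))) := by gcongr
    _ = (K ^ j / (j + 1).factorial) * (K ^ j / j.factorial) *
          (n * (edgeProb d n * n) ^ j * Real.exp (2 * l) ^ j * 2 ^ (j + 1) * r ^ (j + 1)) := by
        rw [← pow_mul, show 2 * j = j + j by ring]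
        simp only [pow_add, pow_one, mul_pow]
        field_simp
    _ ≤ (K ^ (j + 1) / (j + 1).factorial) * (K ^ j / j.factorial) *
          (n * d ^ (j + 1) * Real.exp 1 ^ (j + 1) * 2 ^ (j + 1) * r ^ (j + 1)) := by
        have hx : (edgeProb d n * n) ^ j ≤ d ^ (j + 1) :=
          (pow_le_pow_left₀ (by positivity) hpn j).trans (pow_le_pow_right₀ hd (Nat.le_succ j))
        have hy : Real.exp (2 * l) ^ j ≤ Real.exp 1 ^ (j + 1) :=
          (pow_le_pow_left₀ (by positivity) he j).trans (pow_le_pow_right₀ he1 (Nat.le_succ j))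
        have hz : K ^ j ≤ K ^ (j + 1) := pow_le_pow_right₀ hk3 (Nat.le_succ j)
        have hK0 : 0 ≤ K := by linarith
        gcongr
    _ ≤ Real.exp 1 ^ (j + 1) * Real.exp 1 ^ (j + 1) *
          (n * d ^ (j + 1) * Real.exp 1 ^ (j + 1) * 2 ^ (j + 1) * r ^ (j + 1)) := by
        have hK0 : 0 ≤ K := by linarith
        gcongr
    _ = _ := by simp only [mul_pow]; ring

/-- Markov's inequality for the `t`-th power of the product of weights, with a union bound over the
set, its edges and its heavy part. Since the heavy part contains a thirteenth of the set, `q ≤ r ^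
13` provides a factor `r` for every vertex of the whole set. -/
theorem prob_hasHeavySet_le {θ : Params} (hd : 1 ≤ θ.d) {l κ A q r : ℝ} {t : ℕ} {m : ℝ}
    (hl : 0 ≤ l) (hl1 : 2 * l ≤ 1) (hκ : 0 ≤ κ) (hA : 0 ≤ A)
    (hw : ∀ (G : SimpleGraph (Fin n)) u, 0 ≤ weight θ G u ∧
      weight θ G u ^ t ≤ κ + A * Real.exp (l * deg G u))
    (hq : κ + A * Real.exp (θ.d * ((Real.exp (2 * l) - 1) / 2)) ≤ q)
    (hr : 0 ≤ r) (hqr : q ≤ r ^ 13) (hr1 : r ≤ 1) (hx : 2 * Real.exp 1 ^ 3 * θ.d * r ≤ 1) :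
    (gnp θ.d n).real {G | HasHeavySet θ G m} ≤
      (n + 1) * (n * (2 * Real.exp 1 ^ 3 * θ.d * r) ^ ⌈m⌉₊) := by
  have hd0 : 0 ≤ θ.d := by linarith
  have hp0 := edgeProb_nonneg θ.d n
  have hq0 : 0 ≤ q := le_trans (by positivity) hq
  set I := (Finset.range (n + 1)).filter (fun k => 0 < k ∧ ⌈m⌉₊ ≤ k) with hI
  have hnn : ∀ (G : SimpleGraph (Fin n)) (F : Finset (Sym2 (Fin n))) (U : Finset (Fin n)),
      0 ≤ (if (F : Set _) ⊆ G.edgeSet then (1 : ℝ) else 0) * ∏ u ∈ U, weight θ G u ^ t := by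
    intro G F U
    have : 0 ≤ ∏ u ∈ U, weight θ G u ^ t :=
      Finset.prod_nonneg fun u _ => pow_nonneg (hw G u).1 t
    split_ifs
    · simpa using this
    · simp
  calc _ ≤ expect θ.d n (fun G => ∑ k ∈ I,
        ∑ S ∈ (Finset.univ : Finset (Fin n)).powersetCard k,
          ∑ F ∈ (pairsIn S).powersetCard (k - 1), ∑ U ∈ S.powerset.filter (fun U => k ≤ 13 * U.card),
            (if (F : Set _) ⊆ G.edgeSet then 1 else 0) * ∏ u ∈ U, weight θ G u ^ t) := by
        refine prob_le_of_forall (fun G => ?_) fun G hG => ?_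
        · exact Finset.sum_nonneg fun _ _ => Finset.sum_nonneg fun _ _ => Finset.sum_nonneg
            fun F _ => Finset.sum_nonneg fun U _ => hnn G F U
        · obtain ⟨S, U, hmS, hS0, hS, hUS, hSU, hU⟩ := hG
          obtain ⟨F, hF, hFG⟩ := exists_edges_of_le_spanned (G := G) (S := S) (k := S.card - 1) (by omega)
          refine le_trans ?_ (Finset.single_le_sum (a := S.card) (fun _ _ => Finset.sum_nonneg
            fun _ _ => Finset.sum_nonneg fun F _ => Finset.sum_nonneg fun U _ => hnn G F U)
            (Finset.mem_filter.2 ⟨Finset.mem_range.2 (Nat.lt_succ_of_le ?_), hS0, Nat.ceil_le.2 hmS⟩))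
          · refine le_trans ?_ (Finset.single_le_sum (a := S) (fun _ _ => Finset.sum_nonneg
              fun F _ => Finset.sum_nonneg fun U _ => hnn G F U)
              (Finset.mem_powersetCard.2 ⟨Finset.subset_univ _, rfl⟩))
            refine le_trans ?_ (Finset.single_le_sum (a := F) (fun F _ =>
              Finset.sum_nonneg fun U _ => hnn G F U) hF)
            refine le_trans ?_ (Finset.single_le_sum (a := U) (fun U _ => hnn G F U)
              (Finset.mem_filter.2 ⟨Finset.mem_powerset.2 hUS, hSU⟩))
            rw [if_pos hFG, one_mul, Finset.prod_pow]
            exact one_le_pow₀ hU.le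
          · simpa using Finset.card_le_univ S
    _ = ∑ k ∈ I, ∑ S ∈ (Finset.univ : Finset (Fin n)).powersetCard k,
          ∑ F ∈ (pairsIn S).powersetCard (k - 1), ∑ U ∈ S.powerset.filter (fun U => k ≤ 13 * U.card),
            expect θ.d n (fun G => (if (F : Set _) ⊆ G.edgeSet then 1 else 0) *
              ∏ u ∈ U, weight θ G u ^ t) := by
        simp only [expect_sum]
    _ ≤ ∑ k ∈ I, ∑ S ∈ (Finset.univ : Finset (Fin n)).powersetCard k,
          (((k : ℝ) ^ 2) ^ (k - 1) / (k - 1).factorial *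
            (2 ^ k * ((edgeProb θ.d n * Real.exp (2 * l)) ^ (k - 1) * r ^ k))) := by
        refine Finset.sum_le_sum fun k _ => Finset.sum_le_sum fun S hS => ?_
        have hk := (Finset.mem_powersetCard.1 hS).2
        have hb : 0 ≤ (edgeProb θ.d n * Real.exp (2 * l)) ^ (k - 1) * r ^ k := by positivity
        refine (Finset.sum_le_card_nsmul _ _
          (2 ^ k * ((edgeProb θ.d n * Real.exp (2 * l)) ^ (k - 1) * r ^ k)) fun F hF => ?_).trans ?_
        · refine (Finset.sum_le_card_nsmul _ _
            ((edgeProb θ.d n * Real.exp (2 * l)) ^ (k - 1) * r ^ k) fun U hU => ?_).trans ?_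
          · have hF := Finset.mem_powersetCard.1 hF
            have hU := (Finset.mem_filter.1 hU).2
            have := expect_edges_prod_weight_le hd0 hl hκ hA hw hq (hF.1.trans (pairsIn_subset S)) U
            rw [hF.2] at this
            refine this.trans (mul_le_mul_of_nonneg_left ?_ (by positivity))
            calc q ^ U.card ≤ (r ^ 13) ^ U.card := pow_le_pow_left₀ hq0 hqr _
              _ = r ^ (13 * U.card) := by rw [pow_mul]
              _ ≤ r ^ k := pow_le_pow_of_le_one hr hr1 hU
          · rw [nsmul_eq_mul]
            refine mul_le_mul_of_nonneg_right ?_ hb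
            have := Finset.card_filter_le S.powerset (fun U => k ≤ 13 * U.card)
            rw [Finset.card_powerset, hk] at this
            exact_mod_cast this
        · rw [nsmul_eq_mul]
          have := choose_card_pairsIn_le S (k - 1)
          rw [hk] at this
          exact mul_le_mul_of_nonneg_right this (by positivity)
    _ ≤ ∑ k ∈ I, n * (2 * Real.exp 1 ^ 3 * θ.d * r) ^ ⌈m⌉₊ := by
        refine Finset.sum_le_sum fun k hk => ?_
        have hk := (Finset.mem_filter.1 hk).2
        rw [Finset.sum_const, Finset.card_powersetCard, Finset.card_univ, Fintype.card_fin,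
          nsmul_eq_mul]
        refine (heavy_term_le hd hl1 hr hk.1).trans ?_
        exact mul_le_mul_of_nonneg_left (pow_le_pow_of_le_one (by positivity) hx hk.2)
          (by positivity)
    _ ≤ _ := by
        rw [Finset.sum_const, nsmul_eq_mul]
        refine mul_le_mul_of_nonneg_right ?_ (by positivity)
        have := Finset.card_filter_le (Finset.range (n + 1)) (fun k => 0 < k ∧ ⌈m⌉₊ ≤ k)
        rw [Finset.card_range] at this
        exact_mod_cast this

/-- The injective sequences of `k + 1` vertices with consecutive vertices adjacent. -/
def pathSeqs (G : SimpleGraph (Fin n)) (k : ℕ) : Finset (Fin (k + 1) → Fin n) :=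
  Finset.univ.filter fun f => Function.Injective f ∧ ∀ i : Fin k, G.Adj (f i.castSucc) (f i.succ)

/-- The number of (directed) paths with at most `K` edges. -/
def pathCount (G : SimpleGraph (Fin n)) (K : ℕ) : ℕ :=
  ∑ k ∈ Finset.range (K + 1), (pathSeqs G k).card

/-- An injective sequence uses `k` distinct edges, so each of the at most `n ^ (k + 1)` sequences is
a path with probability at most `p ^ k`, and `p n ≤ d`. -/
theorem expect_pathSeqs_le {d : ℝ} (hd : 0 ≤ d) (k : ℕ) :
    expect d n (fun G => ((pathSeqs G k).card : ℝ)) ≤ n * d ^ k := by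
  set E : (Fin (k + 1) → Fin n) → Finset (Sym2 (Fin n)) :=
    fun f => Finset.univ.image (fun i : Fin k => s(f i.castSucc, f i.succ)) with hE
  have hp0 := edgeProb_nonneg d n
  calc _ = ∑ f : Fin (k + 1) → Fin n, expect d n (fun G => if f ∈ pathSeqs G k then 1 else 0) := by
        rw [← expect_sum]
        refine congrArg _ (funext fun G => ?_)
        simp
    _ ≤ ∑ f : Fin (k + 1) → Fin n, edgeProb d n ^ k := by
        refine Finset.sum_le_sum fun f _ => ?_
        by_cases hf : Function.Injective f
        · have hcard : (E f).card = k := by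
            rw [hE, Finset.card_image_of_injective, Finset.card_univ, Fintype.card_fin]
            intro i j hij
            simp only [Sym2.eq_iff] at hij
            rcases hij with ⟨h1, -⟩ | ⟨h1, h2⟩
            · simpa using hf h1
            · have h1 := congrArg Fin.val (hf h1)
              have h2 := congrArg Fin.val (hf h2)
              simp at h1 h2
              omega
          have hsub : E f ⊆ allEdges n := by
            intro e he
            obtain ⟨i, -, rfl⟩ := Finset.mem_image.1 he
            simp only [allEdges, Finset.mem_filter, Finset.mem_univ, true_and, Sym2.mk_isDiag_iff]
            intro h
            have := congrArg Fin.val (hf h)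
            simp at this
          have := prob_edges_le hd hsub
          rw [hcard] at this
          refine le_trans (expect_mono fun G => ?_) this
          split_ifs with h1 h2 h2
          · exact le_refl _
          · refine absurd (fun e he => ?_) h2
            obtain ⟨i, -, rfl⟩ := Finset.mem_image.1 (Finset.mem_coe.1 he)
            exact (Finset.mem_filter.1 h1).2.2 i
          · norm_num
          · exact le_refl _
        · have : ∀ G : SimpleGraph (Fin n), (if f ∈ pathSeqs G k then (1 : ℝ) else 0) = 0 :=
            fun G => if_neg fun h => hf (Finset.mem_filter.1 h).2.1
          simp only [this, expect, mul_zero, Finset.sum_const_zero]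
          positivity
    _ = n * (edgeProb d n * n) ^ k := by
        simp [mul_pow, pow_succ]; ring
    _ ≤ _ := by
        have := edgeProb_mul_le hd n
        gcongr

theorem prob_pathCount_le {d : ℝ} (hd : 1 ≤ d) (hn : 0 < n) (K : ℕ) :
    (gnp d n).real {G | n ^ 3 < pathCount G K} ≤ (K + 1) * d ^ K / n ^ 2 := by
  have hd0 : 0 ≤ d := by linarith
  have hn' : (0 : ℝ) < n := by exact_mod_cast hn
  calc _ ≤ expect d n (fun G => ((n : ℝ) ^ 3)⁻¹ * (∑ k ∈ Finset.range (K + 1), ((pathSeqs G k).card : ℝ))) := by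
        refine prob_le_of_forall (fun G => by positivity) fun G hG => ?_
        have hG : n ^ 3 < pathCount G K := hG
        have : ((n : ℝ)) ^ 3 ≤ ∑ k ∈ Finset.range (K + 1), ((pathSeqs G k).card : ℝ) := by
          have := hG.le
          rw [pathCount] at this
          exact_mod_cast this
        rw [inv_mul_eq_div, le_div_iff₀ (by positivity), one_mul]
        exact this
    _ = ((n : ℝ) ^ 3)⁻¹ * ∑ k ∈ Finset.range (K + 1), expect d n (fun G => ((pathSeqs G k).card : ℝ)) := by
        rw [expect_const_mul, expect_sum]
    _ ≤ ((n : ℝ) ^ 3)⁻¹ * ∑ k ∈ Finset.range (K + 1), n * d ^ K := by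
        refine mul_le_mul_of_nonneg_left (Finset.sum_le_sum fun k hk => ?_) (by positivity)
        refine (expect_pathSeqs_le hd0 k).trans ?_
        exact mul_le_mul_of_nonneg_left (pow_le_pow_right₀ hd
          (Nat.lt_succ_iff.1 (Finset.mem_range.1 hk))) hn'.le
    _ = _ := by
        simp only [Finset.sum_const, Finset.card_range, nsmul_eq_mul]
        push_cast
        field_simp

end UnionBounds

/-! ### Choice of the parameters, and the limit for large `n` -/

section Asymptotics

open MeasureTheory

/-- A power of the weight is dominated by an exponential function of the degree. -/
theorem weight_pow_le {θ : Params} (hα : 0 < θ.α) (hγ : 0 < θ.γ) (hd : 0 < θ.d) {l : ℝ} {t : ℕ}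
    (ht : (t : ℝ) ≤ l * ((1 + θ.α) * θ.d)) {n : ℕ} (G : SimpleGraph (Fin n)) (u : Fin n) :
    0 ≤ weight θ G u ∧ weight θ G u ^ t ≤ ((1 + θ.γ)⁻¹) ^ t +
      Real.exp (-(l * ((1 + θ.α) * θ.d))) * (θ.d ^ θ.c * ((1 + θ.α) * θ.d)) ^ t *
        Real.exp (l * (deg G u : ℝ)) := by
  have hγ' : 0 < 1 + θ.γ := by linarith
  have hα' : 0 < 1 + θ.α := by linarith
  have hc : 0 < θ.d ^ θ.c := Real.rpow_pos_of_pos hd _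
  set D := (1 + θ.α) * θ.d with hD
  have hD0 : 0 < D := by positivity
  unfold weight
  split_ifs with h
  · exact ⟨by positivity, le_add_of_nonneg_right (by positivity)⟩
  · refine ⟨by positivity, ?_⟩
    have h : D < (deg G u : ℝ) := not_le.1 h
    set x : ℝ := (deg G u : ℝ)
    -- From `y ≤ exp (y - 1)`; the exponent `t (x - D) / D` is at most `l (x - D)` because `t ≤ l D`
    -- and `x > D`.
    have h1 : (x / D) ^ t ≤ Real.exp (l * (x - D)) := by
      have h2 : x / D ≤ Real.exp (x / D - 1) := by linarith [Real.add_one_le_exp (x / D - 1)]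
      calc (x / D) ^ t ≤ Real.exp (x / D - 1) ^ t := by gcongr
        _ = Real.exp (t * (x / D - 1)) := by rw [Real.exp_nat_mul]
        _ ≤ _ := by
          refine Real.exp_le_exp.2 ?_
          have h3 : x / D - 1 = (x - D) / D := by field_simp
          rw [h3, mul_div_assoc', div_le_iff₀ hD0]
          nlinarith
    have h4 : (θ.d ^ θ.c * x) ^ t = (θ.d ^ θ.c * D) ^ t * (x / D) ^ t := by
      rw [← mul_pow]; congr 1; field_simp
    have h5 : Real.exp (l * (x - D)) = Real.exp (-(l * D)) * Real.exp (l * x) := by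
      rw [← Real.exp_add]; congr 1; ring
    rw [h4]
    have h6 : (θ.d ^ θ.c * D) ^ t * (x / D) ^ t ≤
        (θ.d ^ θ.c * D) ^ t * (Real.exp (-(l * D)) * Real.exp (l * x)) := by
      rw [← h5]; gcongr
    have h7 : 0 ≤ ((1 + θ.γ)⁻¹) ^ t := by positivity
    linarith

theorem exp_two_mul_sub_one_le {l : ℝ} (hl : 0 ≤ l) (hl1 : 2 * l ≤ 1) :
    (Real.exp (2 * l) - 1) / 2 ≤ l + 2 * l ^ 2 := by
  have h := Real.abs_exp_sub_one_sub_id_le (x := 2 * l) (by rw [abs_of_nonneg] <;> linarith)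
  have := (abs_le.1 h).2
  nlinarith

/-- The conditions on `d` used in the analysis of the random graph. -/
structure LargeDegree (α γ c d : ℝ) : Prop where
  one_le : 1 ≤ d
  one_le_log : 1 ≤ Real.log d
  log_le : Real.log d ^ 5 ≤ d ^ ((2 : ℝ) / 5)
  log_le' : 40 * (3 + Real.log d) ≤ Real.log d ^ 5
  sqrt_le : Real.sqrt d ≤ α / 4 * ((1 + α) * d)
  light : 100 * Real.log d ^ 5 ≤ (Real.sqrt d - 1) * Real.log (1 + γ)
  heavy : Real.sqrt d * ((c + 1) * Real.log d + 2) + 100 * Real.log d ^ 5 ≤ α ^ 2 / 8 * d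

/-- All that matters is `log d ^ 5 ≤ ε d ^ (2/5) ≤ ε √d` for large `d`, with `ε` small in terms of
`α`, `γ` and `c`. -/
theorem eventually_largeDegree {α γ c : ℝ} (hα : 0 < α) (hγ : 0 < γ) (hc : 0 < c) :
    ∀ᶠ d in atTop, LargeDegree α γ c d := by
  have hη : 0 < Real.log (1 + γ) := Real.log_pos (by linarith)
  set η := Real.log (1 + γ)
  obtain ⟨ε, hε, h1, h2, h3, h4⟩ : ∃ ε : ℝ, 0 < ε ∧ ε ≤ 1 ∧ 100 * ε ≤ η / 2 ∧
      (c + 1) * ε ≤ α ^ 2 / 24 ∧ 100 * ε ≤ α ^ 2 / 24 := by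
    refine ⟨min 1 (min (η / 200) (min (α ^ 2 / 24 / (c + 1)) (α ^ 2 / 2400))), by positivity,
      min_le_left _ _, ?_, ?_, ?_⟩
    · have : min 1 (min (η / 200) (min (α ^ 2 / 24 / (c + 1)) (α ^ 2 / 2400))) ≤ η / 200 :=
        (min_le_right _ _).trans (min_le_left _ _)
      linarith
    · have : min 1 (min (η / 200) (min (α ^ 2 / 24 / (c + 1)) (α ^ 2 / 2400))) ≤
          α ^ 2 / 24 / (c + 1) :=
        (min_le_right _ _).trans ((min_le_right _ _).trans (min_le_left _ _))
      rw [le_div_iff₀ (by positivity)] at this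
      linarith
    · have : min 1 (min (η / 200) (min (α ^ 2 / 24 / (c + 1)) (α ^ 2 / 2400))) ≤ α ^ 2 / 2400 :=
        (min_le_right _ _).trans ((min_le_right _ _).trans (min_le_right _ _))
      linarith
  have hlog := (isLittleO_log_rpow_rpow_atTop 5 (show (0 : ℝ) < 2 / 5 by norm_num)).bound hε
  have hl3 := Real.tendsto_log_atTop.eventually_ge_atTop 4
  have hsq : Tendsto Real.sqrt atTop atTop := Real.tendsto_sqrt_atTop
  have hs1 := hsq.eventually_ge_atTop 2
  have hs2 := hsq.eventually_ge_atTop (4 / α)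
  have hs3 := hsq.eventually_ge_atTop (48 / α ^ 2)
  filter_upwards [hlog, hl3, hs1, hs2, hs3, eventually_ge_atTop 1] with d hlog hl3 hs1 hs2 hs3 hd
  have hy1 : 1 ≤ Real.log d := by linarith
  set y := Real.log d with hy
  set z := Real.sqrt d with hz
  have hzz : z * z = d := Real.mul_self_sqrt (by linarith)
  have hlog' : y ^ 5 ≤ ε * d ^ ((2 : ℝ) / 5) := by
    have h5 : (0 : ℝ) ≤ d ^ ((2 : ℝ) / 5) := Real.rpow_nonneg (by linarith) _
    rw [Real.norm_of_nonneg (Real.rpow_nonneg (by linarith) _), Real.norm_of_nonneg h5] at hlog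
    have : y ^ (5 : ℝ) = y ^ 5 := by
      rw [← Real.rpow_natCast]; norm_num
    rwa [← this]
  have hdz : d ^ ((2 : ℝ) / 5) ≤ z := by
    rw [hz, Real.sqrt_eq_rpow]
    exact Real.rpow_le_rpow_of_exponent_le hd (by norm_num)
  have hyz : y ^ 5 ≤ ε * z := hlog'.trans (mul_le_mul_of_nonneg_left hdz hε.le)
  have hyy : y ≤ y ^ 5 := by
    calc y = y ^ 1 := (pow_one y).symm
      _ ≤ y ^ 5 := pow_le_pow_right₀ hy1 (by norm_num)
  have hz0 : 0 < z := by linarith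
  clear_value y z
  refine ⟨hd, hy ▸ hy1, ?_, ?_, ?_, ?_, ?_⟩ <;> (try rw [← hy]) <;> (try rw [← hz])
  · have h5 : (0 : ℝ) ≤ d ^ ((2 : ℝ) / 5) := Real.rpow_nonneg (by linarith) _
    exact hlog'.trans (by nlinarith)
  · have : (4 : ℝ) ^ 4 ≤ y ^ 4 := pow_le_pow_left₀ (by norm_num) hl3 4
    have : y ^ 5 = y ^ 4 * y := by ring
    nlinarith
  · rw [div_le_iff₀ hα] at hs2
    rw [← hzz]
    have h6 : 4 * z ≤ α * (z * z) := by nlinarith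
    have h7 : 0 ≤ α * α * (z * z) := by positivity
    linarith
  · nlinarith
  · rw [div_le_iff₀ (by positivity)] at hs3
    have e1 : (c + 1) * y ≤ (c + 1) * (ε * z) :=
      mul_le_mul_of_nonneg_left (hyy.trans hyz) (by linarith)
    have e2 : z * ((c + 1) * y) ≤ α ^ 2 / 24 * (z * z) := by
      calc z * ((c + 1) * y) ≤ z * ((c + 1) * (ε * z)) := mul_le_mul_of_nonneg_left e1 hz0.le
        _ = ((c + 1) * ε) * (z * z) := by ring
        _ ≤ _ := mul_le_mul_of_nonneg_right h3 (by positivity)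
    have e3 : 2 * z ≤ α ^ 2 / 24 * (z * z) := by nlinarith
    have e4 : 100 * y ^ 5 ≤ α ^ 2 / 24 * (z * z) := by
      calc 100 * y ^ 5 ≤ (100 * ε) * z := by linarith
        _ ≤ α ^ 2 / 24 * z := mul_le_mul_of_nonneg_right h4 hz0.le
        _ ≤ _ := mul_le_mul_of_nonneg_left (by nlinarith) (by positivity)
    rw [← hzz]
    nlinarith

/-- The length scale of influence paths and short cycles. -/
def scale (d : ℝ) (n : ℕ) : ℝ := Real.log n / Real.log d ^ 5

variable {α γ c d : ℝ}

/-- The union bound is applied with `l = α / 4` and the power `t = ⌊√d⌋`. Large `t` makes the light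
contribution `(1 + γ) ^ (-t)` small, while `t` is still so small that the heavy contribution is
governed by the Chernoff exponent `-α² d / 8`. Both fall below `exp (-100 log ^ 5 d)`. The bound on
`α` ensures `2 l ≤ 1`. -/
theorem prob_heavy_le (hα : 0 < α) (hα2 : α < 3 / 2) (hγ : 0 < γ) (hc : 0 < c) (h : LargeDegree α γ c d)
    {n : ℕ} (hn : 0 < n) :
    (gnp d n).real {G | HasHeavySet ⟨α, γ, c, d⟩ G (3 * scale d n)} ≤
      (n + 1) * (n * ((n : ℝ) ^ 3)⁻¹) := by
  have hd0 : 0 < d := by linarith [h.one_le]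
  set y := Real.log d with hy
  have hy1 : 1 ≤ y := h.one_le_log
  set z := Real.sqrt d with hz
  have hzz : z * z = d := Real.mul_self_sqrt hd0.le
  have hz0 : 0 ≤ z := Real.sqrt_nonneg d
  set t := ⌊z⌋₊ with ht
  have htz : (t : ℝ) ≤ z := Nat.floor_le hz0
  have htz2 : z - 1 ≤ t := by linarith [Nat.lt_floor_add_one z]
  -- Chosen so that the base `2 e ^ 3 d r` of the union bound is `exp (-log ^ 5 d)`; its power `⌈3 *
  -- scale d n⌉₊` is then at most `n ^ (-3)`.
  set r := Real.exp (-y ^ 5) / (2 * Real.exp 1 ^ 3 * d) with hr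
  have hr0 : 0 < r := by positivity
  have hx : 2 * Real.exp 1 ^ 3 * d * r = Real.exp (-y ^ 5) := by rw [hr]; field_simp
  have hx1 : Real.exp (-y ^ 5) ≤ 1 := Real.exp_le_one_iff.2 (by have : 0 ≤ y ^ 5 := by positivity
                                                                linarith)
  have hyy : y ≤ y ^ 5 := by
    calc y = y ^ 1 := (pow_one y).symm
      _ ≤ y ^ 5 := pow_le_pow_right₀ hy1 (by norm_num)
  have hd_exp : d = Real.exp y := (Real.exp_log hd0).symm
  -- Here `r ≥ exp (-y ^ 5 - y - 4)`, and `13 (y ^ 5 + y + 4) + 1 ≤ 79 y ^ 5` for `y ≥ 1`; the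
  -- summand 1 pays for the division by two.
  have hrr : Real.exp (-(100 * y ^ 5)) ≤ r ^ 13 / 2 := by
    have h2 : (2 : ℝ) ≤ Real.exp 1 := by linarith [Real.add_one_le_exp (1 : ℝ)]
    have h3 : Real.exp (-y ^ 5) / (Real.exp 1 * Real.exp 1 ^ 3 * Real.exp y) ≤ r := by
      rw [hr, ← hd_exp]; gcongr
    have h4 : Real.exp (-y ^ 5) / (Real.exp 1 * Real.exp 1 ^ 3 * Real.exp y) =
        Real.exp (-y ^ 5 - 4 - y) := by
      rw [← Real.exp_nat_mul, ← Real.exp_add, ← Real.exp_add, ← Real.exp_sub]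
      congr 1; push_cast; ring
    rw [h4] at h3
    have h5 : Real.exp (-y ^ 5 - 4 - y) ^ 13 ≤ r ^ 13 := pow_le_pow_left₀ (Real.exp_nonneg _) h3 13
    rw [← Real.exp_nat_mul] at h5
    have h6 : Real.exp (-(100 * y ^ 5)) * Real.exp 1 ≤
        Real.exp (((13 : ℕ) : ℝ) * (-y ^ 5 - 4 - y)) := by
      rw [← Real.exp_add]
      refine Real.exp_le_exp.2 ?_
      push_cast; linarith
    have h7 := Real.exp_pos (-(100 * y ^ 5))
    nlinarith
  have hl0 : 0 ≤ α / 4 := by positivity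
  have hl1 : 2 * (α / 4) ≤ 1 := by linarith
  set D := (1 + α) * d with hD
  have hD0 : 0 < D := by positivity
  have hlight : ((1 + γ)⁻¹) ^ t ≤ r ^ 13 / 2 := by
    refine le_trans ?_ hrr
    have h1 : (1 + γ)⁻¹ = Real.exp (-Real.log (1 + γ)) := by
      rw [Real.exp_neg, Real.exp_log (by linarith)]
    have h2 : 0 < Real.log (1 + γ) := Real.log_pos (by linarith)
    rw [h1, ← Real.exp_nat_mul]
    refine Real.exp_le_exp.2 ?_
    have := h.light
    nlinarith [mul_le_mul_of_nonneg_right htz2 h2.le]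
  have hheavy : Real.exp (-(α / 4 * D)) * (d ^ c * D) ^ t *
      Real.exp (d * ((Real.exp (2 * (α / 4)) - 1) / 2)) ≤ r ^ 13 / 2 := by
    refine le_trans ?_ hrr
    have hlogD : Real.log D ≤ y + 2 := by
      rw [hD, Real.log_mul (by positivity) (by positivity)]
      have := Real.log_le_sub_one_of_pos (show 0 < 1 + α by linarith)
      linarith
    have h1 : d ^ c * D = Real.exp (c * y + Real.log D) := by
      rw [Real.exp_add, Real.exp_log hD0, Real.rpow_def_of_pos hd0, mul_comm c]
    rw [h1, ← Real.exp_nat_mul, ← Real.exp_add, ← Real.exp_add]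
    refine Real.exp_le_exp.2 ?_
    -- Together with `-(α / 4) (1 + α) d` this leaves `-α² d / 8`, against which the condition
    -- `heavy` weighs the remaining terms.
    have h2 : d * ((Real.exp (2 * (α / 4)) - 1) / 2) ≤ d * (α / 4 + 2 * (α / 4) ^ 2) :=
      mul_le_mul_of_nonneg_left (exp_two_mul_sub_one_le hl0 hl1) hd0.le
    have h4 := h.heavy
    have h3 : (t : ℝ) * (c * y + Real.log D) ≤ z * ((c + 1) * y + 2) := by
      have h5 : 0 ≤ Real.log D := Real.log_nonneg (by nlinarith [h.one_le])
      exact mul_le_mul htz (by linarith) (by positivity) hz0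
    nlinarith
  have key := prob_hasHeavySet_le (θ := ⟨α, γ, c, d⟩) (n := n) (m := 3 * scale d n)
    (l := α / 4) (q := r ^ 13) (r := r) (t := t) h.one_le hl0 hl1 (κ := ((1 + γ)⁻¹) ^ t)
    (A := Real.exp (-(α / 4 * D)) * (d ^ c * D) ^ t) (by positivity) (by positivity)
    (weight_pow_le hα hγ hd0 (htz.trans h.sqrt_le)) (by simp only; linarith) hr0.le le_rfl
    (by
      have : 1 ≤ 2 * Real.exp 1 ^ 3 * d := by
        have := Real.one_le_exp (zero_le_one (α := ℝ))
        have : 1 ≤ Real.exp 1 ^ 3 := one_le_pow₀ this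
        nlinarith [h.one_le]
      rw [← hx] at hx1
      nlinarith) (by simp only; rw [hx]; exact hx1)
  refine key.trans ?_
  simp only
  rw [hx]
  have hn' : (0 : ℝ) < n := by exact_mod_cast hn
  have : Real.exp (-y ^ 5) ^ ⌈3 * scale d n⌉₊ ≤ ((n : ℝ) ^ 3)⁻¹ := by
    rw [← Real.exp_nat_mul]
    have h1 : ((n : ℝ) ^ 3)⁻¹ = Real.exp (-(3 * Real.log n)) := by
      rw [Real.exp_neg, show (3 : ℝ) * Real.log n = ((3 : ℕ) : ℝ) * Real.log n by norm_num,
        Real.exp_nat_mul, Real.exp_log hn']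
    rw [h1]
    refine Real.exp_le_exp.2 ?_
    have h2 := Nat.le_ceil (3 * scale d n)
    have h3 : 3 * scale d n * y ^ 5 = 3 * Real.log n := by
      rw [scale, ← hy]; field_simp
    have h4 : 0 ≤ y ^ 5 := by positivity
    nlinarith [mul_le_mul_of_nonneg_right h2 h4]
  gcongr

/-- The condition `log_le'` says that `20 (3 + log d) / log ^ 5 d ≤ 1 / 2`, so the exponential cost
of enumerating sets or paths of this size is at most `√n`. -/
theorem pow_floor_scale_le (h : LargeDegree α γ c d) {n : ℕ} (hn : 0 < n) {b C : ℝ}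
    (hb : 0 ≤ b) (hb2 : b ≤ 20) (hC : 1 ≤ C) (hC2 : C ≤ Real.exp 1 ^ 3 * d) :
    C ^ ⌊b * scale d n⌋₊ ≤ Real.sqrt n := by
  have hd0 : 0 < d := by linarith [h.one_le]
  have hy1 := h.one_le_log
  have hn' : (0 : ℝ) < n := by exact_mod_cast hn
  have hln : 0 ≤ Real.log n := Real.log_natCast_nonneg n
  have hs : 0 ≤ scale d n := by unfold scale; positivity
  have hlC : Real.log C ≤ 3 + Real.log d := by
    refine (Real.log_le_log (by linarith) hC2).trans ?_
    rw [Real.log_mul (by positivity) (by positivity), Real.log_pow, Real.log_exp]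
    simp
  have hC0 : 0 < C := by linarith
  rw [← Real.exp_log hC0, ← Real.exp_nat_mul, Real.sqrt_eq_rpow, Real.rpow_def_of_pos hn']
  refine Real.exp_le_exp.2 ?_
  have h1 := Nat.floor_le (mul_nonneg hb hs)
  have h2 : 0 ≤ Real.log C := Real.log_nonneg hC
  have h3 := h.log_le'
  calc (⌊b * scale d n⌋₊ : ℝ) * Real.log C ≤ (20 * scale d n) * (3 + Real.log d) := by
        refine mul_le_mul (h1.trans (mul_le_mul_of_nonneg_right hb2 hs)) hlC h2 (by positivity)
    _ = scale d n * (40 * (3 + Real.log d)) / 2 := by ring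
    _ ≤ scale d n * Real.log d ^ 5 / 2 := by gcongr
    _ = Real.log n * (1 / 2) := by
        unfold scale; field_simp

theorem scale_le_log (h : LargeDegree α γ c d) (n : ℕ) : scale d n ≤ Real.log n := by
  unfold scale
  exact div_le_self (Real.log_natCast_nonneg n) (one_le_pow₀ h.one_le_log)

/-- The properties of the random graph that are used. -/
def Typical (θ : Params) {n : ℕ} (G : SimpleGraph (Fin n)) : Prop :=
  ¬ HasDenseSet G (20 * scale θ.d n) ∧ ¬ HasHeavySet θ G (3 * scale θ.d n) ∧
    pathCount G ⌊4 * scale θ.d n⌋₊ ≤ n ^ 3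

/-- With `w = √n`, dense sets cost about `(log n) d w / n`, heavy sets about `1 / n`, and too many
paths at most about `(log n) w / n`. -/
theorem prob_not_typical_le (hα : 0 < α) (hα2 : α < 3 / 2) (hγ : 0 < γ) (hc : 0 < c)
    (h : LargeDegree α γ c d) {n : ℕ} (hn : 0 < n) :
    (gnp d n).real {G | ¬ Typical ⟨α, γ, c, d⟩ G} ≤
      (d + 3) * ((20 * Real.log n + 1) / Real.sqrt n) := by
  have hd1 := h.one_le
  have hd0 : 0 < d := by linarith
  have hn' : (1 : ℝ) ≤ n := by exact_mod_cast hn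
  have hln : 0 ≤ Real.log n := Real.log_natCast_nonneg n
  have hs0 : 0 ≤ scale d n := by
    have := h.one_le_log
    unfold scale; positivity
  have hsl := scale_le_log h n
  have he : 1 ≤ Real.exp 1 ^ 3 := one_le_pow₀ (Real.one_le_exp zero_le_one)
  set w := Real.sqrt n with hw
  have hw1 : 1 ≤ w := Real.one_le_sqrt.2 hn'
  have hww : w * w = n := Real.mul_self_sqrt (by linarith)
  have hsub : {G : SimpleGraph (Fin n) | ¬ Typical ⟨α, γ, c, d⟩ G} ⊆
      ({G | HasDenseSet G (20 * scale d n)} ∪ {G | HasHeavySet ⟨α, γ, c, d⟩ G (3 * scale d n)}) ∪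
        {G | n ^ 3 < pathCount G ⌊4 * scale d n⌋₊} := by
    intro G hG
    simp only [Typical, Set.mem_ofPred_eq, Set.mem_union] at *
    by_contra hcon
    push Not at hcon
    exact hG ⟨hcon.1.1, hcon.1.2, hcon.2⟩
  have b1 : (gnp d n).real {G | HasDenseSet G (20 * scale d n)} ≤ d * ((20 * Real.log n + 1) / w) := by
    refine (prob_hasDenseSet_le hd1 hn _).trans ?_
    have h1 := pow_floor_scale_le h hn (by norm_num : (0:ℝ) ≤ 20) le_rfl
      (by nlinarith : 1 ≤ Real.exp 1 ^ 3 * d) le_rfl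
    have h2 : (⌊20 * scale d n⌋₊ : ℝ) ≤ 20 * Real.log n :=
      (Nat.floor_le (by positivity)).trans (by linarith)
    calc _ ≤ (20 * Real.log n + 1) * (d / n * w) := by gcongr
      _ = _ := by rw [← hww]; field_simp
  have b2 := prob_heavy_le hα hα2 hγ hc h hn
  have b2' : ((n : ℝ) + 1) * (n * ((n : ℝ) ^ 3)⁻¹) ≤ 2 * ((20 * Real.log n + 1) / w) := by
    calc ((n : ℝ) + 1) * (n * ((n : ℝ) ^ 3)⁻¹) ≤ (n + n) * (n * ((n : ℝ) ^ 3)⁻¹) := by gcongr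
      _ = 2 * (1 / (w * w)) := by rw [hww]; field_simp; norm_num
      _ ≤ 2 * ((20 * Real.log n + 1) / w) := by
        have : w ≤ w * w := by nlinarith
        gcongr
        linarith
  have b3 : (gnp d n).real {G | n ^ 3 < pathCount G ⌊4 * scale d n⌋₊} ≤
      1 * ((20 * Real.log n + 1) / w) := by
    refine (prob_pathCount_le hd1 hn _).trans ?_
    have h1 := pow_floor_scale_le h hn (by norm_num : (0:ℝ) ≤ 4) (by norm_num) hd1
      (by nlinarith : d ≤ Real.exp 1 ^ 3 * d)
    have h2 : (⌊4 * scale d n⌋₊ : ℝ) ≤ 20 * Real.log n :=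
      (Nat.floor_le (by positivity)).trans (by linarith)
    calc _ ≤ (20 * Real.log n + 1) * w / n ^ 2 := by gcongr
      _ ≤ (20 * Real.log n + 1) * w / n := by
        gcongr
        nlinarith
      _ = _ := by rw [← hww]; field_simp
  calc _ ≤ _ := measureReal_mono hsub
    _ ≤ _ := measureReal_union_le _ _
    _ ≤ _ := add_le_add (measureReal_union_le _ _) le_rfl
    _ ≤ _ := by linarith

theorem whp_typical (hα : 0 < α) (hα2 : α < 3 / 2) (hγ : 0 < γ) (hc : 0 < c)
    (h : LargeDegree α γ c d) :
    Tendsto (fun n : ℕ => gnp d n {G | Typical ⟨α, γ, c, d⟩ G}) atTop (𝓝 1) := by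
  have hreal : Tendsto (fun n : ℕ => (gnp d n).real {G | Typical ⟨α, γ, c, d⟩ G}) atTop (𝓝 1) := by
    have h0 : Tendsto (fun n : ℕ => (d + 3) * ((20 * Real.log n + 1) / Real.sqrt n)) atTop (𝓝 0) := by
      have h1 : Tendsto (fun x : ℝ => Real.log x / Real.sqrt x) atTop (𝓝 0) := by
        have := (isLittleO_log_rpow_atTop (show (0 : ℝ) < 1 / 2 by norm_num)).tendsto_div_nhds_zero
        simpa only [← Real.sqrt_eq_rpow] using this
      have h2 : Tendsto (fun x : ℝ => 1 / Real.sqrt x) atTop (𝓝 0) :=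
        tendsto_const_nhds.div_atTop Real.tendsto_sqrt_atTop
      have h3 := (((h1.const_mul 20).add h2).const_mul (d + 3)).comp tendsto_natCast_atTop_atTop
      simp only [mul_zero, add_zero] at h3
      refine h3.congr fun n => ?_
      simp only [Function.comp]
      ring
    have h1 : Tendsto (fun n : ℕ => 1 - (d + 3) * ((20 * Real.log n + 1) / Real.sqrt n)) atTop
        (𝓝 1) := by simpa using h0.const_sub 1
    refine tendsto_of_tendsto_of_tendsto_of_le_of_le' h1 tendsto_const_nhds ?_
      (Eventually.of_forall fun n => measureReal_le_one)
    filter_upwards [eventually_gt_atTop 0] with n hn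
    have h2 := prob_not_typical_le hα hα2 hγ hc h hn
    have h3 := probReal_compl_eq_one_sub (μ := gnp d n)
      (Set.toFinite {G : SimpleGraph (Fin n) | Typical ⟨α, γ, c, d⟩ G}).measurableSet
    have h4 : {G : SimpleGraph (Fin n) | Typical ⟨α, γ, c, d⟩ G}ᶜ =
      {G | ¬ Typical ⟨α, γ, c, d⟩ G} := rfl
    rw [h4] at h3
    linarith
  have := ENNReal.tendsto_ofReal hreal
  simpa [Measure.real] using this

end Asymptotics

/-! ### Influence paths in typical graphs are short -/

section Covering

open Classical

variable {n : ℕ}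

/-- The set `S` is the connected component of `r`, and a connected graph has at most one vertex more
than edges. -/
theorem card_le_card_edges_add_one (H : SimpleGraph (Fin n)) [Fintype H.edgeSet] (S : Finset (Fin n)) {r : Fin n}
    (hE : ∀ x y, H.Adj x y → x ∈ S → y ∈ S) (hr : r ∈ S) (hS : ∀ x ∈ S, H.Reachable r x) :
    S.card ≤ H.edgeFinset.card + 1 := by
  set C := H.connectedComponentMk r with hC
  have hsupp : ∀ x, x ∈ C.supp ↔ x ∈ S := by
    intro x
    rw [SimpleGraph.ConnectedComponent.mem_supp_iff, hC, SimpleGraph.ConnectedComponent.eq]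
    refine ⟨fun h => ?_, fun h => (hS x h).symm⟩
    obtain ⟨p⟩ := h.symm
    clear hC
    induction p with
    | nil => exact hr
    | cons hadj p ih =>
      exact ih (hE _ _ hadj hr) (fun x hx => ((SimpleGraph.Adj.reachable hadj).symm.trans
        (hS x hx))) ⟨p.reverse⟩
  have h1 := C.connected_toSimpleGraph.card_vert_le_card_edgeSet_add_one
  have h2 : Nat.card C = S.card := by
    have : C.supp = (S : Set (Fin n)) := by ext x; simpa using hsupp x
    change Nat.card C.supp = _
    rw [this]; simp
  have h3 : Nat.card C.toSimpleGraph.edgeSet ≤ H.edgeFinset.card := by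
    have h4 : H.edgeFinset.card = Nat.card H.edgeSet := by
      rw [Nat.card_eq_fintype_card, SimpleGraph.edgeFinset_card]
    rw [h4]
    refine Nat.card_le_card_of_injective
      (SimpleGraph.Hom.mapEdgeSet C.toSimpleGraph_hom) ?_
    exact SimpleGraph.Hom.mapEdgeSet.injective _ Subtype.val_injective
  omega

/-- The edges of `G` inside `S`. -/
def within (G : SimpleGraph (Fin n)) (S : Finset (Fin n)) : SimpleGraph (Fin n) where
  Adj x y := G.Adj x y ∧ x ∈ S ∧ y ∈ S
  symm := ⟨fun _ _ h => ⟨h.1.symm, h.2.2, h.2.1⟩⟩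
  loopless := ⟨fun _ h => h.1.ne rfl⟩

theorem spanned_eq (G : SimpleGraph (Fin n)) (S : Finset (Fin n))
    [Fintype (within G S).edgeSet] :
    spanned G S = (within G S).edgeFinset.card := by
  rw [spanned]
  congr 1
  ext e
  induction e with
  | _ x y =>
    rw [SimpleGraph.mem_edgeFinset]
    simp only [pairsIn, allEdges, Finset.mem_filter, Finset.mem_univ, true_and,
      SimpleGraph.mem_edgeSet, Sym2.mem_iff, forall_eq_or_imp,
      forall_eq, Sym2.mk_isDiag_iff, within]
    exact ⟨fun h => ⟨h.2, h.1.2⟩, fun h => ⟨⟨h.1.ne, h.2⟩, h.1⟩⟩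

theorem reachable_of_steps {H : SimpleGraph (Fin n)} {f : ℕ → Fin n} {a b : ℕ} (hab : a ≤ b)
    (h : ∀ i, a ≤ i → i < b → H.Adj (f i) (f (i + 1))) : H.Reachable (f a) (f b) := by
  induction b, hab using Nat.le_induction with
  | base => rfl
  | succ b hb ih =>
    exact (ih fun i h1 h2 => h i h1 (by omega)).trans (h b hb (by omega)).reachable

/-- A repeated edge would have to be traversed backwards, which would give `i = j + 1` and `i + 1 =
j`. -/
theorem sym2_steps_injOn {m : ℕ → Fin n} {k : ℕ} (hinj : Set.InjOn m (Set.Iic k)) :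
    Set.InjOn (fun i => s(m i, m (i + 1))) (Set.Iio k) := by
  intro i hi j hj h
  simp only [Set.mem_Iio] at hi hj
  simp only [Sym2.eq_iff] at h
  rcases h with ⟨h1, -⟩ | ⟨h1, h2⟩
  · exact hinj (Set.mem_Iic.2 hi.le) (Set.mem_Iic.2 hj.le) h1
  · have h1 := hinj (Set.mem_Iic.2 hi.le) (Set.mem_Iic.2 (by omega)) h1
    have h2 := hinj (Set.mem_Iic.2 (by omega)) (Set.mem_Iic.2 hj.le) h2
    omega

/-- The vertices of a sequence of `l` steps. -/
def trace (f : ℕ → Fin n) (l : ℕ) : Finset (Fin n) := (Finset.range (l + 1)).image f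

theorem mem_trace {f : ℕ → Fin n} {l : ℕ} {x : Fin n} : x ∈ trace f l ↔ ∃ j ≤ l, f j = x := by
  simp [trace]

theorem card_trace_le (f : ℕ → Fin n) (l : ℕ) : (trace f l).card ≤ l + 1 :=
  Finset.card_image_le.trans (by simp)

/-- The edges of the sequences `L x`, `x ∈ X`. -/
def stepEdges (L : ℕ → ℕ → Fin n) (len : ℕ → ℕ) (X : Finset ℕ) : Finset (Sym2 (Fin n)) :=
  X.biUnion fun x => (Finset.range (len x)).image fun j => s(L x j, L x (j + 1))

theorem exists_step_not_mem {m : ℕ → Fin n} {k : ℕ} (hinj : Set.InjOn m (Set.Iic k))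
    {E : Finset (Sym2 (Fin n))} {a b : ℕ} (hb : b ≤ k) (h : E.card < b - a) :
    ∃ i, a ≤ i ∧ i < b ∧ s(m i, m (i + 1)) ∉ E := by
  by_contra hcon
  push Not at hcon
  have : ((Finset.Ico a b).image fun i => s(m i, m (i + 1))).card ≤ E.card := by
    refine Finset.card_le_card fun e he => ?_
    obtain ⟨i, hi, rfl⟩ := Finset.mem_image.1 he
    exact hcon i (Finset.mem_Ico.1 hi).1 (Finset.mem_Ico.1 hi).2
  rw [Finset.card_image_of_injOn, Nat.card_Ico] at this
  · omega
  · refine (sym2_steps_injOn hinj).mono fun i hi => ?_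
    simp only [Finset.coe_Ico, Set.mem_Ico, Set.mem_Iio] at *
    omega

/-- Three distant vertices of a path that are connected by short paths give a dense set. -/
theorem spanned_of_shortcuts {G : SimpleGraph (Fin n)} {m : ℕ → Fin n} {k : ℕ}
    (hm : ∀ i < k, G.Adj (m i) (m (i + 1))) (hinj : Set.InjOn m (Set.Iic k))
    {L : ℕ → ℕ → Fin n} {len : ℕ → ℕ} (hL0 : ∀ i ≤ k, L i 0 = m i)
    (hL : ∀ i ≤ k, ∀ j < len i, G.Adj (L i j) (L i (j + 1)))
    {X : Finset ℕ} {a b c : ℕ} (hX : ∀ x ∈ X, x ≤ k) (hb : b ∈ X) (hc : c ∈ X)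
    (hab : (stepEdges L len X).card < b - a) (hbc : (stepEdges L len X).card < c - b)
    (hrab : (SimpleGraph.fromEdgeSet (stepEdges L len X : Set (Sym2 (Fin n)))).Reachable (m a) (m b))
    (hrbc : (SimpleGraph.fromEdgeSet (stepEdges L len X : Set (Sym2 (Fin n)))).Reachable (m b) (m c)) :
    (trace m k ∪ X.biUnion fun x => trace (L x) (len x)).card + 1 ≤
      spanned G (trace m k ∪ X.biUnion fun x => trace (L x) (len x)) := by
  set E := stepEdges L len X with hE
  set S := trace m k ∪ X.biUnion fun x => trace (L x) (len x) with hS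
  -- One edge of the path on each side of `m b` is used by no shortcut. Without these two edges the
  -- union is still connected, because the shortcuts join `m a`, `m b` and `m c`. So it spans at
  -- least `|S| - 1 + 2` edges.
  obtain ⟨p, hap, hpb, hp⟩ := exists_step_not_mem hinj (hX b hb) hab
  obtain ⟨q, hbq, hqc, hq⟩ := exists_step_not_mem hinj (hX c hc) hbc
  have hck := hX c hc
  set EH : Set (Sym2 (Fin n)) := (E : Set (Sym2 (Fin n))) ∪
    {e | ∃ i < k, i ≠ p ∧ i ≠ q ∧ e = s(m i, m (i + 1))} with hEH
  set H := SimpleGraph.fromEdgeSet EH with hH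
  have hmS : ∀ i ≤ k, m i ∈ S := fun i hi =>
    Finset.mem_union_left _ (mem_trace.2 ⟨i, hi, rfl⟩)
  have hLS : ∀ x ∈ X, ∀ j ≤ len x, L x j ∈ S := fun x hx j hj =>
    Finset.mem_union_right _ (Finset.mem_biUnion.2 ⟨x, hx, mem_trace.2 ⟨j, hj, rfl⟩⟩)
  have hEG : ∀ x y, s(x, y) ∈ EH → G.Adj x y ∧ x ∈ S ∧ y ∈ S := by
    intro x y h
    rcases h with h | ⟨i, hi, -, -, h⟩
    · simp only [hE, stepEdges, Finset.coe_biUnion, Finset.mem_coe, Set.mem_iUnion,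
        Finset.coe_image, Set.mem_image, Finset.coe_range, Set.mem_Iio] at h
      obtain ⟨z, hz, j, hj, h⟩ := h
      have h1 := hL z (hX z hz) j hj
      have h2 := hLS z hz j hj.le
      have h3 := hLS z hz (j + 1) hj
      rcases Sym2.eq_iff.1 h with ⟨rfl, rfl⟩ | ⟨rfl, rfl⟩
      · exact ⟨h1, h2, h3⟩
      · exact ⟨h1.symm, h3, h2⟩
    · have h1 := hm i hi
      have h2 := hmS i hi.le
      have h3 := hmS (i + 1) hi
      rcases Sym2.eq_iff.1 h with ⟨rfl, rfl⟩ | ⟨rfl, rfl⟩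
      · exact ⟨h1, h2, h3⟩
      · exact ⟨h1.symm, h3, h2⟩
  have hHG : H ≤ within G S := fun x y h => by
    have := hEG x y ((SimpleGraph.fromEdgeSet_adj _).1 h).1
    exact this
  have hpn : s(m p, m (p + 1)) ∉ EH := by
    rintro (h | ⟨i, hi, hip, -, h⟩)
    · exact hp h
    · exact hip (sym2_steps_injOn hinj (Set.mem_Iio.2 hi) (Set.mem_Iio.2 (by omega)) h.symm)
  have hqn : s(m q, m (q + 1)) ∉ EH := by
    rintro (h | ⟨i, hi, -, hiq, h⟩)
    · exact hq h
    · exact hiq (sym2_steps_injOn hinj (Set.mem_Iio.2 hi) (Set.mem_Iio.2 (by omega)) h.symm)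
  have hpq : s(m p, m (p + 1)) ≠ s(m q, m (q + 1)) := fun h => by
    have := sym2_steps_injOn hinj (Set.mem_Iio.2 (by omega)) (Set.mem_Iio.2 (by omega)) h
    omega
  have hstep : ∀ i < k, i ≠ p → i ≠ q → H.Adj (m i) (m (i + 1)) := fun i hi h1 h2 => by
    rw [hH, SimpleGraph.fromEdgeSet_adj]
    exact ⟨Or.inr ⟨i, hi, h1, h2, rfl⟩, (hm i hi).ne⟩
  have hle : SimpleGraph.fromEdgeSet (E : Set (Sym2 (Fin n))) ≤ H :=
    SimpleGraph.fromEdgeSet_mono Set.subset_union_left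
  have hba : H.Reachable (m b) (m a) := (hrab.mono hle).symm
  have hbc' : H.Reachable (m b) (m c) := hrbc.mono hle
  have hreach_m : ∀ i ≤ k, H.Reachable (m b) (m i) := by
    intro i hi
    -- Cutting the two edges leaves three pieces of the path, which contain `m a`, `m b` and `m c`
    -- respectively.
    by_cases h1 : i ≤ p
    · rcases le_total i a with h2 | h2
      · exact hba.trans (reachable_of_steps h2 fun j h3 h4 =>
          hstep j (by omega) (by omega) (by omega)).symm
      · exact hba.trans (reachable_of_steps h2 fun j h3 h4 =>
          hstep j (by omega) (by omega) (by omega))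
    · by_cases h2 : i ≤ q
      · rcases le_total i b with h3 | h3
        · exact (reachable_of_steps h3 fun j h4 h5 =>
            hstep j (by omega) (by omega) (by omega)).symm
        · exact reachable_of_steps h3 fun j h4 h5 => hstep j (by omega) (by omega) (by omega)
      · rcases le_total i c with h3 | h3
        · exact hbc'.trans (reachable_of_steps h3 fun j h4 h5 =>
            hstep j (by omega) (by omega) (by omega)).symm
        · exact hbc'.trans (reachable_of_steps h3 fun j h4 h5 =>
            hstep j (by omega) (by omega) (by omega))
  have hreach : ∀ x ∈ S, H.Reachable (m b) x := by
    intro x hx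
    rcases Finset.mem_union.1 hx with hx | hx
    · obtain ⟨i, hi, rfl⟩ := mem_trace.1 hx
      exact hreach_m i hi
    · obtain ⟨z, hz, hx⟩ := Finset.mem_biUnion.1 hx
      obtain ⟨j, hj, rfl⟩ := mem_trace.1 hx
      have h1 : H.Reachable (m z) (L z j) := by
        rw [← hL0 z (hX z hz)]
        refine reachable_of_steps (Nat.zero_le j) fun i _ hi => ?_
        rw [hH, SimpleGraph.fromEdgeSet_adj]
        refine ⟨Or.inl ?_, (hL z (hX z hz) i (by omega)).ne⟩
        simp only [hE, stepEdges, Finset.coe_biUnion, Finset.mem_coe, Set.mem_iUnion,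
          Finset.coe_image, Set.mem_image, Finset.coe_range, Set.mem_Iio]
        exact ⟨z, hz, i, by omega, rfl⟩
      exact (hreach_m z (hX z hz)).trans h1
  have hcard := card_le_card_edges_add_one H S (r := m b) (fun x y h _ => (hHG h).2.2)
    (hmS b (hX b hb)) hreach
  have hsub : insert s(m p, m (p + 1)) (insert s(m q, m (q + 1)) H.edgeFinset) ⊆
      (within G S).edgeFinset := by
    intro e he
    rw [Finset.mem_insert, Finset.mem_insert] at he
    rw [SimpleGraph.mem_edgeFinset]
    rcases he with rfl | rfl | he
    · exact ⟨hm p (by omega), hmS p (by omega), hmS (p + 1) (by omega)⟩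
    · exact ⟨hm q (by omega), hmS q (by omega), hmS (q + 1) (by omega)⟩
    · exact SimpleGraph.edgeSet_mono hHG (SimpleGraph.mem_edgeFinset.1 he)
  have hcard2 := Finset.card_le_card hsub
  rw [Finset.card_insert_of_notMem, Finset.card_insert_of_notMem] at hcard2
  · rw [spanned_eq]; omega
  · rw [SimpleGraph.mem_edgeFinset, hH, SimpleGraph.edgeSet_fromEdgeSet]
    exact fun h => hqn h.1
  · rw [Finset.mem_insert, SimpleGraph.mem_edgeFinset, hH, SimpleGraph.edgeSet_fromEdgeSet]
    rintro (h | h)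
    · exact hpq h
    · exact hpn h.1

theorem card_stepEdges_le (L : ℕ → ℕ → Fin n) (len : ℕ → ℕ) {X : Finset ℕ} {l : ℕ}
    (hX : X.card ≤ 3) (hl : ∀ x ∈ X, len x ≤ l) : (stepEdges L len X).card ≤ 3 * l := by
  refine (Finset.card_biUnion_le_card_mul _ _ l fun x hx => ?_).trans (Nat.mul_le_mul_right l hX)
  exact Finset.card_image_le.trans (by simpa using hl x hx)

theorem card_union_traces_le (m : ℕ → Fin n) (k : ℕ) (L : ℕ → ℕ → Fin n) (len : ℕ → ℕ)
    {X : Finset ℕ} {l : ℕ} (hX : X.card ≤ 3) (hl : ∀ x ∈ X, len x ≤ l) :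
    (trace m k ∪ X.biUnion fun x => trace (L x) (len x)).card ≤ k + 1 + 3 * (l + 1) := by
  refine (Finset.card_union_le _ _).trans (add_le_add (card_trace_le _ _) ?_)
  refine (Finset.card_biUnion_le_card_mul _ _ (l + 1) fun x hx => ?_).trans
    (Nat.mul_le_mul_right _ hX)
  exact (card_trace_le _ _).trans (by have := hl x hx; omega)

theorem reachable_of_meet {m : ℕ → Fin n} {L : ℕ → ℕ → Fin n} {len : ℕ → ℕ} {G : SimpleGraph (Fin n)}
    {X : Finset ℕ} {i j : ℕ} (hi : i ∈ X) (hj : j ∈ X) (hL0 : ∀ x ∈ X, L x 0 = m x)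
    (hL : ∀ x ∈ X, ∀ j < len x, G.Adj (L x j) (L x (j + 1)))
    (h : ¬ Disjoint (trace (L i) (len i)) (trace (L j) (len j))) :
    (SimpleGraph.fromEdgeSet (stepEdges L len X : Set (Sym2 (Fin n)))).Reachable (m i) (m j) := by
  have key : ∀ x ∈ X, ∀ b ≤ len x,
      (SimpleGraph.fromEdgeSet (stepEdges L len X : Set (Sym2 (Fin n)))).Reachable (m x) (L x b) := by
    intro x hx b hb
    rw [← hL0 x hx]
    refine reachable_of_steps (Nat.zero_le b) fun i _ hi => ?_
    rw [SimpleGraph.fromEdgeSet_adj]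
    refine ⟨?_, (hL x hx i (by omega)).ne⟩
    simp only [stepEdges, Finset.coe_biUnion, Finset.mem_coe, Set.mem_iUnion,
      Finset.coe_image, Set.mem_image, Finset.coe_range, Set.mem_Iio]
    exact ⟨x, hx, i, by omega, rfl⟩
  obtain ⟨z, hz1, hz2⟩ := Finset.not_disjoint_iff.1 h
  obtain ⟨a, ha, rfl⟩ := mem_trace.1 hz1
  obtain ⟨b, hb, hb2⟩ := mem_trace.1 hz2
  have h1 := key i hi a ha
  have h2 := key j hj b hb
  rw [hb2] at h2
  exact h1.trans h2.symm

theorem card_near_le (k i l : ℕ) :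
    ((Finset.range (k + 1)).filter fun j => j ≤ i + l ∧ i ≤ j + l).card ≤ 2 * l + 1 := by
  have : ((Finset.range (k + 1)).filter fun j => j ≤ i + l ∧ i ≤ j + l) ⊆
      Finset.Icc (i - l) (i + l) := by
    intro j hj
    have := (Finset.mem_filter.1 hj).2
    exact Finset.mem_Icc.2 ⟨by omega, by omega⟩
  refine (Finset.card_le_card this).trans ?_
  rw [Nat.card_Icc]; omega

/-- In a graph without small dense sets, a short path meets few of the shorter paths that start
from the vertices of a given path. -/
theorem card_meeting_le {G : SimpleGraph (Fin n)} {M : ℝ} (hG : ¬ HasDenseSet G M)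
    {m : ℕ → Fin n} {k : ℕ}
    (hm : ∀ i < k, G.Adj (m i) (m (i + 1))) (hinj : Set.InjOn m (Set.Iic k))
    {L : ℕ → ℕ → Fin n} {len : ℕ → ℕ} (hL0 : ∀ i ≤ k, L i 0 = m i)
    (hL : ∀ i ≤ k, ∀ j < len i, G.Adj (L i j) (L i (j + 1)))
    {i : ℕ} (hi : i ≤ k) (hM : (k : ℝ) + 1 + 3 * (len i + 1) ≤ M) :
    ((Finset.range (k + 1)).filter fun j => len j ≤ len i ∧
      ¬ Disjoint (trace (L i) (len i)) (trace (L j) (len j))).card ≤ 12 * (len i + 1) := by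
  by_contra hcon
  push Not at hcon
  set K := (Finset.range (k + 1)).filter fun j => len j ≤ len i ∧
      ¬ Disjoint (trace (L i) (len i)) (trace (L j) (len j)) with hK
  set l := len i with hl
  set N := fun i => (Finset.range (k + 1)).filter fun j => j ≤ i + 3 * l ∧ i ≤ j + 3 * l with hN
  -- At most `6 l + 1` indices lie within distance `3 l` of a given one, and `2 (6 l + 1) < 12 (l +
  -- 1)`. So there are `v`, `w` in `K` such that `i`, `v`, `w` are pairwise more than `3 l` apart,
  -- and the three short paths have at most `3 l` edges together.
  obtain ⟨v, hv⟩ : (K \ N i).Nonempty := by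
    rw [← Finset.card_pos]
    have := Finset.le_card_sdiff (N i) K
    have := card_near_le k i (3 * l)
    have : (N i).card ≤ 2 * (3 * l) + 1 := this
    omega
  obtain ⟨w, hw⟩ : (K \ (N i ∪ N v)).Nonempty := by
    rw [← Finset.card_pos]
    have := Finset.le_card_sdiff (N i ∪ N v) K
    have h1 : (N i).card ≤ 2 * (3 * l) + 1 := card_near_le k i (3 * l)
    have h2 : (N v).card ≤ 2 * (3 * l) + 1 := card_near_le k v (3 * l)
    have := Finset.card_union_le (N i) (N v)
    omega
  simp only [hN, hK, Finset.mem_sdiff, Finset.mem_filter, Finset.mem_union, Finset.mem_range,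
    not_or] at hv hw
  obtain ⟨⟨hv1, hv2, hv3⟩, hv4⟩ := hv
  obtain ⟨⟨hw1, hw2, hw3⟩, hw4, hw5⟩ := hw
  have hX : ∀ x ∈ ({i, v, w} : Finset ℕ), x ≤ k := by
    intro x hx
    simp only [Finset.mem_insert, Finset.mem_singleton] at hx
    omega
  have hXl : ∀ x ∈ ({i, v, w} : Finset ℕ), len x ≤ l := by
    intro x hx
    simp only [Finset.mem_insert, Finset.mem_singleton] at hx
    rcases hx with rfl | rfl | rfl <;> omega
  have hXc : ({i, v, w} : Finset ℕ).card ≤ 3 := Finset.card_le_three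
  have hE := card_stepEdges_le L len hXc hXl
  have hS := card_union_traces_le m k L len hXc hXl
  have hi' : i ∈ ({i, v, w} : Finset ℕ) := by simp
  have hv' : v ∈ ({i, v, w} : Finset ℕ) := by simp
  have hw' : w ∈ ({i, v, w} : Finset ℕ) := by simp
  have rv := reachable_of_meet (X := {i, v, w}) hi' hv' (fun x hx => hL0 x (hX x hx))
    (fun x hx => hL x (hX x hx)) hv3
  have rw' := reachable_of_meet (X := {i, v, w}) hi' hw' (fun x hx => hL0 x (hX x hx))
    (fun x hx => hL x (hX x hx)) hw3
  have rvw := rv.symm.trans rw'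
  refine hG ⟨trace m k ∪ ({i, v, w} : Finset ℕ).biUnion fun x => trace (L x) (len x),
    le_trans (by exact_mod_cast hS) hM, ?_⟩
  have key := fun {a b c : ℕ} => spanned_of_shortcuts (a := a) (b := b) (c := c) hm hinj hL0 hL hX
  -- The three indices have to be sorted: any of them can be the middle one, and each pair is joined
  -- by shortcuts.
  rcases lt_trichotomy i v with h1 | h1 | h1
  · rcases lt_trichotomy v w with h2 | h2 | h2
    · exact key hv' hw' (by omega) (by omega) rv rvw
    · omega
    · rcases lt_trichotomy i w with h3 | h3 | h3
      · exact key hw' hv' (by omega) (by omega) rw' rvw.symm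
      · omega
      · exact key hi' hv' (by omega) (by omega) rw'.symm rv
  · omega
  · rcases lt_trichotomy i w with h2 | h2 | h2
    · exact key hi' hw' (by omega) (by omega) rv.symm rw'
    · omega
    · rcases lt_trichotomy v w with h3 | h3 | h3
      · exact key hw' hi' (by omega) (by omega) rvw rw'.symm
      · omega
      · exact key hv' hi' (by omega) (by omega) rvw.symm rv.symm

/-- A covering lemma of Vitali type. -/
theorem exists_disjoint_subfamily (I : Finset ℕ) (len : ℕ → ℕ) (Λ : ℕ → Finset (Fin n))
    (hne : ∀ i ∈ I, (Λ i).Nonempty)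
    (h : ∀ i ∈ I, (I.filter fun j => len j ≤ len i ∧ ¬ Disjoint (Λ i) (Λ j)).card ≤
      12 * (len i + 1)) :
    ∃ A ⊆ I, (A : Set ℕ).PairwiseDisjoint Λ ∧ I.card ≤ ∑ i ∈ A, 12 * (len i + 1) := by
  induction I using Finset.strongInduction with
  | H I ih =>
    rcases I.eq_empty_or_nonempty with rfl | hI
    · exact ⟨∅, by simp⟩
    -- The greedy choice: by maximality all members that meet the longest one are counted by `h`,
    -- and the rest is treated recursively.
    obtain ⟨i, hi, hmax⟩ := Finset.exists_max_image I len hI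
    set I' := I.filter fun j => Disjoint (Λ i) (Λ j) with hI'
    have hi' : i ∉ I' := by
      intro hmem
      have := (Finset.mem_filter.1 hmem).2
      rw [disjoint_self] at this
      exact (hne i hi).ne_empty this
    have hss : I' ⊂ I := Finset.filter_ssubset.2 ⟨i, hi, fun hd => hi' (Finset.mem_filter.2 ⟨hi, hd⟩)⟩
    obtain ⟨A, hAI, hA, hcard⟩ := ih I' hss (fun j hj => hne j (hss.1 hj)) fun j hj =>
      (Finset.card_le_card (Finset.filter_subset_filter _ hss.1)).trans (h j (hss.1 hj))
    have hiA : i ∉ A := fun hmem => hi' (hAI hmem)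
    refine ⟨insert i A, ?_, ?_, ?_⟩
    · exact Finset.insert_subset hi (hAI.trans hss.1)
    · rw [Finset.coe_insert]
      refine hA.insert fun j hj _ => (Finset.mem_filter.1 (hAI hj)).2
    · rw [Finset.sum_insert hiA]
      have h1 := Finset.card_filter_add_card_filter_not (s := I) (fun j => Disjoint (Λ i) (Λ j))
      have h2 : (I.filter fun j => ¬ Disjoint (Λ i) (Λ j)).card ≤ 12 * (len i + 1) := by
        refine (Finset.card_le_card fun j hj => ?_).trans (h i hi)
        have := Finset.mem_filter.1 hj
        exact Finset.mem_filter.2 ⟨this.1, hmax j this.1, this.2⟩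
      have : I'.card + (I.filter fun j => ¬ Disjoint (Λ i) (Λ j)).card = I.card := h1
      omega

end Covering

/-! ### A long influence path would produce a heavy set -/

section Short

open Classical

variable {n : ℕ}

theorem exists_path_of_not_isBreakPoint {θ : Params} (hd : 0 ≤ θ.d) {G : SimpleGraph (Fin n)}
    {v : Fin n} (hv : ¬ IsBreakPoint θ G v) :
    ∃ (u : Fin n) (p : G.Walk v u), p.IsPath ∧
      (p.length : ℝ) ≤ Real.log n / θ.d ^ ((2 : ℝ) / 5) ∧ 1 < pathWeight θ G p := by
  obtain ⟨u, p, hp, hl, h⟩ := (influence_isGreatest θ G hd v).1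
  exact ⟨u, p, hp, hl, h ▸ not_le.1 hv⟩

theorem support_toFinset_eq_trace {G : SimpleGraph (Fin n)} {u v : Fin n} (p : G.Walk u v) :
    p.support.toFinset = trace p.getVert p.length := by
  ext x
  rw [List.mem_toFinset, mem_trace, SimpleGraph.Walk.mem_support_iff_exists_getVert]
  exact exists_congr fun i => and_comm

theorem pathWeight_eq_prod (θ : Params) {G : SimpleGraph (Fin n)} {u v : Fin n} {p : G.Walk u v}
    (hp : p.IsPath) : pathWeight θ G p = ∏ x ∈ trace p.getVert p.length, weight θ G x := by
  rw [pathWeight, ← support_toFinset_eq_trace, List.prod_toFinset _ hp.support_nodup]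

theorem card_trace_getVert {G : SimpleGraph (Fin n)} {u v : Fin n} {p : G.Walk u v}
    (hp : p.IsPath) : (trace p.getVert p.length).card = p.length + 1 := by
  rw [← support_toFinset_eq_trace, List.toFinset_card_of_nodup hp.support_nodup,
    SimpleGraph.Walk.length_support]

/-- In a typical graph, paths without break-points are short. -/
theorem influencePath_length_lt {θ : Params} (h : LargeDegree θ.α θ.γ θ.c θ.d)
    {G : SimpleGraph (Fin n)} (hG : Typical θ G) (hn : 5 ≤ scale θ.d n) {u v : Fin n}
    {p : G.Walk u v} (hp : IsInfluencePath θ G p) : (p.length : ℝ) < 3 * scale θ.d n := by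
  by_contra hcon
  push Not at hcon
  have hd0 : 0 ≤ θ.d := by linarith [h.one_le]
  set D := scale θ.d n with hD
  -- Only the first `k` edges are kept, so that the sets in which short cuts are sought stay small.
  set k := ⌈3 * D⌉₊ with hk
  have hkp : k ≤ p.length := Nat.ceil_le.2 hcon
  have hkD : 3 * D ≤ k := Nat.le_ceil _
  have hkD2 : (k : ℝ) < 3 * D + 1 := Nat.ceil_lt_add_one (by linarith)
  set m := p.getVert with hm
  have hnb : ∀ i, ¬ IsBreakPoint θ G (m i) := fun i => hp.2 _ (p.getVert_mem_support i)
  choose e w hw hwl hww using fun i => exists_path_of_not_isBreakPoint hd0 (hnb i)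
  set L : ℕ → ℕ → Fin n := fun i => (w i).getVert with hL
  set len : ℕ → ℕ := fun i => (w i).length with hlen
  have hlenD : ∀ i, (len i : ℝ) ≤ D := fun i => by
    refine (hwl i).trans ?_
    have h1 := h.one_le_log
    exact div_le_div_of_nonneg_left (Real.log_natCast_nonneg n) (by positivity) h.log_le
  have hinj : Set.InjOn m (Set.Iic k) := hp.1.getVert_injOn.mono fun i hi =>
    le_trans (Set.mem_Iic.1 hi) hkp
  have hadj : ∀ i < k, G.Adj (m i) (m (i + 1)) := fun i hi =>
    p.adj_getVert_succ (lt_of_lt_of_le hi hkp)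
  have hL0 : ∀ i ≤ k, L i 0 = m i := fun i _ => (w i).getVert_zero
  have hLadj : ∀ i ≤ k, ∀ j < len i, G.Adj (L i j) (L i (j + 1)) := fun i _ j hj =>
    (w i).adj_getVert_succ hj
  -- The size condition holds because `k + 1 + 3 (len i + 1) ≤ 6 D + 5 ≤ 20 D`. The selected
  -- disjoint witnesses contain at least `(k + 1) / 12` vertices, hence at least a thirteenth of
  -- their union with the path.
  obtain ⟨A, hAI, hA, hcard⟩ := exists_disjoint_subfamily (Finset.range (k + 1)) len
    (fun i => trace (L i) (len i)) (fun i _ => ⟨L i 0, mem_trace.2 ⟨0, Nat.zero_le _, rfl⟩⟩)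
    fun i hi => by
      refine card_meeting_le hG.1 hadj hinj hL0 hLadj (Nat.lt_succ_iff.1 (Finset.mem_range.1 hi)) ?_
      have := hlenD i
      rw [← hD]
      linarith
  set U := A.biUnion fun i => trace (L i) (len i) with hU
  have hUcard : U.card = ∑ i ∈ A, (len i + 1) := by
    rw [hU, Finset.card_biUnion hA]
    exact Finset.sum_congr rfl fun i _ => card_trace_getVert (hw i)
  rw [Finset.card_range, ← Finset.mul_sum, ← hUcard] at hcard
  have hMcard : (trace m k).card = k + 1 := by
    rw [trace, Finset.card_image_of_injOn, Finset.card_range]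
    refine hinj.mono fun i hi => ?_
    simp only [Finset.coe_range, Set.mem_Iio, Set.mem_Iic] at *
    omega
  set S := trace m k ∪ U with hS
  have hMS : trace m k ⊆ S := Finset.subset_union_left
  have hUS : U ⊆ S := Finset.subset_union_right
  have hSk : k + 1 ≤ S.card := hMcard ▸ Finset.card_le_card hMS
  have hSU : S.card ≤ 13 * U.card := by
    have : S.card ≤ (trace m k).card + U.card := Finset.card_union_le _ _
    omega
  refine hG.2.1 ⟨S, U, ?_, by omega, ?_, hUS, hSU, ?_⟩
  · have : ((k + 1 : ℕ) : ℝ) ≤ S.card := by exact_mod_cast hSk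
    push_cast at this
    linarith
  · have hmS : ∀ i ≤ k, m i ∈ S := fun i hi => hMS (mem_trace.2 ⟨i, hi, rfl⟩)
    have hrm : ∀ i ≤ k, (within G S).Reachable (m 0) (m i) := fun i hi =>
      reachable_of_steps (Nat.zero_le i) fun j _ hj =>
        ⟨hadj j (by omega), hmS j (by omega), hmS (j + 1) (by omega)⟩
    rw [spanned_eq]
    refine card_le_card_edges_add_one _ S (r := m 0) (fun x y hxy _ => hxy.2.2)
      (hmS 0 (Nat.zero_le k)) fun x hx => ?_
    rcases Finset.mem_union.1 hx with hx | hx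
    · obtain ⟨i, hi, rfl⟩ := mem_trace.1 hx
      exact hrm i hi
    · obtain ⟨i, hi, hx⟩ := Finset.mem_biUnion.1 hx
      obtain ⟨j, hj, rfl⟩ := mem_trace.1 hx
      have hik : i ≤ k := Nat.lt_succ_iff.1 (Finset.mem_range.1 (hAI hi))
      refine (hrm i hik).trans ?_
      rw [← hL0 i hik]
      have hLS : ∀ j ≤ len i, L i j ∈ S := fun j hj =>
        hUS (Finset.mem_biUnion.2 ⟨i, hi, mem_trace.2 ⟨j, hj, rfl⟩⟩)
      exact reachable_of_steps (Nat.zero_le j) fun a _ ha =>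
        ⟨hLadj i hik a (by omega), hLS a (by omega), hLS (a + 1) (by omega)⟩
  · have hne : A.Nonempty := by
      rw [Finset.nonempty_iff_ne_empty]
      rintro rfl
      simp [hU] at hcard
    -- By disjointness the weight of `U` is the product of the weights of the witnesses, each
    -- greater than one.
    rw [hU, Finset.prod_biUnion hA]
    refine Finset.prod_induction_nonempty _ (fun x => (1 : ℝ) < x)
      (fun a b ha hb => one_lt_mul_of_lt_of_le ha hb.le) hne fun i _ => ?_
    rw [← pathWeight_eq_prod θ (hw i)]
    exact hww i

end Short

/-! ### Blocks as closures -/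

section Closure

open Classical Relation

variable {n : ℕ} (θ : Params) (G : SimpleGraph (Fin n))

/-- One step of an influence path; the rule concerns the first vertex. -/
def Step (ρ : StartRule) (u w : Fin n) : Prop :=
  G.Adj u w ∧ ¬ IsBreakPoint θ G w ∧ (ρ = .included → ¬ IsBreakPoint θ G u)

/-- The vertices that are reached from `X` by a sequence of steps. -/
def closure (ρ : StartRule) (X : Set (Fin n)) : Set (Fin n) :=
  {w | ∃ u ∈ X, ReflTransGen (Step θ G ρ) u w}

variable {θ G}

theorem reflTransGen_included_of_walk {u w : Fin n} (p : G.Walk u w)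
    (h : ∀ x ∈ p.support, ¬ IsBreakPoint θ G x) : ReflTransGen (Step θ G .included) u w := by
  induction p with
  | nil => exact .refl
  | cons hadj p ih =>
    refine .head ⟨hadj, h _ (by simp), fun _ => h _ (by simp)⟩ (ih fun x hx => h x ?_)
    simp [hx]

theorem reflTransGen_exempt_of_walk {u w : Fin n} (p : G.Walk u w)
    (h : ∀ x ∈ p.support.tail, ¬ IsBreakPoint θ G x) : ReflTransGen (Step θ G .exempt) u w := by
  induction p with
  | nil => exact .refl
  | cons hadj p ih =>
    refine .head ⟨hadj, h _ ?_, fun h => nomatch h⟩ (ih fun x hx => h x ?_)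
    · simp
    · simpa using List.mem_of_mem_tail hx

theorem exists_walk_of_included {u w : Fin n} (h : ReflTransGen (Step θ G .included) u w) :
    u = w ∨ ∃ p : G.Walk u w, IsInfluencePath θ G p := by
  suffices H : u = w ∨ ∃ p : G.Walk u w, ∀ x ∈ p.support, ¬ IsBreakPoint θ G x by
    rcases H with H | ⟨p, hp⟩
    · exact .inl H
    · exact .inr ⟨p.bypass, p.bypass_isPath, fun x hx => hp x (p.support_bypass_subset_support hx)⟩
  induction h using ReflTransGen.head_induction_on with
  | refl => exact .inl rfl
  | head hs _ ih =>
    right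
    rcases ih with rfl | ⟨p, hp⟩
    · refine ⟨.cons hs.1 .nil, fun x hx => ?_⟩
      simp only [SimpleGraph.Walk.support_cons, SimpleGraph.Walk.support_nil, List.mem_cons,
        List.not_mem_nil, or_false] at hx
      rcases hx with rfl | rfl
      · exact hs.2.2 rfl
      · exact hs.2.1
    · refine ⟨.cons hs.1 p, fun x hx => ?_⟩
      rcases List.mem_cons.1 (by simpa using hx) with rfl | hx
      · exact hs.2.2 rfl
      · exact hp x hx

theorem exists_walk_of_exempt {u w : Fin n} (h : ReflTransGen (Step θ G .exempt) u w) :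
    ∃ p : G.Walk u w, p.IsPath ∧ ∀ x ∈ p.support.tail, ¬ IsBreakPoint θ G x := by
  suffices H : ∃ p : G.Walk u w, ∀ x ∈ p.support.tail, ¬ IsBreakPoint θ G x by
    obtain ⟨p, hp⟩ := H
    refine ⟨p.bypass, p.bypass_isPath, fun x hx => hp x ?_⟩
    -- The first vertex may be a break-point, but a simple path does not return to it, so the tail
    -- of the shortcut consists of vertices of the old tail.
    have h1 := p.bypass_isPath.support_nodup
    rw [← SimpleGraph.Walk.cons_tail_support, List.nodup_cons] at h1
    have h2 := p.support_bypass_subset_support (List.mem_of_mem_tail hx)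
    rw [← SimpleGraph.Walk.cons_tail_support] at h2
    rcases List.mem_cons.1 h2 with rfl | h2
    · exact absurd hx h1.1
    · exact h2
  induction h using ReflTransGen.head_induction_on with
  | refl => exact ⟨.nil, by simp⟩
  | head hs _ ih =>
    obtain ⟨p, hp⟩ := ih
    refine ⟨.cons hs.1 p, fun x hx => ?_⟩
    simp only [SimpleGraph.Walk.support_cons, List.tail_cons] at hx
    rw [← SimpleGraph.Walk.cons_tail_support] at hx
    rcases List.mem_cons.1 hx with rfl | hx
    · exact hs.2.1
    · exact hp x hx

theorem cycleBlock_eq_closure (ρ : StartRule) {a : Fin n} (C : G.Walk a a) :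
    cycleBlock θ G ρ C = closure θ G ρ {x | x ∈ C.support} := by
  ext w
  simp only [cycleBlock, closure, Set.mem_ofPred_eq]
  refine exists_congr fun v => and_congr_right fun hv => ?_
  constructor
  · rintro (rfl | ⟨p, hp⟩)
    · exact .refl
    · cases ρ
      · exact reflTransGen_included_of_walk p hp.2
      · exact reflTransGen_exempt_of_walk p hp.2
  · intro h
    cases ρ
    · rcases exists_walk_of_included h with rfl | ⟨p, hp⟩
      · exact .inl rfl
      · exact .inr ⟨p, hp⟩
    · obtain ⟨p, hp⟩ := exists_walk_of_exempt h
      exact .inr ⟨p, hp⟩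

/-- Under the rule `included` no step leaves a break-point, so the case distinction in the
definition is automatic. -/
theorem vertexBlock_eq_closure (v : Fin n) :
    vertexBlock θ G v = closure θ G .included {v} := by
  ext w
  simp only [vertexBlock, closure, Set.mem_singleton_iff, exists_eq_left, Set.mem_ofPred_eq]
  split_ifs with hv
  · rw [Set.mem_singleton_iff]
    constructor
    · rintro rfl; exact .refl
    · intro h
      rcases ReflTransGen.cases_head h with h | ⟨x, hx, -⟩
      · exact h.symm
      · exact absurd hv (hx.2.2 rfl)
  · constructor
    · rintro (rfl | ⟨p, hp⟩)
      · exact .refl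
      · exact reflTransGen_included_of_walk p hp.2
    · intro h
      rcases exists_walk_of_included h with rfl | h
      · exact .inl rfl
      · exact .inr h

/-- The vertices that are reached from `X` by at most `i` steps. -/
def ball (θ : Params) (G : SimpleGraph (Fin n)) (ρ : StartRule) (X : Set (Fin n)) : ℕ → Set (Fin n)
  | 0 => X
  | i + 1 => ball θ G ρ X i ∪ {w | ∃ u ∈ ball θ G ρ X i, Step θ G ρ u w}

theorem ball_subset_closure (ρ : StartRule) (X : Set (Fin n)) (i : ℕ) :
    ball θ G ρ X i ⊆ closure θ G ρ X := by
  induction i with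
  | zero => exact fun x hx => ⟨x, hx, .refl⟩
  | succ i ih =>
    rintro w (hw | ⟨u, hu, hs⟩)
    · exact ih hw
    · obtain ⟨x, hx, h⟩ := ih hu
      exact ⟨x, hx, h.tail hs⟩

theorem closure_step {ρ : StartRule} {X : Set (Fin n)} {u w : Fin n} (hu : u ∈ closure θ G ρ X)
    (h : Step θ G ρ u w) : w ∈ closure θ G ρ X := by
  obtain ⟨x, hx, h'⟩ := hu
  exact ⟨x, hx, h'.tail h⟩

theorem exists_mem_ball {ρ : StartRule} {X : Set (Fin n)} {w : Fin n}
    (h : w ∈ closure θ G ρ X) : ∃ i, w ∈ ball θ G ρ X i := by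
  obtain ⟨x, hx, h⟩ := h
  induction h with
  | refl => exact ⟨0, hx⟩
  | tail _ hs ih =>
    obtain ⟨i, hi⟩ := ih
    exact ⟨i + 1, .inr ⟨_, hi, hs⟩⟩

theorem ball_mono (ρ : StartRule) (X : Set (Fin n)) : Monotone (ball θ G ρ X) :=
  monotone_nat_of_le_succ fun _ _ h => .inl h

/-- `n` rounds suffice. -/
theorem ball_eq_closure (ρ : StartRule) (X : Set (Fin n)) :
    ball θ G ρ X n = closure θ G ρ X := by
  have hstab : ∀ i, ball θ G ρ X (i + 1) = ball θ G ρ X i → closure θ G ρ X ⊆ ball θ G ρ X i := by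
    rintro i hi w ⟨x, hx, h⟩
    induction h with
    | refl => exact ball_mono ρ X (Nat.zero_le i) hx
    | tail _ hs ih => exact hi ▸ Or.inr ⟨_, ih, hs⟩
  -- A round that adds nothing completes the closure; until then every round adds a vertex.
  have hcard : ∀ i, closure θ G ρ X ⊆ ball θ G ρ X i ∨ i ≤ (ball θ G ρ X i).ncard := by
    intro i
    induction i with
    | zero => right; exact Nat.zero_le _
    | succ i ih =>
      rcases ih with ih | ih
      · left; exact ih.trans (ball_mono ρ X (Nat.le_succ i))
      · by_cases heq : ball θ G ρ X (i + 1) = ball θ G ρ X i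
        · left; rw [heq]; exact hstab i heq
        · right
          have : ball θ G ρ X i ⊂ ball θ G ρ X (i + 1) :=
            (ball_mono ρ X (Nat.le_succ i)).ssubset_of_ne (Ne.symm heq)
          have := Set.ncard_lt_ncard this
          omega
  refine (ball_subset_closure ρ X n).antisymm ?_
  rcases hcard n with h | h
  · exact h
  · have : ball θ G ρ X n = Set.univ := by
      refine Set.eq_univ_of_univ_subset ?_
      rw [Set.eq_of_subset_of_ncard_le (Set.subset_univ (ball θ G ρ X n)) (by simpa [Set.ncard_univ] using h)]
    rw [this]; exact Set.subset_univ _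

end Closure

/-! ### The blocks of a typical graph have at most one cycle -/

section TreeUnicyclic

open Classical Relation

variable {n : ℕ} {θ : Params} {G : SimpleGraph (Fin n)}

theorem within_induce_card (G : SimpleGraph (Fin n)) (B : Set (Fin n)) :
    (G.induce B).edgeSet.ncard = spanned G B.toFinset := by
  rw [spanned_eq]
  have h1 : (within G B.toFinset).edgeFinset.card = (within G B.toFinset).edgeSet.ncard := by
    rw [Set.ncard_eq_toFinset_card']; rfl
  rw [h1]
  have h2 : (within G B.toFinset).edgeSet = Sym2.map Subtype.val '' (G.induce B).edgeSet := by
    ext e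
    induction e with
    | _ x y =>
      constructor
      · rintro ⟨h, hx, hy⟩
        exact ⟨s(⟨x, Set.mem_toFinset.1 hx⟩, ⟨y, Set.mem_toFinset.1 hy⟩), h, rfl⟩
      · rintro ⟨e, he, h⟩
        induction e with
        | _ a b =>
          have hab : (within G B.toFinset).Adj a b :=
            ⟨he, Set.mem_toFinset.2 a.2, Set.mem_toFinset.2 b.2⟩
          rw [Sym2.map_mk] at h
          rw [← h]
          exact hab
  rw [h2, Set.ncard_image_of_injective _ (Sym2.map.injective Subtype.val_injective)]

/-- A vertex of a closure outside the base set is reached through a short chain. -/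
theorem exists_parent_chain {ρ : StartRule} {X : Set (Fin n)} {r : ℝ}
    (hshort : ∀ {u v : Fin n} {p : G.Walk u v}, IsInfluencePath θ G p → (p.length : ℝ) < r)
    (hr : 0 ≤ r) :
    ∃ par : Fin n → Fin n, ∃ lev : Fin n → ℕ,
      (∀ x ∈ closure θ G ρ X, x ∉ X → Step θ G ρ (par x) x ∧ par x ∈ closure θ G ρ X ∧
        lev x = lev (par x) + 1) ∧
      ∀ x ∈ closure θ G ρ X, ∃ T : Finset (Fin n), (x ∈ X ∨ x ∈ T) ∧
        (T.card : ℝ) ≤ r + 1 ∧ ∀ z ∈ T, z ∈ closure θ G ρ X ∧ z ∉ X ∧ (par z ∈ X ∨ par z ∈ T) := by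
  -- The distance from `X` in steps; the default value 0 outside the closure plays no role.
  set lev : Fin n → ℕ := fun x => if h : ∃ i, x ∈ ball θ G ρ X i then Nat.find h else 0 with hlev
  have hlev0 : ∀ x ∈ X, lev x = 0 := fun x hx => by
    have h : ∃ i, x ∈ ball θ G ρ X i := ⟨0, hx⟩
    simp only [hlev, dif_pos h]
    exact (Nat.find_eq_zero h).2 hx
  have hle : ∀ x i, x ∈ ball θ G ρ X i → lev x ≤ i := fun x i hx => by
    have h : ∃ i, x ∈ ball θ G ρ X i := ⟨i, hx⟩
    simp only [hlev, dif_pos h]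
    exact Nat.find_min' h hx
  have hmem : ∀ x ∈ closure θ G ρ X, x ∈ ball θ G ρ X (lev x) := fun x hx => by
    have h := exists_mem_ball hx
    simp only [hlev, dif_pos h]
    exact Nat.find_spec h
  have hpar : ∀ x, ∃ y, x ∈ closure θ G ρ X → x ∉ X → Step θ G ρ y x ∧ y ∈ closure θ G ρ X ∧
      lev x = lev y + 1 := by
    intro x
    by_cases hx : x ∈ closure θ G ρ X ∧ x ∉ X
    · have h1 := hmem x hx.1
      obtain ⟨i, hi⟩ : ∃ i, lev x = i + 1 := by
        refine Nat.exists_eq_succ_of_ne_zero fun h0 => hx.2 ?_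
        rw [h0] at h1; exact h1
      rw [hi] at h1
      rcases h1 with h1 | ⟨y, hy, hs⟩
      · have := hle x i h1; omega
      · refine ⟨y, fun _ _ => ⟨hs, ball_subset_closure ρ X i hy, ?_⟩⟩
        have h2 := hle y i hy
        have h3 : x ∈ ball θ G ρ X (lev y + 1) :=
          .inr ⟨y, hmem y (ball_subset_closure ρ X i hy), hs⟩
        have := hle x _ h3
        omega
    · exact ⟨x, fun h1 h2 => absurd ⟨h1, h2⟩ hx⟩
  choose par hpar using hpar
  refine ⟨par, lev, hpar, ?_⟩
  -- The chain of ancestors outside `X`. Each of them is the target of a step, hence not a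
  -- break-point under either rule, and the levels decrease along the chain. So it is an influence
  -- path and short.
  have hwalk : ∀ i x, x ∈ closure θ G ρ X → x ∉ X → lev x = i + 1 →
      ∃ (y : Fin n) (p : G.Walk x y), IsInfluencePath θ G p ∧ p.length = i ∧
        ∀ z ∈ p.support, z ∈ closure θ G ρ X ∧ z ∉ X ∧ lev z ≤ i + 1 ∧
          (par z ∈ X ∨ par z ∈ p.support) := by
    intro i
    induction i with
    | zero =>
      intro x hx hxX hl
      obtain ⟨hs, hc, hl2⟩ := hpar x hx hxX
      refine ⟨x, .nil, ⟨.nil, ?_⟩, rfl, ?_⟩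
      · intro z hz
        rw [SimpleGraph.Walk.support_nil, List.mem_singleton] at hz
        exact hz ▸ hs.2.1
      · intro z hz
        rw [SimpleGraph.Walk.support_nil, List.mem_singleton] at hz
        subst hz
        refine ⟨hx, hxX, hl.le, .inl ?_⟩
        have h0 : lev (par z) = 0 := by omega
        have := hmem _ hc
        rw [h0] at this
        exact this
    | succ i ih =>
      intro x hx hxX hl
      obtain ⟨hs, hc, hl2⟩ := hpar x hx hxX
      have hpX : par x ∉ X := fun h => by have := hlev0 _ h; omega
      obtain ⟨y, p, ⟨hp, hnb⟩, hlen, hsup⟩ := ih (par x) hc hpX (by omega)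
      refine ⟨y, .cons hs.1.symm p, ⟨?_, ?_⟩, by simp [hlen], ?_⟩
      · rw [SimpleGraph.Walk.cons_isPath_iff]
        refine ⟨hp, fun h => ?_⟩
        have := (hsup x h).2.2.1
        omega
      · intro z hz
        rcases List.mem_cons.1 (by simpa using hz) with rfl | hz
        · exact hs.2.1
        · exact hnb z hz
      · intro z hz
        rcases List.mem_cons.1 (by simpa using hz) with rfl | hz
        · exact ⟨hx, hxX, hl.le, .inr (by simp)⟩
        · obtain ⟨h1, h2, h3, h4⟩ := hsup z hz
          refine ⟨h1, h2, by omega, h4.imp_right fun h => by simp [h]⟩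
  intro x hx
  by_cases hxX : x ∈ X
  · exact ⟨∅, .inl hxX, by simpa using by linarith, by simp⟩
  · obtain ⟨i, hi⟩ : ∃ i, lev x = i + 1 := ⟨_, (hpar x hx hxX).2.2⟩
    obtain ⟨y, p, hp, hlen, hsup⟩ := hwalk i x hx hxX hi
    refine ⟨p.support.toFinset, .inr (by simp), ?_, fun z hz => ?_⟩
    · have h1 := hshort hp
      have h2 := List.toFinset_card_le p.support
      rw [SimpleGraph.Walk.length_support] at h2
      have : ((p.support.toFinset.card : ℕ) : ℝ) ≤ (p.length + 1 : ℕ) := by exact_mod_cast h2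
      push_cast at this
      linarith
    · obtain ⟨h1, h2, -, h4⟩ := hsup z (List.mem_toFinset.1 hz)
      exact ⟨h1, h2, h4.imp_right List.mem_toFinset.2⟩

theorem connected_induce_closure {ρ : StartRule} {X : Set (Fin n)} (hX : (G.induce X).Connected) :
    (G.induce (closure θ G ρ X)).Connected := by
  obtain ⟨⟨a, ha⟩⟩ := hX.nonempty
  have hsub : X ⊆ closure θ G ρ X := fun x hx => ⟨x, hx, .refl⟩
  rw [SimpleGraph.connected_iff_exists_forall_reachable]
  refine ⟨⟨a, hsub ha⟩, ?_⟩
  rintro ⟨w, x, hx, h⟩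
  induction h with
  | refl =>
    have := hX.preconnected ⟨a, ha⟩ ⟨x, hx⟩
    exact this.map (SimpleGraph.induceHomOfLE G hsub).toHom
  | @tail b c h1 hs ih =>
    refine ih.trans (SimpleGraph.Adj.reachable ?_)
    exact hs.1

theorem cycle_card {a : Fin n} {C : G.Walk a a} (hC : C.IsCycle) :
    C.support.toFinset.card = C.length ∧ C.edges.toFinset.card = C.length := by
  constructor
  · have h1 : C.support.toFinset = C.support.tail.toFinset := by
      have h2 := C.end_mem_tail_support hC.not_nil
      conv_lhs => rw [← SimpleGraph.Walk.cons_tail_support]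
      rw [List.toFinset_cons, Finset.insert_eq_of_mem (List.mem_toFinset.2 h2)]
    rw [h1, List.toFinset_card_of_nodup hC.support_nodup, List.length_tail,
      SimpleGraph.Walk.length_support]
    rfl
  · rw [List.toFinset_card_of_nodup hC.isTrail.edges_nodup, SimpleGraph.Walk.length_edges]

/-- On any set that contains the cycle and is closed under parents, the edges of the cycle and the
edges to parents are as many as the vertices. A further edge of the block, with the cycle and the
chains of its two ends, would give a set of at most `4 D + 2 (3 D + 1) ≤ 20 D` vertices that spans
an edge too many. So the block has no further edge. -/
theorem isUnicyclic_cycleBlock {ρ : StartRule} {D : ℝ} (hD : 5 ≤ D)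
    (hdense : ¬ HasDenseSet G (20 * D))
    (hshort : ∀ {u v : Fin n} {p : G.Walk u v}, IsInfluencePath θ G p → (p.length : ℝ) < 3 * D)
    {a : Fin n} {C : G.Walk a a} (hC : C.IsCycle) (hCl : (C.length : ℝ) ≤ 4 * D) :
    IsUnicyclic G (cycleBlock θ G ρ C) := by
  rw [cycleBlock_eq_closure]
  set X : Set (Fin n) := {x | x ∈ C.support} with hX
  have hconn : (G.induce X).Connected := C.connected_induce_support
  refine ⟨connected_induce_closure hconn, ?_⟩
  rw [within_induce_card, Set.ncard_eq_toFinset_card']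
  obtain ⟨par, lev, hpar, hT⟩ := exists_parent_chain (ρ := ρ) (X := X) hshort (by linarith)
  set B := closure θ G ρ X with hB
  set X' := C.support.toFinset with hX'
  have hXX : ∀ x, x ∈ X' ↔ x ∈ X := fun x => List.mem_toFinset
  have hXB : X ⊆ B := fun x hx => ⟨x, hx, .refl⟩
  -- the edges of the cycle and the edges from the vertices of `S` to their parents
  set F : Finset (Fin n) → Finset (Sym2 (Fin n)) := fun S =>
    C.edges.toFinset ∪ (S \ X').image fun z => s(par z, z) with hF
  have hFcard : ∀ S : Finset (Fin n), X' ⊆ S → (∀ z ∈ S, z ∈ B) → (F S).card = S.card := by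
    intro S hS hSB
    rw [hF]
    simp only
    rw [Finset.card_union_of_disjoint, (cycle_card hC).2, Finset.card_image_of_injOn,
      Finset.card_sdiff_of_subset hS, (cycle_card hC).1]
    · have := Finset.card_le_card hS
      rw [(cycle_card hC).1] at this
      omega
    -- Two vertices cannot be parents of each other, since the level drops from a vertex to its
    -- parent.
    · intro x hx y hy hxy
      simp only [Finset.coe_sdiff, Set.mem_sdiff, Finset.mem_coe, hXX] at hx hy
      rcases Sym2.eq_iff.1 hxy with ⟨-, h⟩ | ⟨h1, h2⟩
      · exact h
      · have h3 := (hpar x (hSB x hx.1) hx.2).2.2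
        have h4 := (hpar y (hSB y hy.1) hy.2).2.2
        rw [h1] at h3
        rw [← h2] at h4
        omega
    · rw [Finset.disjoint_left]
      intro e he he2
      obtain ⟨z, hz, rfl⟩ := Finset.mem_image.1 he2
      have h1 := (Finset.mem_sdiff.1 hz).2
      exact h1 (List.mem_toFinset.2 (C.snd_mem_support_of_mem_edges (List.mem_toFinset.1 he)))
  have hFsub : ∀ S : Finset (Fin n), X' ⊆ S → (∀ z ∈ S, z ∈ B) → (∀ z ∈ S, z ∉ X' → par z ∈ S) →
      F S ⊆ (within G S).edgeFinset := by
    intro S hS hSB hSp e he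
    rw [SimpleGraph.mem_edgeFinset]
    rcases Finset.mem_union.1 he with he | he
    · have he := List.mem_toFinset.1 he
      induction e with
      | _ x y =>
        exact ⟨C.adj_of_mem_edges he, hS (List.mem_toFinset.2 (C.fst_mem_support_of_mem_edges he)),
          hS (List.mem_toFinset.2 (C.snd_mem_support_of_mem_edges he))⟩
    · obtain ⟨z, hz, rfl⟩ := Finset.mem_image.1 he
      obtain ⟨hzS, hzX⟩ := Finset.mem_sdiff.1 hz
      exact ⟨(hpar z (hSB z hzS) fun h => hzX ((hXX z).2 h)).1.1, hSp z hzS hzX, hzS⟩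
  have hBf : ∀ z ∈ B.toFinset, z ∈ B := fun z hz => Set.mem_toFinset.1 hz
  have hXBf : X' ⊆ B.toFinset := fun x hx => Set.mem_toFinset.2 (hXB ((hXX x).1 hx))
  have hBp : ∀ z ∈ B.toFinset, z ∉ X' → par z ∈ B.toFinset := fun z hz hzX =>
    Set.mem_toFinset.2 (hpar z (hBf z hz) fun h => hzX ((hXX z).2 h)).2.1
  rw [spanned_eq, ← hFcard _ hXBf hBf]
  congr 1
  refine ((hFsub _ hXBf hBf hBp).antisymm ?_).symm
  intro f hf
  by_contra hfF
  rw [SimpleGraph.mem_edgeFinset] at hf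
  induction f with
  | _ x y =>
    obtain ⟨hadj, hx, hy⟩ := hf
    obtain ⟨Tx, hx1, hx2, hx3⟩ := hT x (hBf x hx)
    obtain ⟨Ty, hy1, hy2, hy3⟩ := hT y (hBf y hy)
    set S := X' ∪ (Tx ∪ Ty) with hS
    have hSX : X' ⊆ S := Finset.subset_union_left
    have hSB : ∀ z ∈ S, z ∈ B := by
      intro z hz
      simp only [hS, Finset.mem_union] at hz
      rcases hz with hz | hz | hz
      · exact hXB ((hXX z).1 hz)
      · exact (hx3 z hz).1
      · exact (hy3 z hz).1
    have hSp : ∀ z ∈ S, z ∉ X' → par z ∈ S := by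
      intro z hz hzX
      simp only [hS, Finset.mem_union, hXX] at hz hzX ⊢
      rcases hz with hz | hz | hz
      · exact absurd hz hzX
      · exact (hx3 z hz).2.2.imp_right .inl
      · exact (hy3 z hz).2.2.imp_right .inr
    have hSs : S ⊆ B.toFinset := fun z hz => Set.mem_toFinset.2 (hSB z hz)
    refine hdense ⟨S, ?_, ?_⟩
    · have h1 := Finset.card_union_le X' (Tx ∪ Ty)
      have h2 := Finset.card_union_le Tx Ty
      rw [(cycle_card hC).1] at h1
      have h3 : ((S.card : ℕ) : ℝ) ≤ (C.length + (Tx.card + Ty.card) : ℕ) := by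
        exact_mod_cast h1.trans (Nat.add_le_add_left h2 _)
      push_cast at h3
      linarith
    · rw [spanned_eq]
      have hfS : s(x, y) ∉ F S := fun h => hfF (by
        rcases Finset.mem_union.1 h with h | h
        · exact Finset.mem_union_left _ h
        · refine Finset.mem_union_right _ ?_
          exact Finset.image_subset_image (Finset.sdiff_subset_sdiff hSs (le_refl _)) h)
      have h1 : insert s(x, y) (F S) ⊆ (within G S).edgeFinset := by
        refine Finset.insert_subset ?_ (hFsub S hSX hSB hSp)
        rw [SimpleGraph.mem_edgeFinset]
        refine ⟨hadj, ?_, ?_⟩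
        · simp only [hS, Finset.mem_union, hXX]
          exact hx1.imp_right .inl
        · simp only [hS, Finset.mem_union, hXX]
          exact hy1.imp_right .inr
      have h2 := Finset.card_le_card h1
      rw [Finset.card_insert_of_notMem hfS, hFcard S hSX hSB] at h2
      exact h2

theorem Step.symm_included {u w : Fin n} (h : Step θ G .included u w) : Step θ G .included w u :=
  ⟨h.1.symm, h.2.2 rfl, fun _ => h.2.1⟩

theorem closure_included_subset (ρ : StartRule) (X : Set (Fin n)) :
    closure θ G .included X ⊆ closure θ G ρ X := by
  rintro w ⟨u, hu, h⟩
  exact ⟨u, hu, ReflTransGen.mono (fun x y hs => ⟨hs.1, hs.2.1, fun _ => hs.2.2 rfl⟩) _ _ h⟩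

/-- If `v` is not a break-point, neither is any vertex of its block, so a cycle inside the block is
an influence path with one edge added. It is therefore short enough to have a block of its own, and
that block contains `v`, against the assumption. -/
theorem isTree_vertexBlock {ρ : StartRule} (hD : 1 ≤ scale θ.d n)
    (hshort : ∀ {u v : Fin n} {p : G.Walk u v}, IsInfluencePath θ G p →
      (p.length : ℝ) < 3 * scale θ.d n)
    {v : Fin n} (hv : ∀ B ∈ cycleBlocks θ G ρ, v ∉ B) :
    (G.induce (vertexBlock θ G v)).IsTree := by
  have hconn : (G.induce (vertexBlock θ G v)).Connected := by
    rw [vertexBlock_eq_closure]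
    refine connected_induce_closure ?_
    rw [SimpleGraph.connected_iff_exists_forall_reachable]
    refine ⟨⟨v, rfl⟩, ?_⟩
    rintro ⟨w, rfl⟩
    rfl
  refine ⟨hconn, ?_⟩
  by_cases hbp : IsBreakPoint θ G v
  · have : vertexBlock θ G v = {v} := by rw [vertexBlock, if_pos hbp]
    rw [this]
    exact SimpleGraph.IsAcyclic.of_subsingleton
  · intro c' C' hC'
    obtain ⟨c, C, hC, hCB⟩ : ∃ (c : Fin n) (C : G.Walk c c), C.IsCycle ∧
        ∀ x ∈ C.support, x ∈ vertexBlock θ G v := by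
      set f := (SimpleGraph.Embedding.induce (G := G) (vertexBlock θ G v)) with hf
      refine ⟨_, C'.map f.toHom, hC'.map f.injective, fun x hx => ?_⟩
      rw [SimpleGraph.Walk.support_map, List.mem_map] at hx
      obtain ⟨y, -, rfl⟩ := hx
      exact y.2
    rw [vertexBlock_eq_closure] at hCB
    have hnb : ∀ x ∈ C.support, ¬ IsBreakPoint θ G x := by
      intro x hx
      obtain ⟨u, hu, h⟩ := hCB x hx
      rw [Set.mem_singleton_iff] at hu
      subst hu
      rcases ReflTransGen.cases_tail h with rfl | ⟨y, -, hs⟩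
      · exact hbp
      · exact hs.2.1
    have hp : IsInfluencePath θ G C.tail := by
      refine ⟨hC.isPath_tail, fun x hx => hnb x ?_⟩
      rw [SimpleGraph.Walk.support_tail_of_not_nil _ hC.not_nil] at hx
      exact List.mem_of_mem_tail hx
    have hlen := hshort hp
    -- The closing edge raises the bound from `3` to at most `4` times the scale, by `hD`; this is
    -- the length allowed for short cycles.
    have hlen2 : C.tail.length + 1 = C.length := C.length_tail_add_one hC.not_nil
    have hCl : (C.length : ℝ) ≤ 4 * scale θ.d n := by
      rw [← hlen2]; push_cast; linarith
    refine hv _ ⟨_, C, hC, hCl, rfl⟩ ?_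
    rw [cycleBlock_eq_closure]
    refine closure_included_subset ρ _ ?_
    obtain ⟨u, hu, h⟩ := hCB _ C.start_mem_support
    rw [Set.mem_singleton_iff] at hu
    subst hu
    -- Between vertices that are not break-points steps can be reversed, so `v` is reached back from
    -- the cycle.
    have : Std.Symm (Step θ G .included) := ⟨fun _ _ hs => hs.symm_included⟩
    exact ⟨_, C.start_mem_support, ReflTransGen.stdSymm.symm _ _ h⟩

/-- All blocks of a typical graph are trees or unicyclic. -/
theorem isTree_or_isUnicyclic_of_mem_blocks (h : LargeDegree θ.α θ.γ θ.c θ.d)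
    (hG : Typical θ G) (hn : 5 ≤ scale θ.d n) {ρ : StartRule} {B : Set (Fin n)}
    (hB : B ∈ blocks θ G ρ) : (G.induce B).IsTree ∨ IsUnicyclic G B := by
  rcases hB with ⟨a, C, hC, hCl, rfl⟩ | ⟨v, hv, rfl⟩
  · exact .inr (isUnicyclic_cycleBlock hn hG.1 (influencePath_length_lt h hG hn) hC hCl)
  · exact .inl (isTree_vertexBlock (by linarith) (influencePath_length_lt h hG hn) hv)

end TreeUnicyclic

/-! ### A language with named arrays, and its compilation to the machine -/

/-- The names of the arrays of natural numbers; scalars are arrays of which only the cell `0` is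
used. -/
inductive NV
  | n | i | j | k | u | v | w | r | fl | eq | off | tail | cnt | ncyc | last | par | root | nb | cur | rows
  deriving DecidableEq

/-- The names of the arrays of real numbers. -/
inductive RV
  | wt | rw | p1 | p2
  deriving DecidableEq

def NV.idx : NV → ℕ
  | n => 0 | i => 1 | j => 2 | k => 3 | u => 4 | v => 5 | w => 6 | r => 7 | fl => 8 | eq => 9
  | off => 10 | tail => 11 | cnt => 12 | ncyc => 13 | last => 14 | par => 15 | root => 16 | nb => 17
  | cur => 18 | rows => 19

def RV.idx : RV → ℕ
  | wt => 0 | rw => 1 | p1 => 2 | p2 => 3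

theorem NV.idx_injective : Function.Injective NV.idx := by
  intro a b h; cases a <;> cases b <;> first | rfl | cases h

theorem RV.idx_injective : Function.Injective RV.idx := by
  intro a b h; cases a <;> cases b <;> first | rfl | cases h

theorem NV.idx_lt (a : NV) : a.idx < 31 := by cases a <;> decide

theorem RV.idx_lt (a : RV) : a.idx < 31 := by cases a <;> decide

/-- The states of the language. -/
structure St where
  nat : NV → ℕ → ℕ
  real : RV → ℕ → ℝ

def St.setN (s : St) (a : NV) (i k : ℕ) : St :=
  { s with nat := Function.update s.nat a (Function.update (s.nat a) i k) }

def St.setR (s : St) (a : RV) (i : ℕ) (x : ℝ) : St :=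
  { s with real := Function.update s.real a (Function.update (s.real a) i x) }

inductive NExp
  | cst (k : ℕ)
  | cell (a : NV) (e : NExp)
  | add (e f : NExp)
  | edge (e f : NExp)

inductive RExp
  | cst (x : ℝ)
  | cell (a : RV) (e : NExp)
  | mul (e f : RExp)
  | cast (e : NExp)

inductive Cond
  | nle (e f : NExp)
  | rle (e f : RExp)

inductive Cmd
  | skip
  | setN (a : NV) (i e : NExp)
  | setR (a : RV) (i : NExp) (e : RExp)
  | seq (C D : Cmd)
  | ite (b : Cond) (C D : Cmd)
  | while (b : Cond) (C : Cmd)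

section Semantics

variable {n : ℕ} (G : SimpleGraph (Fin n))

def NExp.eval (s : St) : NExp → ℕ
  | .cst k => k
  | .cell a e => s.nat a (e.eval s)
  | .add e f => e.eval s + f.eval s
  | .edge e f => adjEntry G (e.eval s) (f.eval s)

def RExp.eval (s : St) : RExp → ℝ
  | .cst x => x
  | .cell a e => s.real a (e.eval G s)
  | .mul e f => e.eval s * f.eval s
  | .cast e => (e.eval G s : ℝ)

def Cond.Holds (s : St) : Cond → Prop
  | .nle e f => e.eval G s ≤ f.eval G s
  | .rle e f => e.eval G s ≤ f.eval G s

/-- Big-step semantics; every assignment and every test counts as one step. -/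
inductive HExec : Cmd → St → ℕ → St → Prop
  | skip (s : St) : HExec .skip s 0 s
  | setN (a : NV) (i e : NExp) (s : St) :
      HExec (.setN a i e) s 1 (s.setN a (i.eval G s) (e.eval G s))
  | setR (a : RV) (i : NExp) (e : RExp) (s : St) :
      HExec (.setR a i e) s 1 (s.setR a (i.eval G s) (e.eval G s))
  | seq {C D : Cmd} {s s' s'' : St} {t t' : ℕ} :
      HExec C s t s' → HExec D s' t' s'' → HExec (.seq C D) s (t + t') s''
  | ite_true {b : Cond} {C D : Cmd} {s s' : St} {t : ℕ} :
      b.Holds G s → HExec C s t s' → HExec (.ite b C D) s (t + 1) s'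
  | ite_false {b : Cond} {C D : Cmd} {s s' : St} {t : ℕ} :
      ¬ b.Holds G s → HExec D s t s' → HExec (.ite b C D) s (t + 1) s'
  | while_true {b : Cond} {C : Cmd} {s s' s'' : St} {t t' : ℕ} :
      b.Holds G s → HExec C s t s' → HExec (.while b C) s' t' s'' →
      HExec (.while b C) s (t + t' + 1) s''
  | while_false {b : Cond} {C : Cmd} {s : St} :
      ¬ b.Holds G s → HExec (.while b C) s 1 s

end Semantics

/-! #### Compilation

The cell `i` of the array with index `a` has address `32 * i + a`; the array with index `31` holds
intermediate results. -/

/-- The address of the `k`-th cell for intermediate results. -/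
def scratch (k : ℕ) : ℕ := 32 * k + 31

/-- Replaces the number `i` in the `k`-th scratch cell by `32 * i + a`. -/
def toAddress (a k : ℕ) : Prog :=
  let dbl : Prog := .op (.nadd (.dir (scratch k)) (.dir (scratch k)) (.dir (scratch k)))
  .seq dbl (.seq dbl (.seq dbl (.seq dbl (.seq dbl (.seq (.op (.nconst (.dir (scratch (k + 1))) a))
    (.op (.nadd (.dir (scratch k)) (.dir (scratch k)) (.dir (scratch (k + 1))))))))))

/-- The scratch cells form a stack: the value is left in cell `k`, and only cells from `k` on are
used. -/
def NExp.compile : NExp → ℕ → Prog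
  | .cst c, k => .op (.nconst (.dir (scratch k)) c)
  | .cell a e, k => .seq (e.compile k) (.seq (toAddress a.idx k)
      (.op (.ncopy (.dir (scratch k)) (.ind (scratch k)))))
  | .add e f, k => .seq (e.compile k) (.seq (f.compile (k + 1))
      (.op (.nadd (.dir (scratch k)) (.dir (scratch k)) (.dir (scratch (k + 1))))))
  | .edge e f, k => .seq (e.compile k) (.seq (f.compile (k + 1))
      (.op (.edge (.dir (scratch k)) (.dir (scratch k)) (.dir (scratch (k + 1))))))

/-- Pending intermediate values are real numbers, so addresses can always be computed in the scratch
cells for naturals from number 0 on. -/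
def RExp.compile : RExp → ℕ → Prog
  | .cst x, k => .op (.rconst (.dir (scratch k)) x)
  | .cell a e, k => .seq (e.compile 0) (.seq (toAddress a.idx 0)
      (.op (.rcopy (.dir (scratch k)) (.ind (scratch 0)))))
  | .mul e f, k => .seq (e.compile k) (.seq (f.compile (k + 1))
      (.op (.rmul (.dir (scratch k)) (.dir (scratch k)) (.dir (scratch (k + 1))))))
  | .cast e, k => .seq (e.compile 0) (.op (.cast (.dir (scratch k)) (.dir (scratch 0))))

def Cond.compile : Cond → Prog
  | .nle e f => .seq (e.compile 0) (f.compile 1)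
  | .rle e f => .seq (e.compile 0) (f.compile 1)

def Cond.test : Cond → Test
  | .nle _ _ => .nle (.dir (scratch 0)) (.dir (scratch 1))
  | .rle _ _ => .rle (.dir (scratch 0)) (.dir (scratch 1))

/-- In `setR` the value is computed before the address, since its evaluation may overwrite the
scratch cell of the address. A machine test only compares cells, so the condition of a loop is
evaluated once before the loop and again at the end of each round. -/
def Cmd.compile : Cmd → Prog
  | .skip => .skip
  | .setN a i e => .seq (i.compile 0) (.seq (toAddress a.idx 0) (.seq (e.compile 1)
      (.op (.ncopy (.ind (scratch 0)) (.dir (scratch 1))))))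
  | .setR a i e => .seq (e.compile 0) (.seq (i.compile 0) (.seq (toAddress a.idx 0)
      (.op (.rcopy (.ind (scratch 0)) (.dir (scratch 0))))))
  | .seq C D => .seq C.compile D.compile
  | .ite b C D => .seq b.compile (.ite b.test C.compile D.compile)
  | .while b C => .seq b.compile (.while b.test (.seq C.compile b.compile))

/-- The memory `m` represents the state `s`. -/
structure Rep (m : Mem) (s : St) : Prop where
  nat : ∀ (a : NV) (i : ℕ), m.nat (32 * i + a.idx) = s.nat a i
  real : ∀ (a : RV) (i : ℕ), m.real (32 * i + a.idx) = s.real a i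

theorem scratch_injective : Function.Injective scratch := fun a b h => by
  simp only [scratch] at h; omega

theorem NV.addr_ne_scratch (a : NV) (i k : ℕ) : 32 * i + a.idx ≠ scratch k := by
  have := a.idx_lt
  simp only [scratch]; omega

theorem RV.addr_ne_scratch (a : RV) (i k : ℕ) : 32 * i + a.idx ≠ scratch k := by
  have := a.idx_lt
  simp only [scratch]; omega

theorem NV.addr_eq_iff (a b : NV) (i j : ℕ) :
    32 * i + a.idx = 32 * j + b.idx ↔ a = b ∧ i = j := by
  have := a.idx_lt
  have := b.idx_lt
  constructor
  · intro h
    exact ⟨NV.idx_injective (by omega), by omega⟩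
  · rintro ⟨rfl, rfl⟩; rfl

theorem RV.addr_eq_iff (a b : RV) (i j : ℕ) :
    32 * i + a.idx = 32 * j + b.idx ↔ a = b ∧ i = j := by
  have := a.idx_lt
  have := b.idx_lt
  constructor
  · intro h
    exact ⟨RV.idx_injective (by omega), by omega⟩
  · rintro ⟨rfl, rfl⟩; rfl

theorem Rep.setReal_scratch {m : Mem} {s : St} (h : Rep m s) (k : ℕ) (x : ℝ) :
    Rep (m.setReal (scratch k) x) s where
  nat := h.nat
  real a i := by
    simp only [Mem.setReal]
    rw [Function.update_of_ne (a.addr_ne_scratch i k)]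
    exact h.real a i

theorem Rep.setN {m : Mem} {s : St} (h : Rep m s) (a : NV) (i x : ℕ) :
    Rep (m.setNat (32 * i + a.idx) x) (s.setN a i x) where
  nat b j := by
    simp only [Mem.setNat, St.setN, Function.update_apply, NV.addr_eq_iff]
    by_cases hb : b = a
    · subst hb
      by_cases hj : j = i <;> simp [hj, h.nat]
    · simp [hb, h.nat]
  real := h.real

theorem Rep.setR {m : Mem} {s : St} (h : Rep m s) (a : RV) (i : ℕ) (x : ℝ) :
    Rep (m.setReal (32 * i + a.idx) x) (s.setR a i x) where
  nat := h.nat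
  real b j := by
    simp only [Mem.setReal, St.setR, Function.update_apply, RV.addr_eq_iff]
    by_cases hb : b = a
    · subst hb
      by_cases hj : j = i <;> simp [hj, h.real]
    · simp [hb, h.real]

/-! ### Correctness and cost of the compilation -/

section Correctness

variable {n : ℕ} (G : SimpleGraph (Fin n))

/-- `P` ends within `c` steps, has the value `x` in the `k`-th scratch cell at the end and modifies
only the scratch cells from the `k`-th on. -/
def ComputesN (P : Prog) (k c : ℕ) (m : Mem) (x : ℕ) : Prop :=
  ∃ t m', Exec G P m t m' ∧ t ≤ c ∧ m'.nat (scratch k) = x ∧ m'.real = m.real ∧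
    ∀ j, (∀ l ≥ k, j ≠ scratch l) → m'.nat j = m.nat j

theorem Rep.of_eq {m m' : Mem} {s : St} (h : Rep m s) {k : ℕ} (hr : m'.real = m.real)
    (hn : ∀ j, (∀ l ≥ k, j ≠ scratch l) → m'.nat j = m.nat j) : Rep m' s where
  nat a i := (hn _ fun l _ => a.addr_ne_scratch i l).trans (h.nat a i)
  real a i := by rw [hr]; exact h.real a i

theorem computesN_toAddress (a k : ℕ) (m : Mem) :
    ComputesN G (toAddress a k) k 7 m (32 * m.nat (scratch k) + a) := by
  have hk : scratch k ≠ scratch (k + 1) := fun h => by have := scratch_injective h; omega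
  refine ⟨_, _, .seq (.op _ _) (.seq (.op _ _) (.seq (.op _ _) (.seq (.op _ _) (.seq (.op _ _)
    (.seq (.op _ _) (.op _ _)))))), le_rfl, ?_, rfl, ?_⟩
  · simp only [Op.run, Mem.setNat, Addr.eval, Function.update_self,
      Function.update_of_ne hk]
    omega
  · intro j hj
    have h1 := hj k le_rfl
    have h2 := hj (k + 1) (Nat.le_succ k)
    simp only [Op.run, Mem.setNat, Addr.eval, Function.update_of_ne h1, Function.update_of_ne h2]

def NExp.cost : NExp → ℕ
  | .cst _ => 1
  | .cell _ e => e.cost + 8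
  | .add e f => e.cost + f.cost + 1
  | .edge e f => e.cost + f.cost + 1

theorem computesN_compile (e : NExp) : ∀ (k : ℕ) (m : Mem) (s : St), Rep m s →
    ComputesN G (e.compile k) k e.cost m (e.eval G s) := by
  induction e with
  | cst c =>
    intro k m s _
    refine ⟨_, _, .op _ _, le_rfl, ?_, rfl, ?_⟩
    · simp [Op.run, Mem.setNat, Addr.eval, NExp.eval]
    · intro j hj
      simp [Op.run, Mem.setNat, Addr.eval, Function.update_of_ne (hj k le_rfl)]
  | cell a e ih =>
    intro k m s hm
    obtain ⟨t1, m1, e1, c1, v1, r1, f1⟩ := ih k m s hm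
    obtain ⟨t2, m2, e2, c2, v2, r2, f2⟩ := computesN_toAddress G a.idx k m1
    have h2 : Rep m2 s := (hm.of_eq r1 f1).of_eq r2 f2
    refine ⟨_, _, .seq e1 (.seq e2 (.op _ _)), ?_, ?_, ?_, ?_⟩
    · simp only [NExp.cost]; omega
    · simp only [Op.run, Mem.setNat, Addr.eval, Function.update_self, NExp.eval]
      rw [v2, v1, h2.nat]
    · exact r2.trans r1
    · intro j hj
      simp only [Op.run, Mem.setNat, Addr.eval, Function.update_of_ne (hj k le_rfl)]
      rw [f2 j hj, f1 j hj]
  | add e f ihe ihf =>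
    intro k m s hm
    obtain ⟨t1, m1, e1, c1, v1, r1, f1⟩ := ihe k m s hm
    obtain ⟨t2, m2, e2, c2, v2, r2, f2⟩ := ihf (k + 1) m1 s (hm.of_eq r1 f1)
    refine ⟨_, _, .seq e1 (.seq e2 (.op _ _)), ?_, ?_, ?_, ?_⟩
    · simp only [NExp.cost]; omega
    · simp only [Op.run, Mem.setNat, Addr.eval, Function.update_self, NExp.eval]
      rw [v2, f2 (scratch k) (fun l hl h => by have := scratch_injective h; omega), v1]
    · exact r2.trans r1
    · intro j hj
      simp only [Op.run, Mem.setNat, Addr.eval, Function.update_of_ne (hj k le_rfl)]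
      rw [f2 j (fun l hl => hj l (by omega)), f1 j hj]
  | edge e f ihe ihf =>
    intro k m s hm
    obtain ⟨t1, m1, e1, c1, v1, r1, f1⟩ := ihe k m s hm
    obtain ⟨t2, m2, e2, c2, v2, r2, f2⟩ := ihf (k + 1) m1 s (hm.of_eq r1 f1)
    refine ⟨_, _, .seq e1 (.seq e2 (.op _ _)), ?_, ?_, ?_, ?_⟩
    · simp only [NExp.cost]; omega
    · simp only [Op.run, Mem.setNat, Addr.eval, Function.update_self, NExp.eval]
      rw [v2, f2 (scratch k) (fun l hl h => by have := scratch_injective h; omega), v1]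
    · exact r2.trans r1
    · intro j hj
      simp only [Op.run, Mem.setNat, Addr.eval, Function.update_of_ne (hj k le_rfl)]
      rw [f2 j (fun l hl => hj l (by omega)), f1 j hj]

def RExp.cost : RExp → ℕ
  | .cst _ => 1
  | .cell _ e => e.cost + 8
  | .mul e f => e.cost + f.cost + 1
  | .cast e => e.cost + 1

/-- `P` ends within `c` steps in a memory that represents the same state, has the value `x` in the
`k`-th scratch cell for reals at the end and does not modify the earlier ones. -/
def ComputesR (P : Prog) (k c : ℕ) (m : Mem) (s : St) (x : ℝ) : Prop :=
  ∃ t m', Exec G P m t m' ∧ t ≤ c ∧ m'.real (scratch k) = x ∧ Rep m' s ∧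
    ∀ l < k, m'.real (scratch l) = m.real (scratch l)

theorem computesR_compile (e : RExp) : ∀ (k : ℕ) (m : Mem) (s : St), Rep m s →
    ComputesR G (e.compile k) k e.cost m s (e.eval G s) := by
  have hne : ∀ {l k : ℕ}, l < k → scratch l ≠ scratch k := fun h h' => by
    have := scratch_injective h'; omega
  induction e with
  | cst c =>
    intro k m s hm
    refine ⟨_, _, .op _ _, le_rfl, ?_, hm.setReal_scratch k c, ?_⟩
    · simp [Op.run, Mem.setReal, Addr.eval, RExp.eval]
    · intro l hl
      simp [Op.run, Mem.setReal, Addr.eval, Function.update_of_ne (hne hl)]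
  | cell a e =>
    intro k m s hm
    obtain ⟨t1, m1, e1, c1, v1, r1, f1⟩ := computesN_compile G e 0 m s hm
    obtain ⟨t2, m2, e2, c2, v2, r2, f2⟩ := computesN_toAddress G a.idx 0 m1
    have h2 : Rep m2 s := (hm.of_eq r1 f1).of_eq r2 f2
    refine ⟨_, _, .seq e1 (.seq e2 (.op _ _)), ?_, ?_, h2.setReal_scratch k _, ?_⟩
    · simp only [RExp.cost]; omega
    · simp only [Op.run, Mem.setReal, Addr.eval, Function.update_self, RExp.eval]
      rw [v2, v1, h2.real]
    · intro l hl
      simp only [Op.run, Mem.setReal, Addr.eval, Function.update_of_ne (hne hl)]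
      rw [r2, r1]
  | mul e f ihe ihf =>
    intro k m s hm
    obtain ⟨t1, m1, e1, c1, v1, r1, f1⟩ := ihe k m s hm
    obtain ⟨t2, m2, e2, c2, v2, r2, f2⟩ := ihf (k + 1) m1 s r1
    refine ⟨_, _, .seq e1 (.seq e2 (.op _ _)), ?_, ?_, r2.setReal_scratch k _, ?_⟩
    · simp only [RExp.cost]; omega
    · simp only [Op.run, Mem.setReal, Addr.eval, Function.update_self, RExp.eval]
      rw [v2, f2 k (Nat.lt_succ_self k), v1]
    · intro l hl
      simp only [Op.run, Mem.setReal, Addr.eval, Function.update_of_ne (hne hl)]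
      rw [f2 l (by omega), f1 l hl]
  | cast e =>
    intro k m s hm
    obtain ⟨t1, m1, e1, c1, v1, r1, f1⟩ := computesN_compile G e 0 m s hm
    refine ⟨_, _, .seq e1 (.op _ _), ?_, ?_, (hm.of_eq r1 f1).setReal_scratch k _, ?_⟩
    · simp only [RExp.cost]; omega
    · simp only [Op.run, Mem.setReal, Addr.eval, Function.update_self, RExp.eval]
      rw [v1]
    · intro l hl
      simp only [Op.run, Mem.setReal, Addr.eval, Function.update_of_ne (hne hl)]
      rw [r1]

def Cond.cost : Cond → ℕ
  | .nle e f => e.cost + f.cost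
  | .rle e f => e.cost + f.cost

theorem cond_compile (b : Cond) (m : Mem) (s : St) (hm : Rep m s) :
    ∃ t m', Exec G b.compile m t m' ∧ t ≤ b.cost ∧ Rep m' s ∧ (b.test.Holds m' ↔ b.Holds G s) := by
  cases b with
  | nle e f =>
    obtain ⟨t1, m1, e1, c1, v1, r1, f1⟩ := computesN_compile G e 0 m s hm
    have h1 := hm.of_eq r1 f1
    obtain ⟨t2, m2, e2, c2, v2, r2, f2⟩ := computesN_compile G f 1 m1 s h1
    refine ⟨_, _, .seq e1 e2, by simp only [Cond.cost]; omega, h1.of_eq r2 f2, ?_⟩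
    simp only [Cond.test, Test.Holds, Addr.eval, Cond.Holds]
    rw [v2, f2 (scratch 0) (fun l hl h => by have := scratch_injective h; omega), v1]
  | rle e f =>
    obtain ⟨t1, m1, e1, c1, v1, r1, f1⟩ := computesR_compile G e 0 m s hm
    obtain ⟨t2, m2, e2, c2, v2, r2, f2⟩ := computesR_compile G f 1 m1 s r1
    refine ⟨_, _, .seq e1 e2, by simp only [Cond.cost]; omega, r2, ?_⟩
    simp only [Cond.test, Test.Holds, Addr.eval, Cond.Holds]
    rw [v2, f2 0 Nat.zero_lt_one, v1]

/-- A bound for the number of machine steps per step of the command. -/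
def Cmd.cost : Cmd → ℕ
  | .skip => 1
  | .setN _ i e => i.cost + e.cost + 8
  | .setR _ i e => i.cost + e.cost + 8
  | .seq C D => C.cost + D.cost
  | .ite b C D => b.cost + 1 + C.cost + D.cost
  | .while b C => b.cost + 1 + C.cost

/-- A simulation with constant slowdown, by induction on the execution; `Cmd.cost` depends on the
program text only. -/
theorem cmd_compile {C : Cmd} {s s' : St} {t : ℕ} (h : HExec G C s t s') :
    ∀ m, Rep m s → ∃ t' m', Exec G C.compile m t' m' ∧ t' ≤ C.cost * t ∧ Rep m' s' := by
  induction h with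
  | skip s => exact fun m hm => ⟨_, _, .skip m, le_rfl, hm⟩
  | setN a i e s =>
    intro m hm
    obtain ⟨t1, m1, e1, c1, v1, r1, f1⟩ := computesN_compile G i 0 m s hm
    obtain ⟨t2, m2, e2, c2, v2, r2, f2⟩ := computesN_toAddress G a.idx 0 m1
    have h2 : Rep m2 s := (hm.of_eq r1 f1).of_eq r2 f2
    obtain ⟨t3, m3, e3, c3, v3, r3, f3⟩ := computesN_compile G e 1 m2 s h2
    have h3 := h2.of_eq r3 f3
    refine ⟨_, _, .seq e1 (.seq e2 (.seq e3 (.op _ _))), ?_, ?_⟩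
    · simp only [Cmd.cost]; omega
    · simp only [Op.run, Addr.eval]
      rw [v3, f3 (scratch 0) (fun l hl h => by have := scratch_injective h; omega), v2, v1]
      exact h3.setN a _ _
  | setR a i e s =>
    intro m hm
    obtain ⟨t1, m1, e1, c1, v1, h1, -⟩ := computesR_compile G e 0 m s hm
    obtain ⟨t2, m2, e2, c2, v2, r2, f2⟩ := computesN_compile G i 0 m1 s h1
    obtain ⟨t3, m3, e3, c3, v3, r3, f3⟩ := computesN_toAddress G a.idx 0 m2
    have h3 : Rep m3 s := (h1.of_eq r2 f2).of_eq r3 f3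
    refine ⟨_, _, .seq e1 (.seq e2 (.seq e3 (.op _ _))), ?_, ?_⟩
    · simp only [Cmd.cost]; omega
    · simp only [Op.run, Addr.eval]
      rw [v3, v2, r3, r2, v1]
      exact h3.setR a _ _
  | @seq C D s s' s'' t t' _ _ ih1 ih2 =>
    intro m hm
    obtain ⟨t1, m1, e1, c1, h1⟩ := ih1 m hm
    obtain ⟨t2, m2, e2, c2, h2⟩ := ih2 m1 h1
    refine ⟨_, _, .seq e1 e2, ?_, h2⟩
    calc t1 + t2 ≤ C.cost * t + D.cost * t' := add_le_add c1 c2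
      _ ≤ (C.cost + D.cost) * (t + t') := by nlinarith [Nat.zero_le (C.cost * t'), Nat.zero_le (D.cost * t)]
  | @ite_true b C D s s' t hb _ ih =>
    intro m hm
    obtain ⟨t0, m0, e0, c0, h0, hb'⟩ := cond_compile G b m s hm
    obtain ⟨t1, m1, e1, c1, h1⟩ := ih m0 h0
    refine ⟨_, _, .seq e0 (.ite_true (hb'.2 hb) e1), ?_, h1⟩
    simp only [Cmd.cost]
    nlinarith [Nat.zero_le (D.cost * t), Nat.zero_le (b.cost * t)]
  | @ite_false b C D s s' t hb _ ih =>
    intro m hm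
    obtain ⟨t0, m0, e0, c0, h0, hb'⟩ := cond_compile G b m s hm
    obtain ⟨t1, m1, e1, c1, h1⟩ := ih m0 h0
    refine ⟨_, _, .seq e0 (.ite_false (fun h => hb (hb'.1 h)) e1), ?_, h1⟩
    simp only [Cmd.cost]
    nlinarith [Nat.zero_le (C.cost * t), Nat.zero_le (b.cost * t)]
  | @while_true b C s s' s'' t t' hb _ _ ih1 ih2 =>
    intro m hm
    obtain ⟨t0, m0, e0, c0, h0, hb'⟩ := cond_compile G b m s hm
    obtain ⟨t1, m1, e1, c1, h1⟩ := ih1 m0 h0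
    obtain ⟨t2, m2, e2, c2, h2⟩ := ih2 m1 h1
    -- The remaining execution begins with an evaluation of the condition, which becomes the end of
    -- the round just finished.
    cases e2 with
    | @seq _ _ _ m3 _ t3 t4 e3 e4 =>
      refine ⟨_, _, .seq e0 (.while_true (hb'.2 hb) (.seq e1 e3) e4), ?_, h2⟩
      simp only [Cmd.cost] at c2 ⊢
      nlinarith [Nat.zero_le (b.cost * t), Nat.zero_le (C.cost * t')]
  | @while_false b C s hb =>
    intro m hm
    obtain ⟨t0, m0, e0, c0, h0, hb'⟩ := cond_compile G b m s hm
    refine ⟨_, _, .seq e0 (.while_false fun h => hb (hb'.1 h)), ?_, h0⟩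
    simp only [Cmd.cost]; omega

end Correctness

/-! ### Verification rules -/

/-- A time bound for commands all whose loops do at most `B` rounds. -/
def Cmd.time (B : ℕ) : Cmd → ℕ
  | .skip => 0
  | .setN _ _ _ => 1
  | .setR _ _ _ => 1
  | .seq C D => C.time B + D.time B
  | .ite _ C D => C.time B + D.time B + 1
  | .while _ C => B * (C.time B + 1) + 1

def Cmd.size : Cmd → ℕ
  | .skip => 1
  | .setN _ _ _ => 1
  | .setR _ _ _ => 1
  | .seq C D => C.size + D.size
  | .ite _ C D => C.size + D.size + 1
  | .while _ C => C.size + 2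

/-- The nesting depth of the loops. -/
def Cmd.depth : Cmd → ℕ
  | .skip => 0
  | .setN _ _ _ => 0
  | .setR _ _ _ => 0
  | .seq C D => max C.depth D.depth
  | .ite _ C D => max C.depth D.depth
  | .while _ C => C.depth + 1

theorem Cmd.time_le {B : ℕ} (hB : 1 ≤ B) (C : Cmd) : C.time B ≤ C.size * B ^ C.depth := by
  induction C with
  | skip => simp [time]
  | setN => simp [time, size, depth]
  | setR => simp [time, size, depth]
  | seq C D ihC ihD =>
    simp only [time, size, depth]
    have h1 : B ^ C.depth ≤ B ^ max C.depth D.depth := Nat.pow_le_pow_right hB (le_max_left _ _)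
    have h2 : B ^ D.depth ≤ B ^ max C.depth D.depth := Nat.pow_le_pow_right hB (le_max_right _ _)
    rw [add_mul]
    exact add_le_add (ihC.trans (Nat.mul_le_mul_left _ h1)) (ihD.trans (Nat.mul_le_mul_left _ h2))
  | ite b C D ihC ihD =>
    simp only [time, size, depth]
    have h1 : B ^ C.depth ≤ B ^ max C.depth D.depth := Nat.pow_le_pow_right hB (le_max_left _ _)
    have h2 : B ^ D.depth ≤ B ^ max C.depth D.depth := Nat.pow_le_pow_right hB (le_max_right _ _)
    rw [add_mul, add_mul, one_mul]
    exact add_le_add (add_le_add (ihC.trans (Nat.mul_le_mul_left _ h1))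
      (ihD.trans (Nat.mul_le_mul_left _ h2))) (Nat.one_le_pow _ _ hB)
  | _ b C ih =>
    simp only [time, size, depth]
    have h1 : 1 ≤ B ^ C.depth := Nat.one_le_pow _ _ hB
    have h2 : B * C.time B ≤ B * (C.size * B ^ C.depth) := Nat.mul_le_mul_left _ ih
    have h3 : 1 ≤ B ^ (C.depth + 1) := Nat.one_le_pow _ _ hB
    have h4 : B * 1 ≤ B * B ^ C.depth := Nat.mul_le_mul_left _ h1
    calc B * (C.time B + 1) + 1 = B * C.time B + B * 1 + 1 := by ring
      _ ≤ B * (C.size * B ^ C.depth) + B * B ^ C.depth + B ^ (C.depth + 1) := by gcongr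
      _ = (C.size + 2) * B ^ (C.depth + 1) := by ring

/-- The arrays of natural numbers that a command may modify. -/
def Cmd.modN (a : NV) : Cmd → Bool
  | .skip => false
  | .setN b _ _ => decide (b = a)
  | .setR _ _ _ => false
  | .seq C D => C.modN a || D.modN a
  | .ite _ C D => C.modN a || D.modN a
  | .while _ C => C.modN a

/-- The arrays of reals that a command may modify. -/
def Cmd.modR (a : RV) : Cmd → Bool
  | .skip => false
  | .setN _ _ _ => false
  | .setR b _ _ => decide (b = a)
  | .seq C D => C.modR a || D.modR a
  | .ite _ C D => C.modR a || D.modR a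
  | .while _ C => C.modR a

@[simp] theorem St.setN_nat_self (s : St) (a : NV) (i k : ℕ) :
    (s.setN a i k).nat a = Function.update (s.nat a) i k := Function.update_self ..

theorem St.setN_nat_of_ne (s : St) {a b : NV} (i k : ℕ) (h : b ≠ a) :
    (s.setN a i k).nat b = s.nat b := Function.update_of_ne h ..

@[simp] theorem St.setN_real (s : St) (a : NV) (i k : ℕ) : (s.setN a i k).real = s.real := rfl

@[simp] theorem St.setR_real_self (s : St) (a : RV) (i : ℕ) (x : ℝ) :
    (s.setR a i x).real a = Function.update (s.real a) i x := Function.update_self ..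

theorem St.setR_real_of_ne (s : St) {a b : RV} (i : ℕ) (x : ℝ) (h : b ≠ a) :
    (s.setR a i x).real b = s.real b := Function.update_of_ne h ..

@[simp] theorem St.setR_nat (s : St) (a : RV) (i : ℕ) (x : ℝ) : (s.setR a i x).nat = s.nat := rfl

/-- The states `s` and `s'` agree in the arrays that `C` does not modify. -/
structure Frame (C : Cmd) (s s' : St) : Prop where
  nat : ∀ a, C.modN a = false → s'.nat a = s.nat a
  real : ∀ a, C.modR a = false → s'.real a = s.real a

theorem Frame.refl (C : Cmd) (s : St) : Frame C s s := ⟨fun _ _ => rfl, fun _ _ => rfl⟩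

theorem Frame.trans {C : Cmd} {s s' s'' : St} (h : Frame C s s') (h' : Frame C s' s'') :
    Frame C s s'' :=
  ⟨fun a ha => (h'.nat a ha).trans (h.nat a ha), fun a ha => (h'.real a ha).trans (h.real a ha)⟩

theorem Frame.mono {C D : Cmd} {s s' : St} (h : Frame C s s')
    (hN : ∀ a, D.modN a = false → C.modN a = false)
    (hR : ∀ a, D.modR a = false → C.modR a = false) : Frame D s s' :=
  ⟨fun a ha => h.nat a (hN a ha), fun a ha => h.real a (hR a ha)⟩

section Rules

variable {n : ℕ} {G : SimpleGraph (Fin n)}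

theorem HExec.frame {C : Cmd} {s s' : St} {t : ℕ} (h : HExec G C s t s') : Frame C s s' := by
  induction h with
  | skip s => exact .refl _ _
  | setN a i e s =>
    refine ⟨fun b hb => s.setN_nat_of_ne _ _ fun h => ?_, fun b _ => rfl⟩
    simp [Cmd.modN, h] at hb
  | setR a i e s =>
    refine ⟨fun b _ => rfl, fun b hb => s.setR_real_of_ne _ _ fun h => ?_⟩
    simp [Cmd.modR, h] at hb
  | seq _ _ ih1 ih2 =>
    refine (ih1.mono ?_ ?_).trans (ih2.mono ?_ ?_) <;> intro a ha <;>
      simp only [Cmd.modN, Cmd.modR, Bool.or_eq_false_iff] at ha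
    exacts [ha.1, ha.1, ha.2, ha.2]
  | ite_true _ _ ih =>
    refine ih.mono ?_ ?_ <;> intro a ha <;>
      simp only [Cmd.modN, Cmd.modR, Bool.or_eq_false_iff] at ha
    exacts [ha.1, ha.1]
  | ite_false _ _ ih =>
    refine ih.mono ?_ ?_ <;> intro a ha <;>
      simp only [Cmd.modN, Cmd.modR, Bool.or_eq_false_iff] at ha
    exacts [ha.2, ha.2]
  | @while_true b C _ _ _ _ _ _ _ _ ih1 ih2 =>
    exact Frame.trans (C := .while b C) (ih1.mono (fun _ h => h) fun _ h => h) ih2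
  | while_false _ => exact .refl _ _

variable (G) in
/-- Started in `s`, the command `C` ends within `C.time B` steps in a state that satisfies `Q`. -/
def Post (B : ℕ) (C : Cmd) (s : St) (Q : St → Prop) : Prop :=
  ∃ t s', HExec G C s t s' ∧ t ≤ C.time B ∧ Q s'

variable {B : ℕ} {C D : Cmd} {s : St} {Q R : St → Prop}

theorem Post.mono (h : Post G B C s Q) (hQ : ∀ s', Q s' → Frame C s s' → R s') :
    Post G B C s R := by
  obtain ⟨t, s', e, ht, hq⟩ := h
  exact ⟨t, s', e, ht, hQ _ hq e.frame⟩

theorem Post.skip (h : Q s) : Post G B .skip s Q := ⟨_, _, .skip s, le_rfl, h⟩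

theorem Post.setN {a : NV} {i e : NExp} (h : Q (s.setN a (i.eval G s) (e.eval G s))) :
    Post G B (.setN a i e) s Q := ⟨_, _, .setN a i e s, le_rfl, h⟩

theorem Post.setR {a : RV} {i : NExp} {e : RExp} (h : Q (s.setR a (i.eval G s) (e.eval G s))) :
    Post G B (.setR a i e) s Q := ⟨_, _, .setR a i e s, le_rfl, h⟩

theorem Post.seq (h : Post G B C s Q) (h' : ∀ s', Q s' → Frame C s s' → Post G B D s' R) :
    Post G B (.seq C D) s R := by
  obtain ⟨t, s', e, ht, hq⟩ := h
  obtain ⟨t', s'', e', ht', hr⟩ := h' s' hq e.frame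
  exact ⟨_, _, .seq e e', add_le_add ht ht', hr⟩

theorem Post.seq_setN {a : NV} {i e : NExp}
    (h : Post G B D (s.setN a (i.eval G s) (e.eval G s)) R) :
    Post G B (.seq (.setN a i e) D) s R :=
  Post.seq (Q := fun s' => s' = s.setN a (i.eval G s) (e.eval G s)) (.setN rfl)
    fun _ hs _ => hs ▸ h

theorem Post.seq_setR {a : RV} {i : NExp} {e : RExp}
    (h : Post G B D (s.setR a (i.eval G s) (e.eval G s)) R) :
    Post G B (.seq (.setR a i e) D) s R :=
  Post.seq (Q := fun s' => s' = s.setR a (i.eval G s) (e.eval G s)) (.setR rfl)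
    fun _ hs _ => hs ▸ h

theorem Post.ite {b : Cond} (h : b.Holds G s → Post G B C s Q) (h' : ¬ b.Holds G s → Post G B D s Q) :
    Post G B (.ite b C D) s Q := by
  by_cases hb : b.Holds G s
  · obtain ⟨t, s', e, ht, hq⟩ := h hb
    exact ⟨_, _, .ite_true hb e, by simp only [Cmd.time]; omega, hq⟩
  · obtain ⟨t, s', e, ht, hq⟩ := h' hb
    exact ⟨_, _, .ite_false hb e, by simp only [Cmd.time]; omega, hq⟩

/-- The invariant is indexed by the number of completed rounds; `i < B` whenever the test succeeds
gives both termination and the time bound. -/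
theorem Post.while {b : Cond} (I : ℕ → St → Prop) (h0 : I 0 s)
    (hI : ∀ i s', I i s' → b.Holds G s' → i < B ∧ Post G B C s' (I (i + 1))) :
    Post G B (.while b C) s fun s' => ∃ i, I i s' ∧ ¬ b.Holds G s' := by
  have key : ∀ m i s', i + m = B → I i s' → ∃ t s'', HExec G (.while b C) s' t s'' ∧
      t ≤ m * (C.time B + 1) + 1 ∧ ∃ j, I j s'' ∧ ¬ b.Holds G s'' := by
    intro m
    induction m with
    | zero =>
      intro i s' hi hs
      have hb : ¬ b.Holds G s' := fun hb => by have := (hI i s' hs hb).1; omega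
      exact ⟨_, _, .while_false hb, by omega, i, hs, hb⟩
    | succ m ih =>
      intro i s' hi hs
      by_cases hb : b.Holds G s'
      · obtain ⟨t, s1, e1, ht, h1⟩ := (hI i s' hs hb).2
        obtain ⟨t', s2, e2, ht', h2⟩ := ih (i + 1) s1 (by omega) h1
        refine ⟨_, _, .while_true hb e1 e2, ?_, h2⟩
        rw [add_mul]
        omega
      · exact ⟨_, _, .while_false hb, by omega, i, hs, hb⟩
  exact key B 0 s (zero_add B) h0

end Rules

/-- The scalar `a`. -/
abbrev NV.val (a : NV) : NExp := .cell a (.cst 0)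

/-- The assignment to a scalar. -/
abbrev NV.put (a : NV) (e : NExp) : Cmd := .setN a (.cst 0) e

/-- `C` for the values `0, …, e - 1` of `x`. -/
def forUpto (x : NV) (e : NExp) (C : Cmd) : Cmd :=
  .seq (x.put (.cst 0)) (.while (.nle (.add x.val (.cst 1)) e)
    (.seq C (x.put (.add x.val (.cst 1)))))

/-- The invariant `I k` refers to the state in which the counter has just received the value `k`.
The bound `e` is evaluated anew in each round, hence `hN`. -/
theorem Post.forUpto {n : ℕ} {G : SimpleGraph (Fin n)} {B : ℕ} {C : Cmd} {s : St} {x : NV}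
    {e : NExp} (N : ℕ) (I : ℕ → St → Prop) (hNB : N ≤ B) (hx : C.modN x = false)
    (h0 : I 0 (s.setN x 0 0))
    (hN : ∀ k s', Frame (forUpto x e C) s s' → I k s' → e.eval G s' = N)
    (hI : ∀ k s', k < N → Frame (BlockCreation.forUpto x e C) s s' → s'.nat x 0 = k → I k s' →
      Post G B C s' fun s'' => I (k + 1) (s''.setN x 0 (k + 1))) :
    Post G B (BlockCreation.forUpto x e C) s fun s' => I N s' := by
  have hxx : ∀ s' s'', (∃ i k, s'' = s'.setN x i k) → Frame (BlockCreation.forUpto x e C) s' s'' := by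
    rintro s' _ ⟨i, k, rfl⟩
    refine ⟨fun a ha => s'.setN_nat_of_ne _ _ fun h => ?_, fun _ _ => rfl⟩
    simp [BlockCreation.forUpto, Cmd.modN, h] at ha
  refine Post.seq_setN (Post.mono (Post.while (fun k s' => k ≤ N ∧ s'.nat x 0 = k ∧
    Frame (BlockCreation.forUpto x e C) s s' ∧ I k s') ?_ ?_) ?_)
  · exact ⟨Nat.zero_le _, by simp [NExp.eval], hxx _ _ ⟨_, _, rfl⟩, h0⟩
  · rintro k s' ⟨-, hk, hF, hs⟩ hb
    have hlt : k < N := by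
      simp only [Cond.Holds, NExp.eval, hk, hN k s' hF hs] at hb
      exact hb
    refine ⟨hlt.trans_le hNB, (hI k s' hlt hF hk hs).seq fun s1 h1 hF1 => Post.setN ?_⟩
    have h2 : s1.nat x 0 = k := by rw [hF1.nat x hx, hk]
    simp only [NExp.eval, h2]
    refine ⟨hlt, by simp, (hF.trans (hF1.mono ?_ ?_)).trans (hxx _ _ ⟨_, _, rfl⟩), h1⟩ <;>
    · intro a ha
      simp only [BlockCreation.forUpto, Cmd.modN, Cmd.modR, Bool.or_eq_false_iff] at ha
      exact ha.2.1
  · rintro s' ⟨k, ⟨hk, hkx, hF, hs⟩, hb⟩ -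
    have : k = N := by
      simp only [Cond.Holds, NExp.eval, hkx, hN k s' hF hs] at hb
      omega
    exact this ▸ hs

/-! ### Subprograms -/

section Subprograms

variable {n : ℕ} {G : SimpleGraph (Fin n)} {B : ℕ} {s : St}

theorem one_le_adjEntry_iff (u v : Fin n) : 1 ≤ adjEntry G u v ↔ G.Adj u v := by
  unfold adjEntry
  split_ifs with h
  · simpa using h
  · simpa using h

theorem deg_eq_sum_adjEntry (u : Fin n) : deg G u = ∑ w ∈ Finset.range n, adjEntry G u w := by
  classical
  rw [deg, Finset.sum_range fun w => adjEntry G u w]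
  have : ∀ w : Fin n, adjEntry G u w = if G.Adj u w then 1 else 0 := by
    intro w
    unfold adjEntry
    congr 1
    simp
  simp only [this, Finset.sum_boole, Nat.cast_id, Set.ncard_eq_toFinset_card']
  congr 1
  ext w
  simp

/-- The assignment of the weights. -/
def weightsCmd (θ : Params) : Cmd :=
  forUpto .u NV.n.val
    (.seq (NV.eq.put (.cst 0))
    (.seq (forUpto .w NV.n.val (NV.eq.put (.add NV.eq.val (.edge NV.u.val NV.w.val))))
    (.ite (.rle (.cast NV.eq.val) (.cst ((1 + θ.α) * θ.d)))
      (.setR .wt NV.u.val (.cst (1 + θ.γ)⁻¹))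
      (.setR .wt NV.u.val (.mul (.cst (θ.d ^ θ.c)) (.cast NV.eq.val))))))

theorem post_weightsCmd (θ : Params) (hn : s.nat .n 0 = n) (hB : n ≤ B) :
    Post G B (weightsCmd θ) s fun s' => ∀ u : Fin n, s'.real .wt u = weight θ G u := by
  refine (Post.forUpto n (fun k s' => ∀ u : Fin n, (u : ℕ) < k → s'.real .wt u = weight θ G u)
    hB rfl (by simp) ?_ ?_).mono fun s' h _ u => h u u.2
  · intro k s' hF _
    simp only [NExp.eval]
    rw [hF.nat .n rfl, hn]
  intro k s' hk hF hu h
  refine Post.seq_setN (Post.seq (Q := fun s'' => s''.nat .eq 0 = deg G ⟨k, hk⟩)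
    ((Post.forUpto n (fun l s'' => s''.nat .eq 0 = ∑ w ∈ Finset.range l, adjEntry G k w)
      hB rfl ?_ ?_ ?_).mono fun s'' h _ => ?_) ?_)
  · simp [St.setN_nat_of_ne, NExp.eval]
  · intro l s'' hF' _
    simp only [NExp.eval]
    rw [hF'.nat .n rfl, St.setN_nat_of_ne _ _ _ (by simp), hF.nat .n rfl, hn]
  · intro l s'' hl hF' hw h'
    refine Post.setN ?_
    have hu' : s''.nat .u 0 = k := by
      rw [hF'.nat .u rfl, St.setN_nat_of_ne _ _ _ (by simp), hu]
    simp [St.setN_nat_of_ne, NExp.eval, Finset.sum_range_succ, h', hu', hw]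
  · rw [h, deg_eq_sum_adjEntry]
  · intro s1 h1 hF1
    have hu' : s1.nat .u 0 = k := by
      rw [hF1.nat .u rfl, St.setN_nat_of_ne _ _ _ (by simp), hu]
    have hr : s1.real = s'.real := by
      ext a i
      rw [hF1.real a rfl]; rfl
    have key : ∀ x : ℝ, x = weight θ G ⟨k, hk⟩ → ∀ u : Fin n, (u : ℕ) < k + 1 →
        ((s1.setR .wt (NV.u.val.eval G s1) x).setN .u 0 (k + 1)).real .wt u = weight θ G u := by
      intro x hx u hu
      simp only [NExp.eval, hu', St.setN_real, St.setR_real_self, hr]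
      rcases Nat.lt_succ_iff_lt_or_eq.1 hu with h2 | h2
      · rw [Function.update_of_ne h2.ne, h u h2]
      · rw [h2, Function.update_self, hx]
        congr 1
        exact Fin.ext h2.symm
    refine Post.ite (fun hb => Post.setR (key _ ?_)) (fun hb => Post.setR (key _ ?_))
    · simp only [Cond.Holds, RExp.eval, NExp.eval, h1] at hb
      simp [RExp.eval, weight, hb]
    · simp only [Cond.Holds, RExp.eval, NExp.eval, h1] at hb
      simp [RExp.eval, weight, hb, NExp.eval, h1]

/-- The array `f` holds the indicator function of the set `X`. -/
def Marks (f : ℕ → ℕ) (X : Set (Fin n)) : Prop :=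
  ∀ v : Fin n, f v ≤ 1 ∧ (1 ≤ f v ↔ v ∈ X)

theorem Marks.forall_eq_iff {f g : ℕ → ℕ} {X Y : Set (Fin n)} (hf : Marks f X) (hg : Marks g Y) :
    (∀ v : Fin n, f v = g v) ↔ Y = X := by
  constructor
  · intro h
    ext v
    rw [← (hf v).2, ← (hg v).2, h v]
  · rintro rfl v
    have h1 := hf v
    have h2 := hg v
    rcases Nat.lt_or_ge (f v) 1 with h | h
    · have : ¬ 1 ≤ g v := fun h' => absurd (h1.2.2 (h2.2.1 h')) (by omega)
      omega
    · have := h2.2.2 (h1.2.1 h)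
      omega

theorem Marks.insert {f : ℕ → ℕ} {X : Set (Fin n)} (hf : Marks f X) (w : Fin n) :
    Marks (Function.update f w 1) (insert w X) := by
  intro v
  by_cases h : v = w
  · subst h; simp
  · rw [Function.update_of_ne (fun h' => h (Fin.ext h'))]
    simpa [h] using hf v

/-- Empties the set in `cur`. -/
def clearCmd : Cmd := forUpto .u NV.n.val (.setN .cur NV.u.val (.cst 0))

theorem post_clearCmd (hn : s.nat .n 0 = n) (hB : n ≤ B) :
    Post G B clearCmd s fun s' => Marks (s'.nat .cur) (∅ : Set (Fin n)) := by
  refine (Post.forUpto n (fun k s' => ∀ v < k, s'.nat .cur v = 0) hB rfl (by simp) ?_ ?_).mono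
    fun s' h _ v => by simp [h v v.2]
  · intro k s' hF _
    simp only [NExp.eval]
    rw [hF.nat .n rfl, hn]
  · intro k s' hk hF hu h
    refine Post.setN fun v hv => ?_
    simp only [NExp.eval, hu, ne_eq, reduceCtorEq, not_false_eq_true, St.setN_nat_of_ne,
      St.setN_nat_self]
    rcases Nat.lt_succ_iff_lt_or_eq.1 hv with h2 | h2
    · rw [Function.update_of_ne h2.ne, h v h2]
    · rw [h2, Function.update_self]

def guardCmd (ρ : StartRule) (C : Cmd) : Cmd :=
  match ρ with
  | .included => .ite (.nle (.cst 1) (.cell .nb NV.u.val)) C .skip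
  | .exempt => C

/-- Adds to the set in `cur` the vertices that can be reached from it. -/
def closeCmd (ρ : StartRule) : Cmd :=
  forUpto .k NV.n.val (forUpto .u NV.n.val (forUpto .w NV.n.val
    (.ite (.nle (.cst 1) (.cell .cur NV.u.val))
      (.ite (.nle (.cst 1) (.edge NV.u.val NV.w.val))
        (.ite (.nle (.cst 1) (.cell .nb NV.w.val))
          (guardCmd ρ (.setN .cur NV.w.val (.cst 1))) .skip) .skip) .skip)))

/-- Marks are set in place, so a round may run ahead of the ball. The invariant only sandwiches the
marked set between `ball k` and the closure, and the two coincide after `n` rounds by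
`ball_eq_closure`. -/
theorem post_closeCmd (θ : Params) (ρ : StartRule) (hn : s.nat .n 0 = n) (hB : n ≤ B)
    (hnb : ∀ v : Fin n, 1 ≤ s.nat .nb v ↔ ¬ IsBreakPoint θ G v) {X : Set (Fin n)}
    (hX : Marks (s.nat .cur) X) :
    Post G B (closeCmd ρ) s fun s' => Marks (s'.nat .cur) (closure θ G ρ X) := by
  have hle : ∀ s' : St, s'.nat .n = s.nat .n → NV.n.val.eval G s' = n := fun s' h => by
    simp only [NExp.eval, h, hn]
  refine (Post.forUpto n (fun k s' => ∃ Y, Marks (s'.nat .cur) Y ∧ ball θ G ρ X k ⊆ Y ∧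
    Y ⊆ closure θ G ρ X) hB (by cases ρ <;> rfl) ?_ ?_ ?_).mono ?_
  · refine ⟨X, by simpa [St.setN_nat_of_ne] using hX, le_rfl, fun x hx => ⟨x, hx, .refl⟩⟩
  · intro k s' hF _
    exact hle _ (hF.nat .n (by cases ρ <;> rfl))
  · rintro k s1 hk hF1 - ⟨Y, hY, hbY, hYc⟩
    refine (Post.forUpto n (fun l s' => ∃ Y, Marks (s'.nat .cur) Y ∧ ball θ G ρ X k ⊆ Y ∧
      Y ⊆ closure θ G ρ X ∧ ∀ u : Fin n, (u : ℕ) < l → u ∈ ball θ G ρ X k → ∀ w, Step θ G ρ u w →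
        w ∈ Y) hB (by cases ρ <;> rfl) ?_ ?_ ?_).mono ?_
    · exact ⟨Y, by simpa [St.setN_nat_of_ne] using hY, hbY, hYc, fun u hu => by omega⟩
    · intro l s' hF _
      exact hle _ ((hF.nat .n (by cases ρ <;> rfl)).trans (hF1.nat .n (by cases ρ <;> rfl)))
    · rintro l s2 hl hF2 hu2 ⟨Y, hY, hbY, hYc, hYs⟩
      refine (Post.forUpto n (fun m s' => ∃ Y, Marks (s'.nat .cur) Y ∧ ball θ G ρ X k ⊆ Y ∧
        Y ⊆ closure θ G ρ X ∧ (∀ u : Fin n, (u : ℕ) < l → u ∈ ball θ G ρ X k →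
          ∀ w, Step θ G ρ u w → w ∈ Y) ∧ (⟨l, hl⟩ ∈ ball θ G ρ X k →
          ∀ w : Fin n, (w : ℕ) < m → Step θ G ρ ⟨l, hl⟩ w → w ∈ Y)) hB
          (by cases ρ <;> rfl) ?_ ?_ ?_).mono ?_
      · exact ⟨Y, by simpa [St.setN_nat_of_ne] using hY, hbY, hYc, hYs, fun _ w hw => by omega⟩
      · intro m s' hF _
        exact hle _ ((hF.nat .n (by cases ρ <;> rfl)).trans ((hF2.nat .n (by cases ρ <;> rfl)).trans
          (hF1.nat .n (by cases ρ <;> rfl))))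
      · rintro m s3 hm hF3 hw3 ⟨Y, hY, hbY, hYc, hYs, hYw⟩
        have hu3 : s3.nat .u 0 = l := by rw [hF3.nat .u (by cases ρ <;> rfl), hu2]
        have hnb3 : ∀ v : Fin n, 1 ≤ s3.nat .nb v ↔ ¬ IsBreakPoint θ G v := by
          intro v
          rw [hF3.nat .nb (by cases ρ <;> rfl), hF2.nat .nb (by cases ρ <;> rfl),
            hF1.nat .nb (by cases ρ <;> rfl), hnb]
        -- The common outcome of all failed tests: nothing is to be added for this pair.
        have hno : ¬ (⟨l, hl⟩ ∈ Y ∧ Step θ G ρ ⟨l, hl⟩ ⟨m, hm⟩) →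
            (fun s'' : St => ∃ Y, Marks ((s''.setN .w 0 (m + 1)).nat .cur) Y ∧
              ball θ G ρ X k ⊆ Y ∧ Y ⊆ closure θ G ρ X ∧ (∀ u : Fin n, (u : ℕ) < l →
              u ∈ ball θ G ρ X k → ∀ w, Step θ G ρ u w → w ∈ Y) ∧ (⟨l, hl⟩ ∈ ball θ G ρ X k →
              ∀ w : Fin n, (w : ℕ) < m + 1 → Step θ G ρ ⟨l, hl⟩ w → w ∈ Y)) s3 := by
          intro h
          refine ⟨Y, by simpa [St.setN_nat_of_ne] using hY, hbY, hYc, hYs, fun hb w hw hs => ?_⟩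
          rcases Nat.lt_succ_iff_lt_or_eq.1 hw with h2 | h2
          · exact hYw hb w h2 hs
          · obtain rfl : w = ⟨m, hm⟩ := Fin.ext h2
            exact absurd ⟨hbY hb, hs⟩ h
        have hc := (hY ⟨l, hl⟩).2
        have hnw := hnb3 ⟨m, hm⟩
        have hnu := hnb3 ⟨l, hl⟩
        have hadj := one_le_adjEntry_iff (G := G) ⟨l, hl⟩ ⟨m, hm⟩
        simp only at hc hnw hnu hadj
        refine Post.ite (fun h1 => ?_) fun h1 => Post.skip (hno ?_)
        swap
        · simp only [Cond.Holds, NExp.eval, hu3, hc] at h1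
          exact fun h => h1 h.1
        refine Post.ite (fun h2 => ?_) fun h2 => Post.skip (hno ?_)
        swap
        · simp only [Cond.Holds, NExp.eval, hu3, hw3, hadj] at h2
          exact fun h => h2 h.2.1
        refine Post.ite (fun h3 => ?_) fun h3 => Post.skip (hno ?_)
        swap
        · simp only [Cond.Holds, NExp.eval, hw3, hnw] at h3
          exact fun h => h3 h.2.2.1
        simp only [Cond.Holds, NExp.eval, hu3, hc] at h1
        simp only [Cond.Holds, NExp.eval, hu3, hw3, hadj] at h2
        simp only [Cond.Holds, NExp.eval, hw3, hnw] at h3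
        have hyes : Step θ G ρ ⟨l, hl⟩ ⟨m, hm⟩ → Post G B (.setN .cur NV.w.val (.cst 1)) s3
            (fun s'' : St => ∃ Y, Marks ((s''.setN .w 0 (m + 1)).nat .cur) Y ∧
              ball θ G ρ X k ⊆ Y ∧ Y ⊆ closure θ G ρ X ∧ (∀ u : Fin n, (u : ℕ) < l →
              u ∈ ball θ G ρ X k → ∀ w, Step θ G ρ u w → w ∈ Y) ∧ (⟨l, hl⟩ ∈ ball θ G ρ X k →
              ∀ w : Fin n, (w : ℕ) < m + 1 → Step θ G ρ ⟨l, hl⟩ w → w ∈ Y)) := by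
          intro hst
          refine Post.setN ⟨insert ⟨m, hm⟩ Y, ?_, hbY.trans (Set.subset_insert _ _),
            Set.insert_subset (closure_step (hYc h1) hst) hYc,
            fun u hu hb w hs => Set.mem_insert_of_mem _ (hYs u hu hb w hs), fun hb w hw hs => ?_⟩
          · simpa [St.setN_nat_of_ne, NExp.eval, hw3] using hY.insert ⟨m, hm⟩
          · rcases Nat.lt_succ_iff_lt_or_eq.1 hw with h4 | h4
            · exact Set.mem_insert_of_mem _ (hYw hb w h4 hs)
            · exact Set.mem_insert_iff.2 (.inl (Fin.ext h4))
        cases ρ with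
        | exempt => exact hyes ⟨h2, h3, fun h => by cases h⟩
        | included =>
          refine Post.ite (fun h4 => ?_) fun h4 => Post.skip (hno ?_)
          · simp only [Cond.Holds, NExp.eval, hu3, hnu] at h4
            exact hyes ⟨h2, h3, fun _ => h4⟩
          · simp only [Cond.Holds, NExp.eval, hu3, hnu] at h4
            exact fun h => h4 (h.2.2.2 rfl)
      · rintro s4 ⟨Y, hY, hbY, hYc, hYs, hYw⟩ -
        refine ⟨Y, by simpa [St.setN_nat_of_ne] using hY, hbY, hYc, fun u hu hb w hs => ?_⟩
        rcases Nat.lt_succ_iff_lt_or_eq.1 hu with h4 | h4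
        · exact hYs u h4 hb w hs
        · obtain rfl : u = ⟨l, hl⟩ := Fin.ext h4
          exact hYw hb w w.2 hs
    · rintro s4 ⟨Y, hY, hbY, hYc, hYs⟩ -
      refine ⟨Y, by simpa [St.setN_nat_of_ne] using hY, ?_, hYc⟩
      rintro w (hw | ⟨u, hu, hs⟩)
      · exact hbY hw
      · exact hYs u u.2 hu w hs
  · rintro s' ⟨Y, hY, hbY, hYc⟩ -
    rw [ball_eq_closure] at hbY
    rwa [hbY.antisymm hYc]

end Subprograms

/-! ### Lists of distinct sets -/

section Listing

variable {n : ℕ} {G : SimpleGraph (Fin n)} {B : ℕ} {s : St}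

/-- The first `N` rows hold the sets `Xs 0, …, Xs (N - 1)`, which are distinct. -/
structure Listing (rows : ℕ → ℕ) (N : ℕ) (Xs : ℕ → Set (Fin n)) : Prop where
  marks : ∀ r < N, Marks (fun v => rows (r * n + v)) (Xs r)
  injOn : Set.InjOn Xs (Set.Iio N)

/-- Compares the set in `cur` with the row that starts at `off`. -/
def compareCmd : Cmd :=
  .seq (NV.eq.put (.cst 1)) (forUpto .v NV.n.val
    (.ite (.nle (.cell .cur NV.v.val) (.cell .rows (.add NV.off.val NV.v.val)))
      (.ite (.nle (.cell .rows (.add NV.off.val NV.v.val)) (.cell .cur NV.v.val)) .skip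
        (NV.eq.put (.cst 0)))
      (NV.eq.put (.cst 0))))

theorem post_compareCmd (hn : s.nat .n 0 = n) (hB : n ≤ B) {X Y : Set (Fin n)}
    (hX : Marks (s.nat .cur) X) (hY : Marks (fun v => s.nat .rows (s.nat .off 0 + v)) Y) :
    Post G B compareCmd s fun s' => (1 ≤ s'.nat .eq 0 ↔ Y = X) := by
  refine Post.seq_setN ((Post.forUpto n (fun k s' => 1 ≤ s'.nat .eq 0 ↔
    ∀ v < k, s.nat .cur v = s.nat .rows (s.nat .off 0 + v)) hB rfl ?_ ?_ ?_).mono ?_)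
  · simp [St.setN_nat_of_ne, NExp.eval]
  · intro k s' hF _
    simp only [NExp.eval]
    rw [hF.nat .n rfl, St.setN_nat_of_ne _ _ _ (by simp), hn]
  · intro k s' hk hF hv h
    have h1 : s'.nat .cur = s.nat .cur := by
      rw [hF.nat .cur rfl, St.setN_nat_of_ne _ _ _ (by simp)]
    have h2 : s'.nat .rows = s.nat .rows := by
      rw [hF.nat .rows rfl, St.setN_nat_of_ne _ _ _ (by simp)]
    have h3 : s'.nat .off = s.nat .off := by
      rw [hF.nat .off rfl, St.setN_nat_of_ne _ _ _ (by simp)]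
    refine Post.ite (fun hb => Post.ite (fun hb' => Post.skip ?_) fun hb' => Post.setN ?_)
      fun hb => Post.setN ?_
    · simp only [Cond.Holds, NExp.eval, hv, h1, h2, h3] at hb hb'
      simp only [ne_eq, reduceCtorEq, not_false_eq_true, St.setN_nat_of_ne, h]
      constructor
      · intro h4 v hv
        rcases Nat.lt_succ_iff_lt_or_eq.1 hv with h5 | rfl
        · exact h4 v h5
        · omega
      · exact fun h4 v hv => h4 v (by omega)
    · simp only [Cond.Holds, NExp.eval, hv, h1, h2, h3] at hb hb'
      simp only [ne_eq, reduceCtorEq, not_false_eq_true, St.setN_nat_of_ne, St.setN_nat_self,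
        NExp.eval, Function.update_self]
      refine ⟨fun h => by omega, fun h => ?_⟩
      have := h k (Nat.lt_succ_self k)
      omega
    · simp only [Cond.Holds, NExp.eval, hv, h1, h2, h3] at hb
      simp only [ne_eq, reduceCtorEq, not_false_eq_true, St.setN_nat_of_ne, St.setN_nat_self,
        NExp.eval, Function.update_self]
      refine ⟨fun h => by omega, fun h => ?_⟩
      have := h k (Nat.lt_succ_self k)
      omega
  · rintro s' h -
    rw [h, ← hX.forall_eq_iff hY]
    exact ⟨fun h v => h v v.2, fun h v hv => h ⟨v, hv⟩⟩

/-- Appends the set in `cur` to the list unless it is there. -/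
def addRowCmd : Cmd :=
  .seq (NV.fl.put (.cst 0)) (.seq (NV.off.put (.cst 0))
  (.seq (forUpto .r NV.cnt.val (.seq compareCmd (.seq
      (.ite (.nle (.cst 1) NV.eq.val) (NV.fl.put (.cst 1)) .skip)
      (NV.off.put (.add NV.off.val NV.n.val)))))
    (.ite (.nle NV.fl.val (.cst 0))
      (.seq (forUpto .v NV.n.val (.setN .rows (.add NV.off.val NV.v.val) (.cell .cur NV.v.val)))
        (NV.cnt.put (.add NV.cnt.val (.cst 1)))) .skip)))

/-- A set is written only after comparison with all rows, which keeps the list free of repetitions.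
Old rows keep their numbers, so that the cycle blocks remain an initial segment of the list. -/
theorem post_addRowCmd (hn : s.nat .n 0 = n) (hB : n ≤ B) {X : Set (Fin n)}
    (hX : Marks (s.nat .cur) X) {Xs : ℕ → Set (Fin n)} {N : ℕ} (hN : s.nat .cnt 0 = N) (hNB : N ≤ B)
    (hL : Listing (s.nat .rows) N Xs) :
    Post G B addRowCmd s fun s' => ∃ Xs' N', s'.nat .cnt 0 = N' ∧ N ≤ N' ∧ N' ≤ N + 1 ∧
      Listing (s'.nat .rows) N' Xs' ∧ (∀ r < N, Xs' r = Xs r) ∧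
      Xs' '' Set.Iio N' = insert X (Xs '' Set.Iio N) := by
  refine Post.seq_setN (Post.seq_setN (Post.seq (Q := fun s' => s'.nat .off 0 = N * n ∧
    (1 ≤ s'.nat .fl 0 ↔ ∃ r < N, Xs r = X)) (Post.forUpto N (fun k s' => s'.nat .off 0 = k * n ∧
    (1 ≤ s'.nat .fl 0 ↔ ∃ r < k, Xs r = X)) hNB rfl ?_ ?_ ?_) ?_))
  · simp [St.setN_nat_of_ne, NExp.eval]
  · intro k s' hF _
    simp only [NExp.eval]
    rw [hF.nat .cnt rfl]
    simp [St.setN_nat_of_ne, hN]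
  · rintro k s' hk hF hr ⟨hoff, hfl⟩
    have h1 : s'.nat .cur = s.nat .cur := by
      rw [hF.nat .cur rfl]; simp [St.setN_nat_of_ne]
    have h2 : s'.nat .rows = s.nat .rows := by
      rw [hF.nat .rows rfl]; simp [St.setN_nat_of_ne]
    have h3 : s'.nat .n 0 = n := by
      rw [hF.nat .n rfl]; simp [St.setN_nat_of_ne, hn]
    refine (post_compareCmd h3 hB (X := X) (Y := Xs k) (by rwa [h1])
      (by rw [h2, hoff]; exact hL.marks k hk)).seq fun s1 heq hF1 => ?_
    have h4 : s1.nat .off 0 = k * n := by rw [hF1.nat .off rfl, hoff]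
    have h5 : s1.nat .fl 0 = s'.nat .fl 0 := by rw [hF1.nat .fl rfl]
    have h6 : s1.nat .n 0 = n := by rw [hF1.nat .n rfl, h3]
    refine Post.seq (Q := fun s2 => 1 ≤ s2.nat .fl 0 ↔ ∃ r < k + 1, Xs r = X)
      (Post.ite (fun hb => Post.setN ?_) fun hb => Post.skip ?_) fun s2 hfl2 hF2 => Post.setN ?_
    · simp only [Cond.Holds, NExp.eval, heq] at hb
      simp only [NExp.eval, St.setN_nat_self, Function.update_self, le_refl, true_iff]
      exact ⟨k, Nat.lt_succ_self k, hb⟩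
    · simp only [Cond.Holds, NExp.eval, heq] at hb
      rw [h5, hfl]
      constructor
      · rintro ⟨r, hr, h⟩; exact ⟨r, by omega, h⟩
      · rintro ⟨r, hr, h⟩
        rcases Nat.lt_succ_iff_lt_or_eq.1 hr with h7 | rfl
        · exact ⟨r, h7, h⟩
        · exact absurd h hb
    · have h7 : s2.nat .off 0 = k * n := by rw [hF2.nat .off rfl, h4]
      have h8 : s2.nat .n 0 = n := by rw [hF2.nat .n rfl, h6]
      simp [St.setN_nat_of_ne, NExp.eval, h7, h8, hfl2, add_mul]
  · rintro s' ⟨hoff, hfl⟩ hF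
    have h1 : s'.nat .cur = s.nat .cur := by
      rw [hF.nat .cur rfl]; simp [St.setN_nat_of_ne]
    have h2 : s'.nat .rows = s.nat .rows := by
      rw [hF.nat .rows rfl]; simp [St.setN_nat_of_ne]
    have h3 : s'.nat .n 0 = n := by
      rw [hF.nat .n rfl]; simp [St.setN_nat_of_ne, hn]
    have h4 : s'.nat .cnt 0 = N := by
      rw [hF.nat .cnt rfl]; simp [St.setN_nat_of_ne, hN]
    refine Post.ite (fun hb => ?_) fun hb => Post.skip ?_
    · have hnew : ¬ ∃ r < N, Xs r = X := by
        rw [← hfl]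
        simp only [Cond.Holds, NExp.eval] at hb
        omega
      refine Post.seq (Q := fun s1 => (∀ x < N * n, s1.nat .rows x = s.nat .rows x) ∧
        ∀ v < n, s1.nat .rows (N * n + v) = s.nat .cur v) ((Post.forUpto n (fun k s1 =>
        (∀ x < N * n, s1.nat .rows x = s.nat .rows x) ∧
        ∀ v < k, s1.nat .rows (N * n + v) = s.nat .cur v) hB rfl ?_ ?_ ?_)) ?_
      · simp [St.setN_nat_of_ne, h2]
      · intro k s1 hF1 _
        simp only [NExp.eval]
        rw [hF1.nat .n rfl, h3]
      · rintro k s1 hk hF1 hv ⟨hr1, hr2⟩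
        have h5 : s1.nat .off 0 = N * n := by rw [hF1.nat .off rfl, hoff]
        have h6 : s1.nat .cur = s.nat .cur := by rw [hF1.nat .cur rfl, h1]
        refine Post.setN ?_
        simp only [ne_eq, reduceCtorEq, not_false_eq_true, St.setN_nat_of_ne, St.setN_nat_self,
          NExp.eval, h5, h6, hv]
        constructor
        · intro x hx
          rw [Function.update_of_ne (by omega), hr1 x hx]
        · intro v hv
          rcases Nat.lt_succ_iff_lt_or_eq.1 hv with h7 | rfl
          · rw [Function.update_of_ne (by omega), hr2 v h7]
          · rw [Function.update_self]
      · rintro s1 ⟨hr1, hr2⟩ hF1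
        have h7 : s1.nat .cnt 0 = N := by rw [hF1.nat .cnt rfl, h4]
        refine Post.setN ⟨Function.update Xs N X, N + 1, ?_, Nat.le_succ N, le_rfl, ⟨?_, ?_⟩,
          fun r hr => Function.update_of_ne hr.ne _ _, ?_⟩
        · simp [NExp.eval, h7]
        · intro r hr v
          simp only [ne_eq, reduceCtorEq, not_false_eq_true, St.setN_nat_of_ne]
          rcases Nat.lt_succ_iff_lt_or_eq.1 hr with h8 | rfl
          · have : r * n + v < N * n := by
              calc r * n + v < r * n + n := by omega
                _ = (r + 1) * n := by ring
                _ ≤ N * n := Nat.mul_le_mul_right _ h8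
            rw [hr1 _ this, Function.update_of_ne h8.ne]
            exact hL.marks r h8 v
          · rw [hr2 v v.2, Function.update_self]
            exact hX v
        · intro r hr r' hr' h
          have hr0 : r < N + 1 := hr
          have hr0' : r' < N + 1 := hr'
          rcases Nat.lt_succ_iff_lt_or_eq.1 hr0 with h8 | rfl <;>
            rcases Nat.lt_succ_iff_lt_or_eq.1 hr0' with h9 | h9
          · rw [Function.update_of_ne h8.ne, Function.update_of_ne h9.ne] at h
            exact hL.injOn h8 h9 h
          · rw [h9, Function.update_of_ne h8.ne, Function.update_self] at h
            exact absurd ⟨r, h8, h⟩ hnew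
          · rw [Function.update_of_ne h9.ne, Function.update_self] at h
            exact absurd ⟨r', h9, h.symm⟩ hnew
          · exact h9.symm
        · have : Set.Iio (N + 1) = insert N (Set.Iio N) := by
            ext x; simp
          rw [this, Set.image_insert_eq, Function.update_self]
          congr 1
          refine Set.image_congr fun r hr => Function.update_of_ne (ne_of_lt hr) _ _
    · have hold : ∃ r < N, Xs r = X := by
        rw [← hfl]
        simp only [Cond.Holds, NExp.eval] at hb
        omega
      obtain ⟨r, hr, hrX⟩ := hold
      refine ⟨Xs, N, h4, le_rfl, Nat.le_succ N, by rwa [h2], fun _ _ => rfl, ?_⟩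
      rw [Set.insert_eq_of_mem]
      exact ⟨r, hr, hrX⟩

end Listing

/-! ### Paths -/

section Paths

variable {n : ℕ} {G : SimpleGraph (Fin n)} {B : ℕ} {s : St}

/-- The first `tail` entries describe the paths `q 0, q 1, …`, whose last vertices come first. -/
structure PathTree (q : ℕ → List (Fin n)) (tail : ℕ) (last par : ℕ → ℕ) : Prop where
  le_tail : n ≤ tail
  base : ∀ v : Fin n, q v = [v]
  par_lt : ∀ i < tail, n ≤ i → par i < i
  cons : ∀ i < tail, n ≤ i → ∃ v, q i = v :: q (par i)
  last_eq : ∀ i < tail, ∃ v l, q i = v :: l ∧ last i = v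
  nodup : ∀ i < tail, (q i).Nodup

/-- Sets `cur` to the set of the vertices of the path number `i`. -/
def markCmd : Cmd :=
  .seq clearCmd (.seq (NV.j.put NV.i.val) (forUpto .k NV.n.val
    (.seq (.setN .cur (.cell .last NV.j.val) (.cst 1))
      (.ite (.nle NV.n.val NV.j.val) (NV.j.put (.cell .par NV.j.val)) .skip))))

/-- Following the pointers `par` for `n` rounds is enough, because a list of distinct vertices has
length at most `n`. The disjunction in the invariant covers the idle rounds at a path of length
zero. -/
theorem post_markCmd (hn : s.nat .n 0 = n) (hB : n ≤ B) {q : ℕ → List (Fin n)} {tail : ℕ}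
    (hq : PathTree q tail (s.nat .last) (s.nat .par)) (hi : s.nat .i 0 < tail) :
    Post G B markCmd s fun s' => Marks (s'.nat .cur) {v | v ∈ q (s.nat .i 0)} := by
  set i := s.nat .i 0 with hi0
  refine (post_clearCmd hn hB).seq fun s1 h1 hF1 => Post.seq_setN ((Post.forUpto n (fun k s' =>
    ∃ X : Set (Fin n), Marks (s'.nat .cur) X ∧ s'.nat .j 0 < tail ∧
      (∀ v, v ∈ q i ↔ v ∈ X ∨ v ∈ q (s'.nat .j 0)) ∧
      ((q (s'.nat .j 0)).length + k ≤ n ∨ s'.nat .j 0 < n ∧ ∀ v ∈ q (s'.nat .j 0), v ∈ X))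
    hB rfl ?_ ?_ ?_).mono ?_)
  · refine ⟨∅, by simpa [St.setN_nat_of_ne] using h1, ?_, ?_, ?_⟩
    · simp [St.setN_nat_of_ne, NExp.eval, hF1.nat .i rfl, ← hi0, hi]
    · simp [St.setN_nat_of_ne, NExp.eval, hF1.nat .i rfl, ← hi0]
    · left
      simpa [St.setN_nat_of_ne, NExp.eval, hF1.nat .i rfl, ← hi0] using
        (hq.nodup i hi).length_le_card
  · intro k s' hF _
    simp only [NExp.eval]
    rw [hF.nat .n rfl, St.setN_nat_of_ne _ _ _ (by simp), hF1.nat .n rfl, hn]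
  · rintro k s' hk hF hk' ⟨X, hX, hj, hmem, hlen⟩
    have hlast : s'.nat .last = s.nat .last := by
      rw [hF.nat .last rfl, St.setN_nat_of_ne _ _ _ (by simp), hF1.nat .last rfl]
    have hpar : s'.nat .par = s.nat .par := by
      rw [hF.nat .par rfl, St.setN_nat_of_ne _ _ _ (by simp), hF1.nat .par rfl]
    have hn' : s'.nat .n 0 = n := by
      rw [hF.nat .n rfl, St.setN_nat_of_ne _ _ _ (by simp), hF1.nat .n rfl, hn]
    obtain ⟨v, l, hvl, hv⟩ := hq.last_eq _ hj
    refine Post.seq_setN ?_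
    simp only [NExp.eval, hlast, hv]
    refine Post.ite (fun hb => Post.setN ?_) fun hb => Post.skip ?_
    · simp only [Cond.Holds, NExp.eval, ne_eq, reduceCtorEq, not_false_eq_true,
        St.setN_nat_of_ne, hn'] at hb
      obtain ⟨v', hc⟩ := hq.cons _ hj hb
      obtain ⟨rfl, rfl⟩ : v = v' ∧ l = q (s.nat .par (s'.nat .j 0)) := by
        rw [hvl] at hc; simpa using hc
      refine ⟨insert v X, ?_, ?_, ?_, ?_⟩
      · simpa [St.setN_nat_of_ne] using hX.insert v
      · simpa [St.setN_nat_of_ne, NExp.eval, hpar] using (hq.par_lt _ hj hb).trans hj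
      · intro u
        rw [hmem, hvl]
        simp [St.setN_nat_of_ne, NExp.eval, hpar]
        tauto
      · left
        simp [St.setN_nat_of_ne, NExp.eval, hpar]
        rcases hlen with h | h
        · rw [hvl, List.length_cons] at h
          omega
        · omega
    · simp only [Cond.Holds, NExp.eval, ne_eq, reduceCtorEq, not_false_eq_true,
        St.setN_nat_of_ne, hn', not_le] at hb
      have hl : q (s'.nat .j 0) = [⟨_, hb⟩] := hq.base ⟨_, hb⟩
      obtain rfl : l = [] := by rw [hvl] at hl; simp at hl; exact hl.2
      refine ⟨insert v X, ?_, ?_, ?_, .inr ⟨?_, ?_⟩⟩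
      · simpa [St.setN_nat_of_ne] using hX.insert v
      · simpa [St.setN_nat_of_ne] using hj
      · intro u
        rw [hmem]
        simp [St.setN_nat_of_ne, hvl]
        tauto
      · simpa [St.setN_nat_of_ne] using hb
      · intro u hu
        left
        simpa [St.setN_nat_of_ne, hvl] using hu
  · rintro s' ⟨X, hX, hj, hmem, hlen⟩ -
    obtain ⟨v, l, hvl, hv⟩ := hq.last_eq _ hj
    have h2 : ∀ v ∈ q (s'.nat .j 0), v ∈ X := by
      rcases hlen with h | h
      · rw [hvl, List.length_cons] at h; omega
      · exact h.2
    have : {v | v ∈ q i} = X := by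
      ext u
      rw [Set.mem_ofPred_eq, hmem]
      exact ⟨fun h => h.elim id (h2 u), .inl⟩
    rwa [this]

end Paths

/-! ### The list of all short paths -/

section Queue

variable {n : ℕ} {G : SimpleGraph (Fin n)} {B : ℕ} {s : St}

/-- `l` lists the vertices of a path whose number of edges `k` satisfies `b ^ k ≤ n`. -/
structure IsShortPath (G : SimpleGraph (Fin n)) (b : ℝ) (l : List (Fin n)) : Prop where
  ne_nil : l ≠ []
  isChain : l.IsChain G.Adj
  nodup : l.Nodup
  pow_le : b ^ (l.length - 1) ≤ n

theorem IsShortPath.tail {b : ℝ} (hb : 1 ≤ b) {w : Fin n} {l : List (Fin n)}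
    (h : IsShortPath G b (w :: l)) (hl : l ≠ []) : IsShortPath G b l where
  ne_nil := hl
  isChain := h.isChain.tail
  nodup := h.nodup.of_cons
  pow_le := (pow_le_pow_right₀ hb (by simp)).trans h.pow_le

theorem isShortPath_singleton (b : ℝ) (v : Fin n) : IsShortPath G b [v] where
  ne_nil := by simp
  isChain := by simp
  nodup := by simp
  pow_le := by
    have : 1 ≤ n := by have := v.2; omega
    simpa using this

/-- The queue of the search for all short paths. -/
structure Queue (G : SimpleGraph (Fin n)) (W : Fin n → ℝ) (b₁ b₂ : ℝ) (q : ℕ → List (Fin n))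
    (tail : ℕ) (last par root : ℕ → ℕ) (rw p1 p2 : ℕ → ℝ) : Prop
    extends PathTree q tail last par where
  root_eq : ∀ i < tail, ∃ v, (q i).getLast? = some v ∧ root i = v
  rw_eq : ∀ i < tail, rw i = ((q i).map W).prod
  p1_eq : ∀ i < tail, p1 i = b₁ ^ ((q i).length - 1)
  p2_eq : ∀ i < tail, p2 i = b₂ ^ ((q i).length - 1)
  short : ∀ i < tail, IsShortPath G b₂ (q i)
  injOn : Set.InjOn q (Set.Iio tail)

section Append

variable {W : Fin n → ℝ} {b₁ b₂ : ℝ} {q : ℕ → List (Fin n)} {t : ℕ} {last par root : ℕ → ℕ}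
  {rw p1 p2 : ℕ → ℝ}

/-- The entries are distinct short paths; this bounds the number of rounds of the search. -/
theorem Queue.tail_le (h : Queue G W b₁ b₂ q t last par root rw p1 p2)
    (hB : ∀ F : Finset (List (Fin n)), (∀ l ∈ F, IsShortPath G b₂ l) → F.card ≤ B) : t ≤ B := by
  classical
  have := hB ((Finset.range t).image q) (by
    intro l hl
    obtain ⟨i, hi, rfl⟩ := Finset.mem_image.1 hl
    exact h.short i (Finset.mem_range.1 hi))
  rwa [Finset.card_image_of_injOn (by simpa using h.injOn), Finset.card_range] at this

theorem Queue.two_le_length_iff (h : Queue G W b₁ b₂ q t last par root rw p1 p2) {i : ℕ}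
    (hi : i < t) : 2 ≤ (q i).length ↔ n ≤ i := by
  constructor
  · intro h2
    by_contra hn
    rw [h.base ⟨i, by omega⟩] at h2
    simp at h2
  · intro hn
    obtain ⟨v, hv⟩ := h.cons i hi hn
    have := (h.short _ ((h.par_lt i hi hn).trans hi)).ne_nil
    rw [hv, List.length_cons]
    have := List.length_pos_iff.2 this
    omega

/-- The first `n` entries are exactly the paths with one vertex, so the length needed for a cycle is
tested by comparing indices. -/
theorem Queue.three_le_length_iff (h : Queue G W b₁ b₂ q t last par root rw p1 p2) {i : ℕ}
    (hi : i < t) : 3 ≤ (q i).length ↔ n ≤ i ∧ n ≤ par i := by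
  constructor
  · intro h3
    have hn := (h.two_le_length_iff hi).1 (by omega)
    obtain ⟨v, hv⟩ := h.cons i hi hn
    refine ⟨hn, (h.two_le_length_iff ((h.par_lt i hi hn).trans hi)).1 ?_⟩
    rw [hv, List.length_cons] at h3
    omega
  · rintro ⟨hn, hp⟩
    obtain ⟨v, hv⟩ := h.cons i hi hn
    have := (h.two_le_length_iff ((h.par_lt i hi hn).trans hi)).2 hp
    rw [hv, List.length_cons]
    omega

theorem Queue.append (h : Queue G W b₁ b₂ q t last par root rw p1 p2) {i : ℕ} (hi : i < t)
    {w : Fin n} (hs : IsShortPath G b₂ (w :: q i)) (hnew : ∀ j < t, q j ≠ w :: q i) :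
    Queue G W b₁ b₂ (Function.update q t (w :: q i)) (t + 1) (Function.update last t w)
      (Function.update par t i) (Function.update root t (root i))
      (Function.update rw t (rw i * W w)) (Function.update p1 t (p1 i * b₁))
      (Function.update p2 t (p2 i * b₂)) := by
  have hlen : 1 ≤ (q i).length := List.length_pos_iff.2 (h.short i hi).ne_nil
  have hpow : ∀ b : ℝ, b ^ ((q i).length - 1) * b = b ^ ((w :: q i).length - 1) := by
    intro b
    rw [← pow_succ, List.length_cons]
    congr 1
    omega
  refine ⟨⟨?_, ?_, ?_, ?_, ?_, ?_⟩, ?_, ?_, ?_, ?_, ?_, ?_⟩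
  · exact h.le_tail.trans (Nat.le_succ t)
  · intro v
    have := v.2.trans_le h.le_tail
    rw [Function.update_of_ne this.ne, h.base]
  · intro j hj hn
    rcases Nat.lt_succ_iff_lt_or_eq.1 hj with hj | rfl
    · rw [Function.update_of_ne hj.ne]; exact h.par_lt j hj hn
    · rwa [Function.update_self]
  · intro j hj hn
    rcases Nat.lt_succ_iff_lt_or_eq.1 hj with hj | rfl
    · rw [Function.update_of_ne hj.ne, Function.update_of_ne hj.ne,
        Function.update_of_ne ((h.par_lt j hj hn).trans hj).ne]
      exact h.cons j hj hn
    · rw [Function.update_self, Function.update_self, Function.update_of_ne hi.ne]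
      exact ⟨w, rfl⟩
  · intro j hj
    rcases Nat.lt_succ_iff_lt_or_eq.1 hj with hj | rfl
    · rw [Function.update_of_ne hj.ne, Function.update_of_ne hj.ne]; exact h.last_eq j hj
    · rw [Function.update_self, Function.update_self]; exact ⟨w, _, rfl, rfl⟩
  · intro j hj
    rcases Nat.lt_succ_iff_lt_or_eq.1 hj with hj | rfl
    · rw [Function.update_of_ne hj.ne]; exact h.nodup j hj
    · rw [Function.update_self]; exact hs.nodup
  · intro j hj
    rcases Nat.lt_succ_iff_lt_or_eq.1 hj with hj | rfl
    · rw [Function.update_of_ne hj.ne, Function.update_of_ne hj.ne]; exact h.root_eq j hj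
    · rw [Function.update_self, Function.update_self]
      obtain ⟨v, hv, hr⟩ := h.root_eq i hi
      refine ⟨v, ?_, hr⟩
      rw [List.getLast?_cons, hv]
      rfl
  · intro j hj
    rcases Nat.lt_succ_iff_lt_or_eq.1 hj with hj | rfl
    · rw [Function.update_of_ne hj.ne, Function.update_of_ne hj.ne]; exact h.rw_eq j hj
    · rw [Function.update_self, Function.update_self, h.rw_eq i hi, List.map_cons, List.prod_cons,
        mul_comm]
  · intro j hj
    rcases Nat.lt_succ_iff_lt_or_eq.1 hj with hj | rfl
    · rw [Function.update_of_ne hj.ne, Function.update_of_ne hj.ne]; exact h.p1_eq j hj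
    · rw [Function.update_self, Function.update_self, h.p1_eq i hi, hpow]
  · intro j hj
    rcases Nat.lt_succ_iff_lt_or_eq.1 hj with hj | rfl
    · rw [Function.update_of_ne hj.ne, Function.update_of_ne hj.ne]; exact h.p2_eq j hj
    · rw [Function.update_self, Function.update_self, h.p2_eq i hi, hpow]
  · intro j hj
    rcases Nat.lt_succ_iff_lt_or_eq.1 hj with hj | rfl
    · rw [Function.update_of_ne hj.ne]; exact h.short j hj
    · rw [Function.update_self]; exact hs
  · intro j hj j' hj' he
    rcases Nat.lt_succ_iff_lt_or_eq.1 (Set.mem_Iio.1 hj) with hj | rfl <;>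
      rcases Nat.lt_succ_iff_lt_or_eq.1 (Set.mem_Iio.1 hj') with hj' | rfl
    · rw [Function.update_of_ne hj.ne, Function.update_of_ne hj'.ne] at he
      exact h.injOn hj hj' he
    · rw [Function.update_of_ne hj.ne, Function.update_self] at he
      exact absurd he (hnew j hj)
    · rw [Function.update_of_ne hj'.ne, Function.update_self] at he
      exact absurd he.symm (hnew j' hj')
    · rfl

end Append

/-- The initial queue, of the paths of length zero. -/
def startCmd : Cmd :=
  .seq (forUpto .u NV.n.val
    (.seq (.setN .last NV.u.val NV.u.val) (.seq (.setN .root NV.u.val NV.u.val)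
    (.seq (.setR .rw NV.u.val (.cell .wt NV.u.val)) (.seq (.setR .p1 NV.u.val (.cst 1))
      (.setR .p2 NV.u.val (.cst 1)))))))
    (NV.tail.put NV.n.val)

/-- The statement that the state contains the queue. -/
abbrev HasQueue (G : SimpleGraph (Fin n)) (W : Fin n → ℝ) (b₁ b₂ : ℝ) (q : ℕ → List (Fin n))
    (t : ℕ) (s : St) : Prop :=
  s.nat .tail 0 = t ∧ Queue G W b₁ b₂ q t (s.nat .last) (s.nat .par) (s.nat .root) (s.real .rw)
    (s.real .p1) (s.real .p2)

theorem post_startCmd (hn : s.nat .n 0 = n) (hB : n ≤ B) {W : Fin n → ℝ} (b₁ b₂ : ℝ)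
    (hW : ∀ u : Fin n, s.real .wt u = W u) :
    Post G B startCmd s fun s' => ∃ q, HasQueue G W b₁ b₂ q n s' := by
  refine Post.seq (Post.forUpto n (fun k s' => ∀ u : Fin n, (u : ℕ) < k → s'.nat .last u = u ∧
    s'.nat .root u = u ∧ s'.real .rw u = W u ∧ s'.real .p1 u = 1 ∧ s'.real .p2 u = 1) hB rfl
    (by simp) ?_ ?_) ?_
  · intro k s' hF _
    simp only [NExp.eval]
    rw [hF.nat .n rfl, hn]
  · intro k s' hk hF hu h
    refine Post.seq_setN (Post.seq_setN (Post.seq_setR (Post.seq_setR (Post.setR fun u huk => ?_))))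
    have hwt : s'.real .wt k = W ⟨k, hk⟩ := by rw [hF.real .wt rfl]; exact hW ⟨k, hk⟩
    simp only [NExp.eval, RExp.eval, ne_eq, reduceCtorEq, not_false_eq_true, St.setN_nat_of_ne,
      St.setN_nat_self, hu, St.setN_real, St.setR_nat, St.setR_real_of_ne, St.setR_real_self, hwt]
    rcases Nat.lt_succ_iff_lt_or_eq.1 huk with h2 | h2
    · simpa only [Function.update_of_ne h2.ne] using h u h2
    · obtain rfl : u = ⟨k, hk⟩ := Fin.ext h2
      simp
  · intro s' h hF
    have hn' : s'.nat .n 0 = n := by rw [hF.nat .n rfl, hn]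
    obtain ⟨q, hq⟩ : ∃ q : ℕ → List (Fin n), ∀ i (hi : i < n), q i = [⟨i, hi⟩] :=
      ⟨fun i => if hi : i < n then [⟨i, hi⟩] else [], fun i hi => dif_pos hi⟩
    refine Post.setN ⟨q, by simp [NExp.eval, hn'], ?_⟩
    simp only [ne_eq, reduceCtorEq, not_false_eq_true, St.setN_nat_of_ne, St.setN_real]
    refine ⟨⟨le_rfl, fun v => hq v v.2, by omega, by omega, ?_, ?_⟩, ?_, ?_, ?_, ?_, ?_, ?_⟩
    · intro i hi
      exact ⟨⟨i, hi⟩, [], hq i hi, (h ⟨i, hi⟩ hi).1⟩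
    · intro i hi
      rw [hq i hi]; simp
    · intro i hi
      exact ⟨⟨i, hi⟩, by rw [hq i hi]; rfl, (h ⟨i, hi⟩ hi).2.1⟩
    · intro i hi
      rw [hq i hi]
      simpa using (h ⟨i, hi⟩ hi).2.2.1
    · intro i hi
      rw [hq i hi]
      simpa using (h ⟨i, hi⟩ hi).2.2.2.1
    · intro i hi
      rw [hq i hi]
      simpa using (h ⟨i, hi⟩ hi).2.2.2.2
    · intro i hi
      rw [hq i hi]
      exact isShortPath_singleton _ _
    · intro i hi j hj he
      rw [hq i hi, hq j hj] at he
      exact Fin.mk.inj (List.cons.inj he).1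

/-- Appends the extension of the path number `i` by the vertex `w` to the queue. -/
def appendCmd (b₁ b₂ : ℝ) : Cmd :=
  .seq (.setN .last NV.tail.val NV.w.val) (.seq (.setN .par NV.tail.val NV.i.val)
  (.seq (.setN .root NV.tail.val (.cell .root NV.i.val))
  (.seq (.setR .rw NV.tail.val (.mul (.cell .rw NV.i.val) (.cell .wt NV.w.val)))
  (.seq (.setR .p1 NV.tail.val (.mul (.cell .p1 NV.i.val) (.cst b₁)))
  (.seq (.setR .p2 NV.tail.val (.mul (.cell .p2 NV.i.val) (.cst b₂)))
  (NV.tail.put (.add NV.tail.val (.cst 1))))))))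

/-- Appends all extensions of the path number `i` to the queue. -/
def extendCmd (b₁ b₂ : ℝ) : Cmd :=
  .seq markCmd (forUpto .w NV.n.val
    (.ite (.nle (.cst 1) (.edge (.cell .last NV.i.val) NV.w.val))
      (.ite (.nle (.cell .cur NV.w.val) (.cst 0))
        (.ite (.rle (.mul (.cell .p2 NV.i.val) (.cst b₂)) (.cast NV.n.val)) (appendCmd b₁ b₂) .skip)
        .skip) .skip))

/-- The extensions of the first `i` paths are in the queue. -/
structure Processed (G : SimpleGraph (Fin n)) (b₂ : ℝ) (q : ℕ → List (Fin n)) (t : ℕ)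
    (par : ℕ → ℕ) (i : ℕ) : Prop where
  par_lt : ∀ j < t, n ≤ j → par j < i
  mem : ∀ j < i, ∀ w, IsShortPath G b₂ (w :: q j) → ∃ j' < t, q j' = w :: q j

/-- The invariant records that entries with parent `i` end in a vertex below the current `w`. This
excludes repetitions, since an entry is determined by its parent and its last vertex. -/
theorem post_extendCmd (hn : s.nat .n 0 = n) (hB : n ≤ B) {W : Fin n → ℝ} {b₁ b₂ : ℝ}
    (hW : ∀ u : Fin n, s.real .wt u = W u) {q : ℕ → List (Fin n)} {t i : ℕ}
    (hq : HasQueue G W b₁ b₂ q t s) (hi : s.nat .i 0 = i) (hit : i < t)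
    (hP : Processed G b₂ q t (s.nat .par) i) :
    Post G B (extendCmd b₁ b₂) s fun s' => ∃ q' t', HasQueue G W b₁ b₂ q' t' s' ∧ i + 1 ≤ t' ∧
      Processed G b₂ q' t' (s'.nat .par) (i + 1) := by
  refine (post_markCmd hn hB hq.2.toPathTree (hi ▸ hit)).seq fun s1 h1 hF1 => ?_
  rw [hi] at h1
  refine (Post.forUpto n (fun k s' => ∃ q' t', HasQueue G W b₁ b₂ q' t' s' ∧ i < t' ∧ q' i = q i ∧
    (∀ j < t', n ≤ j → s'.nat .par j < i ∨ s'.nat .par j = i ∧ s'.nat .last j < k) ∧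
    (∀ j < i, ∀ w, IsShortPath G b₂ (w :: q' j) → ∃ j' < t', q' j' = w :: q' j) ∧
    (∀ w : Fin n, (w : ℕ) < k → IsShortPath G b₂ (w :: q' i) → ∃ j' < t', q' j' = w :: q' i))
    hB rfl ?_ ?_ ?_).mono ?_
  · refine ⟨q, t, ⟨?_, ?_⟩, hit, rfl, ?_, hP.mem, fun w hw => by omega⟩
    · simpa [St.setN_nat_of_ne, hF1.nat .tail rfl] using hq.1
    · simpa [St.setN_nat_of_ne, hF1.nat .last rfl, hF1.nat .par rfl, hF1.nat .root rfl,
        hF1.real .rw rfl, hF1.real .p1 rfl, hF1.real .p2 rfl] using hq.2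
    · intro j hj hnj
      left
      simpa [St.setN_nat_of_ne, hF1.nat .par rfl] using hP.par_lt j hj hnj
  · intro k s' hF _
    simp only [NExp.eval]
    rw [hF.nat .n rfl, hF1.nat .n rfl, hn]
  · rintro k s' hk hF hw ⟨q', t', hq', hit', hqi, hpar, hmem, hmk⟩
    have hn' : s'.nat .n 0 = n := by rw [hF.nat .n rfl, hF1.nat .n rfl, hn]
    have hi' : s'.nat .i 0 = i := by rw [hF.nat .i rfl, hF1.nat .i rfl, hi]
    have hwt : s'.real .wt k = W ⟨k, hk⟩ := by
      rw [hF.real .wt rfl, hF1.real .wt rfl]; exact hW ⟨k, hk⟩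
    have hcur : 1 ≤ s'.nat .cur k ↔ ⟨k, hk⟩ ∈ q i := by
      rw [hF.nat .cur rfl]; exact (h1 ⟨k, hk⟩).2
    obtain ⟨v, l, hvl, hv⟩ := hq'.2.last_eq i hit'
    have hno : ¬ IsShortPath G b₂ (⟨k, hk⟩ :: q' i) → (fun s'' : St => ∃ q' t',
        HasQueue G W b₁ b₂ q' t' (s''.setN .w 0 (k + 1)) ∧ i < t' ∧ q' i = q i ∧
        (∀ j < t', n ≤ j → (s''.setN .w 0 (k + 1)).nat .par j < i ∨
          (s''.setN .w 0 (k + 1)).nat .par j = i ∧ (s''.setN .w 0 (k + 1)).nat .last j < k + 1) ∧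
        (∀ j < i, ∀ w, IsShortPath G b₂ (w :: q' j) → ∃ j' < t', q' j' = w :: q' j) ∧
        (∀ w : Fin n, (w : ℕ) < k + 1 → IsShortPath G b₂ (w :: q' i) →
          ∃ j' < t', q' j' = w :: q' i)) s' := by
      intro hs
      refine ⟨q', t', by simpa [HasQueue, St.setN_nat_of_ne] using hq', hit', hqi, ?_, hmem, ?_⟩
      · intro j hj hnj
        simp only [ne_eq, reduceCtorEq, not_false_eq_true, St.setN_nat_of_ne]
        exact (hpar j hj hnj).imp id fun h => ⟨h.1, by omega⟩
      · intro w hwk hsw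
        rcases Nat.lt_succ_iff_lt_or_eq.1 hwk with h2 | h2
        · exact hmk w h2 hsw
        · obtain rfl : w = ⟨k, hk⟩ := Fin.ext h2
          exact absurd hsw hs
    have hadj := one_le_adjEntry_iff (G := G) v ⟨k, hk⟩
    refine Post.ite (fun hb1 => ?_) fun hb1 => Post.skip (hno fun h => hb1 ?_)
    swap
    · simp only [Cond.Holds, NExp.eval, hi', hw, hv, hadj]
      have := h.isChain
      rw [hvl, List.isChain_cons_cons] at this
      exact this.1.symm
    refine Post.ite (fun hb2 => ?_) fun hb2 => Post.skip (hno fun h => hb2 ?_)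
    swap
    · simp only [Cond.Holds, NExp.eval, hw]
      have := h.nodup
      rw [List.nodup_cons, hqi, ← hcur] at this
      omega
    have hlen : 1 ≤ (q' i).length := by rw [hvl]; simp
    have hp2 : s'.real .p2 i * b₂ = b₂ ^ ((⟨k, hk⟩ :: q' i : List (Fin n)).length - 1) := by
      rw [hq'.2.p2_eq i hit', ← pow_succ, List.length_cons]
      congr 1
      omega
    refine Post.ite (fun hb3 => ?_) fun hb3 => Post.skip (hno fun h => hb3 ?_)
    swap
    · simp only [Cond.Holds, RExp.eval, NExp.eval, hi', hn', hp2]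
      exact h.pow_le
    simp only [Cond.Holds, NExp.eval, hi', hw, hv, hadj] at hb1
    simp only [Cond.Holds, NExp.eval, hw] at hb2
    simp only [Cond.Holds, RExp.eval, NExp.eval, hi', hn', hp2] at hb3
    have hs : IsShortPath G b₂ (⟨k, hk⟩ :: q' i) := by
      refine ⟨by simp, ?_, ?_, hb3⟩
      · rw [hvl, List.isChain_cons_cons]
        refine ⟨hb1.symm, ?_⟩
        rw [← hvl]
        exact (hq'.2.short i hit').isChain
      · rw [List.nodup_cons]
        refine ⟨?_, (hq'.2.short i hit').nodup⟩
        rw [hqi, ← hcur]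
        omega
    -- An equal entry would have parent `i`, by injectivity of `q'`, and last vertex `k`, but only
    -- smaller vertices have been tried.
    have hnew : ∀ j < t', q' j ≠ ⟨k, hk⟩ :: q' i := by
      intro j hj he
      have hnj : n ≤ j := (hq'.2.two_le_length_iff hj).1 (by rw [he, List.length_cons]; omega)
      obtain ⟨u, hu⟩ := hq'.2.cons j hj hnj
      obtain ⟨u', l', hu', hlast⟩ := hq'.2.last_eq j hj
      have h2 : q' (s'.nat .par j) = q' i := by
        rw [hu] at he
        exact (List.cons.inj he).2
      have h3 : s'.nat .par j = i :=
        hq'.2.injOn ((hq'.2.par_lt j hj hnj).trans hj) hit' h2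
      have h4 : u' = ⟨k, hk⟩ := by
        rw [hu'] at he
        exact (List.cons.inj he).1
      rcases hpar j hj hnj with h5 | h5
      · omega
      · rw [hlast, h4] at h5
        simp at h5
    have hA := hq'.2.append hit' hs hnew
    refine Post.seq_setN (Post.seq_setN (Post.seq_setN (Post.seq_setR (Post.seq_setR
      (Post.seq_setR (Post.setN ?_))))))
    simp only [HasQueue, NExp.eval, RExp.eval, ne_eq, reduceCtorEq, not_false_eq_true,
      St.setN_nat_of_ne, St.setN_nat_self, St.setN_real, St.setR_nat, St.setR_real_of_ne,
      St.setR_real_self, hw, hi', hq'.1, hwt, Function.update_self]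
    refine ⟨Function.update q' t' (⟨k, hk⟩ :: q' i), t' + 1, ⟨rfl, hA⟩,
      hit'.trans (Nat.lt_succ_self _), ?_, ?_, ?_, ?_⟩
    · rw [Function.update_of_ne hit'.ne, hqi]
    · intro j hj hnj
      rcases Nat.lt_succ_iff_lt_or_eq.1 hj with hj | rfl
      · simp only [Function.update_of_ne hj.ne]
        exact (hpar j hj hnj).imp id fun h => ⟨h.1, by omega⟩
      · simp
    · intro j hj w
      rw [Function.update_of_ne (hj.trans hit').ne]
      intro h
      obtain ⟨j', hj', he⟩ := hmem j hj w h
      exact ⟨j', by omega, by rw [Function.update_of_ne hj'.ne, he]⟩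
    · intro w hwk
      rw [Function.update_of_ne hit'.ne]
      intro h
      rcases Nat.lt_succ_iff_lt_or_eq.1 hwk with h2 | h2
      · obtain ⟨j', hj', he⟩ := hmk w h2 h
        exact ⟨j', by omega, by rw [Function.update_of_ne hj'.ne, he]⟩
      · obtain rfl : w = ⟨k, hk⟩ := Fin.ext h2
        exact ⟨t', by omega, Function.update_self ..⟩
  · rintro s' ⟨q', t', hq', hit', -, hpar, hmem, hmk⟩ -
    refine ⟨q', t', hq', hit', ⟨?_, ?_⟩⟩
    · intro j hj hnj
      rcases hpar j hj hnj with h | h <;> omega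
    · intro j hj w hw
      rcases Nat.lt_succ_iff_lt_or_eq.1 hj with hj | rfl
      · exact hmem j hj w hw
      · exact hmk w w.2 hw

/-- The computation of the queue of all short paths. -/
def queueCmd (b₁ b₂ : ℝ) : Cmd :=
  .seq startCmd (.seq (NV.i.put (.cst 0)) (.while (.nle (.add NV.i.val (.cst 1)) NV.tail.val)
    (.seq (extendCmd b₁ b₂) (NV.i.put (.add NV.i.val (.cst 1))))))

/-- Each round processes one entry of a duplicate-free queue, so there are at most `B` rounds. The
queue is complete because a short path minus its last vertex is again short, using `1 ≤ b₂`. -/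
theorem post_queueCmd (hn : s.nat .n 0 = n) (hnB : n ≤ B) {W : Fin n → ℝ} {b₁ b₂ : ℝ}
    (hb : 1 ≤ b₂) (hB : ∀ F : Finset (List (Fin n)), (∀ l ∈ F, IsShortPath G b₂ l) → F.card ≤ B)
    (hW : ∀ u : Fin n, s.real .wt u = W u) :
    Post G B (queueCmd b₁ b₂) s fun s' => ∃ q t, HasQueue G W b₁ b₂ q t s' ∧
      ∀ l, IsShortPath G b₂ l → ∃ i < t, q i = l := by
  refine (post_startCmd hn hnB b₁ b₂ hW).seq fun s1 h1 hF1 => Post.seq_setN ((Post.while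
    (fun i s' => s'.nat .i 0 = i ∧ s'.nat .n 0 = n ∧ (∀ u : Fin n, s'.real .wt u = W u) ∧
    ∃ q t, HasQueue G W b₁ b₂ q t s' ∧ i ≤ t ∧ Processed G b₂ q t (s'.nat .par) i)
    ?_ ?_).mono ?_)
  · obtain ⟨q, hq⟩ := h1
    refine ⟨by simp [NExp.eval], ?_, ?_, q, n, ?_, Nat.zero_le _, ⟨by omega, by omega⟩⟩
    · simp [St.setN_nat_of_ne, hF1.nat .n rfl, hn]
    · simpa [hF1.real .wt rfl] using hW
    · simpa [HasQueue, St.setN_nat_of_ne] using hq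
  · rintro i s' ⟨hi, hn', hW', q, t, hq, hit, hP⟩ hb
    simp only [Cond.Holds, NExp.eval, hi, hq.1] at hb
    refine ⟨lt_of_lt_of_le hb (hq.2.tail_le hB), (post_extendCmd hn' hnB hW' hq hi hb hP).seq
      fun s2 h2 hF2 => Post.setN ?_⟩
    obtain ⟨q', t', hq', hit', hP'⟩ := h2
    refine ⟨by simp [NExp.eval, hF2.nat .i rfl, hi], ?_, ?_, q', t', ?_, hit', ?_⟩
    · simp [St.setN_nat_of_ne, hF2.nat .n rfl, hn']
    · simpa [hF2.real .wt rfl] using hW'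
    · simpa [HasQueue, St.setN_nat_of_ne] using hq'
    · simpa [St.setN_nat_of_ne] using hP'
  · rintro s' ⟨i, ⟨hi, -, -, q, t, hq, hit, hP⟩, hnb⟩ -
    simp only [Cond.Holds, NExp.eval, hi, hq.1] at hnb
    refine ⟨q, t, hq, fun l hl => ?_⟩
    induction l with
    | nil => exact absurd rfl hl.ne_nil
    | cons w l ih =>
      by_cases hl' : l = []
      · subst hl'
        exact ⟨w, w.2.trans_le hq.2.le_tail, hq.2.base w⟩
      · obtain ⟨j, hj, rfl⟩ := ih (hl.tail hb hl')
        exact hP.mem j (by omega) w hl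

end Queue

/-! ### From the list of paths to the list of blocks -/

section Main

variable {n : ℕ} {G : SimpleGraph (Fin n)} {B : ℕ} {s : St}

/-- Marks the vertices that are not break-points. -/
def influenceCmd : Cmd :=
  forUpto .i NV.tail.val
    (.ite (.rle (.cell .p1 NV.i.val) (.cast NV.n.val))
      (.ite (.rle (.cell .rw NV.i.val) (.cst 1)) .skip
        (.setN .nb (.cell .root NV.i.val) (.cst 1))) .skip)

/-- Paths are stored backwards, so the vertex on which a path exerts influence is its root, the last
entry of the list. The maximum in the definition of influence need not be computed: one path of
weight above one decides. -/
theorem post_influenceCmd (hn : s.nat .n 0 = n) {W : Fin n → ℝ} {b₁ b₂ : ℝ}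
    {q : ℕ → List (Fin n)} {t : ℕ} (hq : HasQueue G W b₁ b₂ q t s) (htB : t ≤ B)
    (hnb : ∀ v : Fin n, s.nat .nb v = 0) :
    Post G B influenceCmd s fun s' => ∀ v : Fin n, 1 ≤ s'.nat .nb v ↔
      ∃ i < t, (q i).getLast? = some v ∧ b₁ ^ ((q i).length - 1) ≤ n ∧
        ¬ ((q i).map W).prod ≤ 1 := by
  refine Post.forUpto t (fun k s' => ∀ v : Fin n, 1 ≤ s'.nat .nb v ↔
      ∃ i < k, (q i).getLast? = some v ∧ b₁ ^ ((q i).length - 1) ≤ n ∧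
        ¬ ((q i).map W).prod ≤ 1) htB rfl ?_ ?_ ?_
  · simp [St.setN_nat_of_ne, hnb]
  · intro k s' hF _
    simp only [NExp.eval]
    rw [hF.nat .tail rfl, hq.1]
  · intro k s' hk hF hi h
    have hn' : s'.nat .n 0 = n := by rw [hF.nat .n rfl, hn]
    obtain ⟨v₀, hv₀, hroot⟩ := hq.2.root_eq k hk
    have hno : (b₁ ^ ((q k).length - 1) ≤ n → ((q k).map W).prod ≤ 1) → (fun s' : St =>
        ∀ v : Fin n, 1 ≤ (s'.setN .i 0 (k + 1)).nat .nb v ↔ ∃ i < k + 1, (q i).getLast? = some v ∧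
        b₁ ^ ((q i).length - 1) ≤ n ∧ ¬ ((q i).map W).prod ≤ 1) s' := by
      intro hk' v
      simp only [ne_eq, reduceCtorEq, not_false_eq_true, St.setN_nat_of_ne, h]
      constructor
      · rintro ⟨i, hi, h⟩; exact ⟨i, by omega, h⟩
      · rintro ⟨i, hi, h1, h2, h3⟩
        rcases Nat.lt_succ_iff_lt_or_eq.1 hi with h4 | rfl
        · exact ⟨i, h4, h1, h2, h3⟩
        · exact absurd (hk' h2) h3
    refine Post.ite (fun hb1 => Post.ite (fun hb2 => Post.skip (hno fun _ => ?_))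
      fun hb2 => Post.setN fun v => ?_) fun hb1 => Post.skip (hno fun h => absurd ?_ hb1)
    · simp only [Cond.Holds, RExp.eval, NExp.eval, hi] at hb2
      rwa [hF.real .rw rfl, hq.2.rw_eq k hk] at hb2
    · simp only [Cond.Holds, RExp.eval, NExp.eval, hi, hn'] at hb1 hb2
      rw [hF.real .rw rfl, hq.2.rw_eq k hk] at hb2
      rw [hF.real .p1 rfl, hq.2.p1_eq k hk] at hb1
      simp only [NExp.eval, hi, hF.nat .root rfl, hroot, ne_eq, reduceCtorEq, not_false_eq_true,
        St.setN_nat_of_ne, St.setN_nat_self]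
      by_cases hv : v = v₀
      · subst hv
        simp only [Function.update_self, le_refl, true_iff]
        exact ⟨k, Nat.lt_succ_self k, hv₀, hb1, hb2⟩
      · rw [Function.update_of_ne fun h => hv (Fin.ext h), h]
        constructor
        · rintro ⟨i, hi, h⟩; exact ⟨i, by omega, h⟩
        · rintro ⟨i, hi, h1, h2, h3⟩
          rcases Nat.lt_succ_iff_lt_or_eq.1 hi with h4 | rfl
          · exact ⟨i, h4, h1, h2, h3⟩
          · rw [hv₀, Option.some.injEq] at h1
            exact absurd h1.symm hv
    · simp only [Cond.Holds, RExp.eval, NExp.eval, hi, hn']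
      rw [hF.real .p1 rfl, hq.2.p1_eq k hk]
      exact h

/-- `l` lists the vertices of a cycle whose number of edges `k` satisfies `b ^ k ≤ n`. -/
structure IsShortCycle (G : SimpleGraph (Fin n)) (b : ℝ) (l : List (Fin n)) : Prop where
  path : IsShortPath G b l
  three_le : 3 ≤ l.length
  adj : ∃ u v, l.head? = some u ∧ l.getLast? = some v ∧ G.Adj u v
  pow_le : b ^ l.length ≤ n

/-- Lists the blocks of the cycles. -/
def cyclesCmd (ρ : StartRule) (b₂ : ℝ) : Cmd :=
  forUpto .i NV.tail.val
    (.ite (.nle NV.n.val NV.i.val) (.ite (.nle NV.n.val (.cell .par NV.i.val))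
      (.ite (.nle (.cst 1) (.edge (.cell .last NV.i.val) (.cell .root NV.i.val)))
        (.ite (.rle (.mul (.cell .p2 NV.i.val) (.cst b₂)) (.cast NV.n.val))
          (.seq markCmd (.seq (closeCmd ρ) addRowCmd)) .skip) .skip) .skip) .skip)

/-- A cycle is a path with at least three vertices and adjacent ends. It is found once for each
starting point and direction; the repetitions are removed by `addRowCmd`. -/
theorem post_cyclesCmd (θ : Params) (ρ : StartRule) (hn : s.nat .n 0 = n) (hB : n ≤ B)
    {W : Fin n → ℝ} {b₁ b₂ : ℝ} {q : ℕ → List (Fin n)} {t : ℕ} (hq : HasQueue G W b₁ b₂ q t s)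
    (htB : t ≤ B) (hnb : ∀ v : Fin n, 1 ≤ s.nat .nb v ↔ ¬ IsBreakPoint θ G v)
    (hcnt : s.nat .cnt 0 = 0) :
    Post G B (cyclesCmd ρ b₂) s fun s' => ∃ Xs N, s'.nat .cnt 0 = N ∧ N ≤ t ∧
      Listing (s'.nat .rows) N Xs ∧ Xs '' Set.Iio N =
        {X | ∃ i < t, IsShortCycle G b₂ (q i) ∧ X = closure θ G ρ {v | v ∈ q i}} := by
  refine Post.forUpto t (fun k s' => ∃ Xs N, s'.nat .cnt 0 = N ∧ N ≤ k ∧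
      Listing (s'.nat .rows) N Xs ∧ Xs '' Set.Iio N =
        {X | ∃ i < k, IsShortCycle G b₂ (q i) ∧ X = closure θ G ρ {v | v ∈ q i}})
      htB (by cases ρ <;> rfl) ?_ ?_ ?_
  · refine ⟨fun _ => ∅, 0, by simp [St.setN_nat_of_ne, hcnt], le_rfl, ⟨by omega, ?_⟩, ?_⟩
    · intro i hi; simp at hi
    · ext X; simp
  · intro k s' hF _
    simp only [NExp.eval]
    rw [hF.nat .tail (by cases ρ <;> rfl), hq.1]
  · rintro k s' hk hF hi ⟨Xs, N, hN, hNk, hL, hX⟩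
    have hn' : s'.nat .n 0 = n := by rw [hF.nat .n (by cases ρ <;> rfl), hn]
    have hlast' : s'.nat .last = s.nat .last := hF.nat .last (by cases ρ <;> rfl)
    have hpar' : s'.nat .par = s.nat .par := hF.nat .par (by cases ρ <;> rfl)
    have hroot' : s'.nat .root = s.nat .root := hF.nat .root (by cases ρ <;> rfl)
    have hp2' : s'.real .p2 = s.real .p2 := hF.real .p2 (by cases ρ <;> rfl)
    have hnb' : s'.nat .nb = s.nat .nb := hF.nat .nb (by cases ρ <;> rfl)
    obtain ⟨v₀, hv₀, hroot⟩ := hq.2.root_eq k hk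
    obtain ⟨w₀, l, hw₀, hlast⟩ := hq.2.last_eq k hk
    have hset : ∀ X, (∃ i < k + 1, IsShortCycle G b₂ (q i) ∧ X = closure θ G ρ {v | v ∈ q i}) ↔
        (∃ i < k, IsShortCycle G b₂ (q i) ∧ X = closure θ G ρ {v | v ∈ q i}) ∨
        IsShortCycle G b₂ (q k) ∧ X = closure θ G ρ {v | v ∈ q k} := by
      intro X
      constructor
      · rintro ⟨i, hi, h⟩
        rcases Nat.lt_succ_iff_lt_or_eq.1 hi with h4 | rfl
        · exact .inl ⟨i, h4, h⟩
        · exact .inr h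
      · rintro (⟨i, hi, h⟩ | h)
        · exact ⟨i, by omega, h⟩
        · exact ⟨k, Nat.lt_succ_self k, h⟩
    have hno : ¬ IsShortCycle G b₂ (q k) → (fun s' : St => ∃ Xs N,
        (s'.setN .i 0 (k + 1)).nat .cnt 0 = N ∧ N ≤ k + 1 ∧
        Listing ((s'.setN .i 0 (k + 1)).nat .rows) N Xs ∧ Xs '' Set.Iio N =
        {X | ∃ i < k + 1, IsShortCycle G b₂ (q i) ∧ X = closure θ G ρ {v | v ∈ q i}}) s' := by
      intro h
      refine ⟨Xs, N, by simpa [St.setN_nat_of_ne] using hN, by omega,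
        by simpa [St.setN_nat_of_ne] using hL, ?_⟩
      rw [hX]
      ext X
      simp only [Set.mem_ofPred_eq, hset, h, false_and, or_false]
    have hlen : 1 ≤ (q k).length := List.length_pos_iff.2 (hq.2.short k hk).ne_nil
    have hp2 : s.real .p2 k * b₂ = b₂ ^ (q k).length := by
      rw [hq.2.p2_eq k hk, ← pow_succ]
      congr 1
      omega
    have hadj := one_le_adjEntry_iff (G := G) w₀ v₀
    refine Post.ite (fun hb1 => ?_) fun hb1 => Post.skip (hno fun h => hb1 ?_)
    swap
    · simp only [Cond.Holds, NExp.eval, hn', hi]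
      exact ((hq.2.three_le_length_iff hk).1 h.three_le).1
    refine Post.ite (fun hb2 => ?_) fun hb2 => Post.skip (hno fun h => hb2 ?_)
    swap
    · simp only [Cond.Holds, NExp.eval, hn', hi, hpar']
      exact ((hq.2.three_le_length_iff hk).1 h.three_le).2
    refine Post.ite (fun hb3 => ?_) fun hb3 => Post.skip (hno fun h => hb3 ?_)
    swap
    · simp only [Cond.Holds, NExp.eval, hi, hlast', hroot', hlast, hroot, hadj]
      obtain ⟨u, v, hu, hv, huv⟩ := h.adj
      rw [hw₀, List.head?_cons, Option.some.injEq] at hu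
      rw [hv₀, Option.some.injEq] at hv
      rwa [hu, hv]
    refine Post.ite (fun hb4 => ?_) fun hb4 => Post.skip (hno fun h => hb4 ?_)
    swap
    · simp only [Cond.Holds, RExp.eval, NExp.eval, hi, hn', hp2', hp2]
      exact h.pow_le
    simp only [Cond.Holds, NExp.eval, hn', hi] at hb1
    simp only [Cond.Holds, NExp.eval, hn', hi, hpar'] at hb2
    simp only [Cond.Holds, NExp.eval, hi, hlast', hroot', hlast, hroot, hadj] at hb3
    simp only [Cond.Holds, RExp.eval, NExp.eval, hi, hn', hp2', hp2] at hb4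
    have hcyc : IsShortCycle G b₂ (q k) :=
      ⟨hq.2.short k hk, (hq.2.three_le_length_iff hk).2 ⟨hb1, hb2⟩,
        ⟨w₀, v₀, by rw [hw₀]; rfl, hv₀, hb3⟩, hb4⟩
    have hq' : PathTree q t (s'.nat .last) (s'.nat .par) := by
      rw [hlast', hpar']; exact hq.2.toPathTree
    refine (post_markCmd hn' hB hq' (by rwa [hi])).seq fun s1 h1 hF1 => ?_
    rw [hi] at h1
    refine (post_closeCmd θ ρ (by rw [hF1.nat .n rfl, hn']) hB
      (by rw [hF1.nat .nb rfl, hnb']; exact hnb) h1).seq fun s2 h2 hF2 => ?_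
    refine (post_addRowCmd (by rw [hF2.nat .n (by cases ρ <;> rfl), hF1.nat .n rfl, hn']) hB h2
      (N := N) (by rw [hF2.nat .cnt (by cases ρ <;> rfl), hF1.nat .cnt rfl, hN]) (by omega)
      (by rw [hF2.nat .rows (by cases ρ <;> rfl), hF1.nat .rows rfl]; exact hL)).mono ?_
    rintro s3 ⟨Xs', N', hN', h3, h4, hL', -, hX'⟩ -
    refine ⟨Xs', N', by simpa [St.setN_nat_of_ne] using hN', by omega,
        by simpa [St.setN_nat_of_ne] using hL', ?_⟩
    rw [hX', hX]
    ext X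
    simp only [Set.mem_ofPred_eq, hset, hcyc, true_and, Set.mem_insert_iff, or_comm]

/-- Lists the blocks of the vertices that lie in none of the sets listed before. -/
def verticesCmd : Cmd :=
  .seq (NV.ncyc.put NV.cnt.val) (forUpto .i NV.n.val
    (.seq (NV.fl.put (.cst 0)) (.seq (NV.off.put (.cst 0))
    (.seq (forUpto .r NV.ncyc.val (.seq
      (.ite (.nle (.cst 1) (.cell .rows (.add NV.off.val NV.i.val))) (NV.fl.put (.cst 1)) .skip)
      (NV.off.put (.add NV.off.val NV.n.val))))
    (.ite (.nle NV.fl.val (.cst 0))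
      (.seq clearCmd (.seq (.setN .cur NV.i.val (.cst 1))
        (.seq (closeCmd .included) addRowCmd))) .skip)))))

/-- Only the first `N` rows, the cycle blocks, are searched for the vertex; their number is frozen
in `ncyc` because rows are appended meanwhile. At most one row is added per vertex, so the list
stays within `B` rows. -/
theorem post_verticesCmd (θ : Params) (hn : s.nat .n 0 = n) (hB : n ≤ B)
    (hnb : ∀ v : Fin n, 1 ≤ s.nat .nb v ↔ ¬ IsBreakPoint θ G v) {Xs : ℕ → Set (Fin n)} {N : ℕ}
    (hN : s.nat .cnt 0 = N) (hNB : N + n ≤ B) (hL : Listing (s.nat .rows) N Xs) :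
    Post G B verticesCmd s fun s' => ∃ Xs' N', s'.nat .cnt 0 = N' ∧ N' ≤ B ∧
      Listing (s'.nat .rows) N' Xs' ∧ Xs' '' Set.Iio N' = Xs '' Set.Iio N ∪
        {X | ∃ v : Fin n, (∀ Y ∈ Xs '' Set.Iio N, v ∉ Y) ∧ X = vertexBlock θ G v} := by
  refine Post.seq_setN ((Post.forUpto n (fun k s' => ∃ Xs' N', s'.nat .cnt 0 = N' ∧ N ≤ N' ∧
    N' ≤ N + k ∧ Listing (s'.nat .rows) N' Xs' ∧ (∀ r < N, Xs' r = Xs r) ∧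
    Xs' '' Set.Iio N' = Xs '' Set.Iio N ∪ {X | ∃ v : Fin n, (v : ℕ) < k ∧
      (∀ Y ∈ Xs '' Set.Iio N, v ∉ Y) ∧ X = vertexBlock θ G v}) hB rfl ?_ ?_ ?_).mono ?_)
  · refine ⟨Xs, N, by simp [St.setN_nat_of_ne, hN], le_rfl, le_rfl,
      by simpa [St.setN_nat_of_ne] using hL, fun _ _ => rfl, by simp⟩
  · intro k s' hF _
    simp only [NExp.eval]
    rw [hF.nat .n rfl, St.setN_nat_of_ne _ _ _ (by simp), hn]
  · rintro k s' hk hF hi ⟨Xs', N', hN', h1, h2, hL', hXs', hX'⟩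
    have hn' : s'.nat .n 0 = n := by
      rw [hF.nat .n rfl, St.setN_nat_of_ne _ _ _ (by simp), hn]
    have hncyc : s'.nat .ncyc 0 = N := by
      rw [hF.nat .ncyc rfl]; simp [NExp.eval, hN]
    have hnb' : s'.nat .nb = s.nat .nb := by
      rw [hF.nat .nb rfl, St.setN_nat_of_ne _ _ _ (by simp)]
    have hset : ∀ X, (∃ v : Fin n, (v : ℕ) < k + 1 ∧ (∀ Y ∈ Xs '' Set.Iio N, v ∉ Y) ∧
          X = vertexBlock θ G v) ↔
        (∃ v : Fin n, (v : ℕ) < k ∧ (∀ Y ∈ Xs '' Set.Iio N, v ∉ Y) ∧ X = vertexBlock θ G v) ∨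
        (∀ Y ∈ Xs '' Set.Iio N, ⟨k, hk⟩ ∉ Y) ∧ X = vertexBlock θ G ⟨k, hk⟩ := by
      intro X
      constructor
      · rintro ⟨v, hv, h⟩
        rcases Nat.lt_succ_iff_lt_or_eq.1 hv with h4 | h4
        · exact .inl ⟨v, h4, h⟩
        · obtain rfl : v = ⟨k, hk⟩ := Fin.ext h4
          exact .inr h
      · rintro (⟨v, hv, h⟩ | h)
        · exact ⟨v, by omega, h⟩
        · exact ⟨⟨k, hk⟩, Nat.lt_succ_self k, h⟩
    refine Post.seq_setN (Post.seq_setN (Post.seq (Q := fun s1 => 1 ≤ s1.nat .fl 0 ↔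
      ∃ r < N, ⟨k, hk⟩ ∈ Xs r) ((Post.forUpto N (fun m s1 => s1.nat .off 0 = m * n ∧
      (1 ≤ s1.nat .fl 0 ↔ ∃ r < m, ⟨k, hk⟩ ∈ Xs r)) (by omega) rfl ?_ ?_ ?_).mono
      fun s1 h _ => h.2) ?_))
    · simp [St.setN_nat_of_ne, NExp.eval]
    · intro m s1 hF1 _
      simp only [NExp.eval]
      rw [hF1.nat .ncyc rfl]
      simp [St.setN_nat_of_ne, hncyc]
    · rintro m s1 hm hF1 hr ⟨hoff, hfl⟩
      have h3 : s1.nat .rows = s'.nat .rows := by rw [hF1.nat .rows rfl]; simp [St.setN_nat_of_ne]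
      have h4 : s1.nat .i 0 = k := by rw [hF1.nat .i rfl]; simp [St.setN_nat_of_ne, hi]
      have h5 : s1.nat .n 0 = n := by rw [hF1.nat .n rfl]; simp [St.setN_nat_of_ne, hn']
      have h6 := ((hL'.marks m (hm.trans_le h1)) ⟨k, hk⟩).2
      rw [hXs' m hm] at h6
      refine Post.seq (Q := fun s2 => 1 ≤ s2.nat .fl 0 ↔ ∃ r < m + 1, ⟨k, hk⟩ ∈ Xs r)
        (Post.ite (fun hb => Post.setN ?_) fun hb => Post.skip ?_) fun s2 hfl2 hF2 => Post.setN ?_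
      · simp only [Cond.Holds, NExp.eval, hoff, h3, h4, h6] at hb
        simp only [NExp.eval, St.setN_nat_self, Function.update_self, le_refl, true_iff]
        exact ⟨m, Nat.lt_succ_self m, hb⟩
      · simp only [Cond.Holds, NExp.eval, hoff, h3, h4, h6] at hb
        rw [hfl]
        constructor
        · rintro ⟨r, hr, h⟩; exact ⟨r, by omega, h⟩
        · rintro ⟨r, hr, h⟩
          rcases Nat.lt_succ_iff_lt_or_eq.1 hr with h7 | rfl
          · exact ⟨r, h7, h⟩
          · exact absurd h hb
      · have h7 : s2.nat .off 0 = m * n := by rw [hF2.nat .off rfl, hoff]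
        have h8 : s2.nat .n 0 = n := by rw [hF2.nat .n rfl, h5]
        simp [St.setN_nat_of_ne, NExp.eval, h7, h8, hfl2, add_mul]
    · intro s1 hfl hF1
      have h3 : s1.nat .rows = s'.nat .rows := by rw [hF1.nat .rows rfl]; simp [St.setN_nat_of_ne]
      have h4 : s1.nat .i 0 = k := by rw [hF1.nat .i rfl]; simp [St.setN_nat_of_ne, hi]
      have h5 : s1.nat .n 0 = n := by rw [hF1.nat .n rfl]; simp [St.setN_nat_of_ne, hn']
      have h6 : s1.nat .cnt 0 = N' := by rw [hF1.nat .cnt rfl]; simp [St.setN_nat_of_ne, hN']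
      have h7 : s1.nat .nb = s.nat .nb := by
        rw [hF1.nat .nb rfl]; simp [St.setN_nat_of_ne, hnb']
      refine Post.ite (fun hb => ?_) fun hb => Post.skip ?_
      · simp only [Cond.Holds, NExp.eval] at hb
        have hnot : ∀ Y ∈ Xs '' Set.Iio N, ⟨k, hk⟩ ∉ Y := by
          rintro _ ⟨r, hr, rfl⟩ hkr
          have := hfl.2 ⟨r, hr, hkr⟩
          omega
        refine (post_clearCmd h5 hB).seq fun s2 h8 hF2 => Post.seq_setN ?_
        have h9 : s2.nat .i 0 = k := by rw [hF2.nat .i rfl, h4]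
        refine (post_closeCmd (s := s2.setN .cur (NV.i.val.eval G s2) ((NExp.cst 1).eval G s2)) θ
          .included (X := {⟨k, hk⟩}) ?_ hB ?_ ?_).seq fun s3 h10 hF3 => ?_
        · simp [St.setN_nat_of_ne, hF2.nat .n rfl, h5]
        · simpa [St.setN_nat_of_ne, hF2.nat .nb rfl, h7] using hnb
        · have := h8.insert ⟨k, hk⟩
          simpa [NExp.eval, h9] using this
        · rw [← vertexBlock_eq_closure] at h10
          refine (post_addRowCmd (by rw [hF3.nat .n rfl]; simp [St.setN_nat_of_ne, hF2.nat .n rfl, h5])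
            hB h10 (N := N') (by rw [hF3.nat .cnt rfl]; simp [St.setN_nat_of_ne, hF2.nat .cnt rfl, h6])
            (by omega) (Xs := Xs') (by rw [hF3.nat .rows rfl]; simpa [St.setN_nat_of_ne, hF2.nat .rows rfl, h3] using hL')).mono ?_
          rintro s4 ⟨Xs2, N2, hN2, h11, h12, hL2, hXs2, hX2⟩ -
          refine ⟨Xs2, N2, by simpa [St.setN_nat_of_ne] using hN2, by omega, by omega,
            by simpa [St.setN_nat_of_ne] using hL2, ?_, ?_⟩
          · intro r hr
            rw [hXs2 r (by omega), hXs' r hr]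
          · rw [hX2, hX']
            ext X
            simp only [Set.mem_insert_iff, Set.mem_union, Set.mem_ofPred_eq, hset]
            rw [and_iff_right hnot, or_comm, or_assoc]
      · simp only [Cond.Holds, NExp.eval] at hb
        obtain ⟨r, hr, hkr⟩ := hfl.1 (by omega)
        refine ⟨Xs', N', by simpa [St.setN_nat_of_ne] using h6, h1, by omega,
            by simpa [St.setN_nat_of_ne, h3] using hL', hXs', ?_⟩
        rw [hX']
        ext X
        simp only [Set.mem_union, Set.mem_ofPred_eq, hset]
        rw [or_iff_left (b := (∀ Y ∈ Xs '' Set.Iio N, ⟨k, hk⟩ ∉ Y) ∧ X = vertexBlock θ G ⟨k, hk⟩)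
          fun h => h.1 _ ⟨r, hr, rfl⟩ hkr]
  · rintro s' ⟨Xs', N', hN', -, hle, hL', -, hX'⟩ -
    refine ⟨Xs', N', hN', hle.trans hNB, hL', ?_⟩
    rw [hX']
    congr 1
    ext X
    simp

/-- The list of all blocks. -/
def blocksCmd (θ : Params) (ρ : StartRule) (b₁ b₂ : ℝ) : Cmd :=
  .seq (weightsCmd θ) (.seq (queueCmd b₁ b₂) (.seq influenceCmd (.seq (cyclesCmd ρ b₂) verticesCmd)))

/-- The translation between the tests of the program and the definitions is isolated in `hbreak` and
`hcyc`. There is at most one row per path and one per vertex, hence `Q + n ≤ B`. -/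
theorem post_blocksCmd (θ : Params) (ρ : StartRule) {b₁ b₂ : ℝ} (hn : s.nat .n 0 = n)
    (hnb : ∀ v : Fin n, s.nat .nb v = 0) (hcnt : s.nat .cnt 0 = 0) (hb : 1 ≤ b₂) {Q : ℕ}
    (hQ : ∀ F : Finset (List (Fin n)), (∀ l ∈ F, IsShortPath G b₂ l) → F.card ≤ Q)
    (hQB : Q + n ≤ B)
    (hbreak : ∀ v, ¬ IsBreakPoint θ G v ↔ ∃ l, IsShortPath G b₂ l ∧ l.getLast? = some v ∧
      b₁ ^ (l.length - 1) ≤ n ∧ ¬ (l.map (weight θ G)).prod ≤ 1)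
    (hcyc : cycleBlocks θ G ρ =
      {X | ∃ l, IsShortCycle G b₂ l ∧ X = closure θ G ρ {v | v ∈ l}}) :
    Post G B (blocksCmd θ ρ b₁ b₂) s fun s' => ∃ Xs N, s'.nat .n 0 = n ∧ s'.nat .cnt 0 = N ∧
      N ≤ B ∧ Listing (s'.nat .rows) N Xs ∧ Xs '' Set.Iio N = blocks θ G ρ := by
  have hnB : n ≤ B := by omega
  refine (post_weightsCmd θ hn hnB).seq fun s1 h1 hF1 => ?_
  have hn1 : s1.nat .n 0 = n := by rw [hF1.nat .n rfl, hn]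
  refine (post_queueCmd (b₁ := b₁) hn1 hnB hb (fun F hF => (hQ F hF).trans (by omega)) h1).seq
    fun s2 h2 hF2 => ?_
  obtain ⟨q, t, hq, hall⟩ := h2
  have ht : t ≤ Q := hq.2.tail_le hQ
  have hn2 : s2.nat .n 0 = n := by rw [hF2.nat .n rfl, hn1]
  refine (post_influenceCmd hn2 hq (by omega)
    (by rw [hF2.nat .nb rfl, hF1.nat .nb rfl]; exact hnb)).seq fun s3 h3 hF3 => ?_
  have hn3 : s3.nat .n 0 = n := by rw [hF3.nat .n rfl, hn2]
  have hq3 : HasQueue G (weight θ G) b₁ b₂ q t s3 := by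
    simpa only [HasQueue, hF3.nat .tail rfl, hF3.nat .last rfl, hF3.nat .par rfl,
      hF3.nat .root rfl, hF3.real .rw rfl, hF3.real .p1 rfl, hF3.real .p2 rfl] using hq
  have hnb3 : ∀ v : Fin n, 1 ≤ s3.nat .nb v ↔ ¬ IsBreakPoint θ G v := by
    intro v
    rw [h3, hbreak]
    constructor
    · rintro ⟨i, hi, h⟩
      exact ⟨q i, hq.2.short i hi, h⟩
    · rintro ⟨l, hl, h⟩
      obtain ⟨i, hi, rfl⟩ := hall l hl
      exact ⟨i, hi, h⟩
  refine (post_cyclesCmd θ ρ hn3 hnB hq3 (by omega) hnb3 (by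
    rw [hF3.nat .cnt rfl, hF2.nat .cnt rfl, hF1.nat .cnt rfl, hcnt])).seq fun s4 h4 hF4 => ?_
  obtain ⟨Xs, N, hN, hNt, hL, hX⟩ := h4
  have hX' : Xs '' Set.Iio N = cycleBlocks θ G ρ := by
    rw [hX, hcyc]
    ext X
    constructor
    · rintro ⟨i, hi, h, rfl⟩
      exact ⟨q i, h, rfl⟩
    · rintro ⟨l, hl, rfl⟩
      obtain ⟨i, hi, rfl⟩ := hall l hl.path
      exact ⟨i, hi, hl, rfl⟩
  have hn4 : s4.nat .n 0 = n := by rw [hF4.nat .n (by cases ρ <;> rfl), hn3]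
  refine (post_verticesCmd θ hn4 hnB (by rw [hF4.nat .nb (by cases ρ <;> rfl)]; exact hnb3) hN
    (by omega) hL).mono ?_
  rintro s5 ⟨Xs', N', hN', hle, hL', hX5⟩ hF5
  refine ⟨Xs', N', by rw [hF5.nat .n rfl, hn4], hN', hle, hL', ?_⟩
  rw [hX5, hX']
  rfl

end Main

/-! ### The lists of the algorithm and the walks of the definitions -/

section Bridge

variable {n : ℕ} {G : SimpleGraph (Fin n)}

/-- The machine has no logarithm; logarithmic bounds on lengths are tested by comparing powers of a
real constant with `n`. -/
theorem exp_pow_le_natCast_iff {x : ℝ} (hx : 0 < x) (hn : 1 ≤ n) (k : ℕ) :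
    Real.exp x ^ k ≤ n ↔ (k : ℝ) ≤ Real.log n / x := by
  have hn' : (0 : ℝ) < n := by exact_mod_cast hn
  rw [← Real.exp_nat_mul, ← Real.le_log_iff_exp_le hn', le_div_iff₀ hx]

theorem getLast?_support {u v : Fin n} (p : G.Walk u v) : p.support.getLast? = some v := by
  rw [List.getLast?_eq_some_getLast p.support_ne_nil, p.getLast_support]

theorem head?_support {u v : Fin n} (p : G.Walk u v) : p.support.head? = some u := by
  rw [← p.cons_tail_support]; rfl

theorem isShortPath_support {b : ℝ} {u v : Fin n} {p : G.Walk u v} (hp : p.IsPath)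
    (h : b ^ p.length ≤ n) : IsShortPath G b p.support where
  ne_nil := p.support_ne_nil
  isChain := p.isChain_adj_support
  nodup := hp.support_nodup
  pow_le := by rwa [p.length_support, Nat.add_sub_cancel]

/-- The walk along the vertices of a short path. -/
theorem IsShortPath.exists_walk {b : ℝ} {l : List (Fin n)} (h : IsShortPath G b l) :
    ∃ (u v : Fin n) (p : G.Walk u v), p.IsPath ∧ p.support = l := by
  refine ⟨_, _, SimpleGraph.Walk.ofSupport l h.ne_nil h.isChain, ?_,
    SimpleGraph.Walk.support_ofSupport _ _⟩
  rw [SimpleGraph.Walk.isPath_def, SimpleGraph.Walk.support_ofSupport]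
  exact h.nodup

/-- Since `log d ^ 5 / 4 ≤ d ^ (2/5)`, the paths relevant for influence are among the listed ones.
Reversal changes neither length nor weight. -/
theorem not_isBreakPoint_iff {θ : Params} (h : LargeDegree θ.α θ.γ θ.c θ.d) (v : Fin n) :
    ¬ IsBreakPoint θ G v ↔ ∃ l, IsShortPath G (Real.exp (Real.log θ.d ^ 5 / 4)) l ∧
      l.getLast? = some v ∧ Real.exp (θ.d ^ ((2 : ℝ) / 5)) ^ (l.length - 1) ≤ n ∧
      ¬ (l.map (weight θ G)).prod ≤ 1 := by
  have hn : 1 ≤ n := by have := v.2; omega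
  have hd : 0 ≤ θ.d := zero_le_one.trans h.one_le
  have hlog := h.one_le_log
  have hle : Real.log θ.d ^ 5 / 4 ≤ θ.d ^ ((2 : ℝ) / 5) := by
    have h1 := h.log_le
    have h2 : 0 ≤ Real.log θ.d ^ 5 := by positivity
    linarith
  have hpos : 0 < θ.d ^ ((2 : ℝ) / 5) := Real.rpow_pos_of_pos (by linarith [h.one_le]) _
  constructor
  · intro hv
    obtain ⟨u, p, hp, hl, hw⟩ := exists_path_of_not_isBreakPoint hd hv
    rw [← exp_pow_le_natCast_iff hpos hn] at hl
    refine ⟨p.reverse.support, isShortPath_support hp.reverse ?_, getLast?_support _, ?_, ?_⟩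
    · rw [p.length_reverse]
      exact (pow_le_pow_left₀ (Real.exp_pos _).le (Real.exp_le_exp.2 hle) _).trans hl
    · rwa [SimpleGraph.Walk.length_support, Nat.add_sub_cancel, p.length_reverse]
    · rw [p.support_reverse, List.map_reverse, List.prod_reverse, not_le]
      exact hw
  · rintro ⟨l, hl, hlast, hlen, hw⟩ hv
    obtain ⟨u, v', p, hp, rfl⟩ := hl.exists_walk
    rw [getLast?_support, Option.some.injEq] at hlast
    subst hlast
    refine hw (le_trans ?_ hv)
    refine (influence_isGreatest θ G hd _).2 ⟨u, p.reverse, hp.reverse, ?_, ?_⟩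
    · rw [← exp_pow_le_natCast_iff hpos hn, p.length_reverse]
      rwa [SimpleGraph.Walk.length_support, Nat.add_sub_cancel] at hlen
    · rw [pathWeight, p.support_reverse, List.map_reverse, List.prod_reverse]

/-- A cycle without its first edge is a path through the same vertices, and the closure depends only
on the vertex set. -/
theorem cycleBlocks_eq {θ : Params} (h : LargeDegree θ.α θ.γ θ.c θ.d) (ρ : StartRule) :
    cycleBlocks θ G ρ = {X | ∃ l, IsShortCycle G (Real.exp (Real.log θ.d ^ 5 / 4)) l ∧
      X = closure θ G ρ {v | v ∈ l}} := by
  have hlog := h.one_le_log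
  have hpos : 0 < Real.log θ.d ^ 5 / 4 := by positivity
  have hlen : ∀ k : ℕ, 1 ≤ n → ((k : ℝ) ≤ 4 * (Real.log n / Real.log θ.d ^ 5) ↔
      Real.exp (Real.log θ.d ^ 5 / 4) ^ k ≤ n) := by
    intro k hn
    rw [exp_pow_le_natCast_iff hpos hn, div_div_eq_mul_div, mul_comm, div_mul_eq_mul_div]
  have hb : 1 ≤ Real.exp (Real.log θ.d ^ 5 / 4) := Real.one_le_exp hpos.le
  ext X
  constructor
  · rintro ⟨a, C, hC, hl, rfl⟩
    have hn : 1 ≤ n := by have := a.2; omega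
    rw [hlen _ hn] at hl
    have h3 := hC.three_le_length
    have hnil : ¬ C.Nil := hC.not_nil
    have htl : C.tail.length + 1 = C.length := C.length_tail_add_one hnil
    refine ⟨C.tail.support, ⟨isShortPath_support hC.isPath_tail ?_, ?_, ?_, ?_⟩, ?_⟩
    · exact (pow_le_pow_right₀ hb (by omega)).trans hl
    · rw [SimpleGraph.Walk.length_support]; omega
    · exact ⟨_, _, head?_support _, getLast?_support _, (C.adj_snd hnil).symm⟩
    · rwa [SimpleGraph.Walk.length_support, htl]
    · rw [cycleBlock_eq_closure]
      congr 1
      ext x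
      simp only [Set.mem_ofPred_eq]
      rw [← C.cons_tail_support, List.mem_cons, C.support_tail_of_not_nil hnil]
      refine ⟨?_, .inr⟩
      rintro (rfl | hx)
      · have := C.tail.end_mem_support
        rwa [C.support_tail_of_not_nil hnil] at this
      · exact hx
  · rintro ⟨l, hl, rfl⟩
    obtain ⟨u, v, p, hp, rfl⟩ := hl.path.exists_walk
    obtain ⟨u', v', hu, hv, huv⟩ := hl.adj
    rw [head?_support, Option.some.injEq] at hu
    rw [getLast?_support, Option.some.injEq] at hv
    subst hu hv
    have hn : 1 ≤ n := by have := u.2; omega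
    have h3 := hl.three_le
    rw [SimpleGraph.Walk.length_support] at h3
    refine ⟨v, SimpleGraph.Walk.cons huv.symm p, ?_, ?_, ?_⟩
    · rw [SimpleGraph.Walk.isCycle_iff_isPath_tail_and_le_length]
      refine ⟨by simpa using hp, ?_⟩
      rwa [SimpleGraph.Walk.length_cons]
    · rw [hlen _ hn, SimpleGraph.Walk.length_cons]
      simpa [SimpleGraph.Walk.length_support] using hl.pow_le
    · rw [cycleBlock_eq_closure]
      congr 1
      ext x
      simp only [Set.mem_ofPred_eq, SimpleGraph.Walk.support_cons, List.mem_cons]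
      refine ⟨.inr, ?_⟩
      rintro (rfl | hx)
      · exact p.end_mem_support
      · exact hx

/-- The lists are grouped by their number of edges; each comes from an injective sequence through
`List.ofFn`. -/
theorem card_le_pathCount {b : ℝ} {K : ℕ} (hK : ∀ k : ℕ, 1 ≤ n → b ^ k ≤ n → k ≤ K)
    (F : Finset (List (Fin n))) (hF : ∀ l ∈ F, IsShortPath G b l) : F.card ≤ pathCount G K := by
  classical
  have hmaps : Set.MapsTo (fun l : List (Fin n) => l.length - 1) F (Finset.range (K + 1)) := by
    intro l hl
    have h := hF l hl
    have hn : 1 ≤ n := by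
      have := (l.head h.ne_nil).2
      omega
    simpa using hK _ hn h.pow_le
  rw [Finset.card_eq_sum_card_fiberwise hmaps, pathCount]
  refine Finset.sum_le_sum fun k _ => ?_
  refine Finset.card_le_card_of_surjOn (fun f => List.ofFn f) ?_
  intro l hl
  rw [Finset.mem_coe, Finset.mem_filter] at hl
  have h := hF l hl.1
  have hlen : l.length = k + 1 := by
    have := List.length_pos_iff.2 h.ne_nil
    omega
  refine ⟨fun i => l[(i : ℕ)]'(by omega), ?_, ?_⟩
  · rw [Finset.mem_coe, pathSeqs, Finset.mem_filter]
    refine ⟨Finset.mem_univ _, ?_, ?_⟩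
    · intro i j hij
      exact Fin.ext ((h.nodup.getElem_inj_iff).1 hij)
    · intro i
      exact List.isChain_iff_getElem.1 h.isChain i (by omega)
  · refine List.ext_getElem (by simp [hlen]) fun i h1 h2 => by
      simp only [List.getElem_ofFn]

end Bridge

/-! ### The program -/

section Program

variable {n : ℕ} {G : SimpleGraph (Fin n)} {B : ℕ} {s : St}

def double (e : NExp) : NExp := .add e e

/-- Lists the blocks and prepares the relocation of the list. -/
def listCmd (θ : Params) (ρ : StartRule) (b₁ b₂ : ℝ) : Cmd :=
  .seq (blocksCmd θ ρ b₁ b₂) (.seq (NV.off.put (.cst 0))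
  (.seq (forUpto .r NV.cnt.val (NV.off.put (.add NV.off.val NV.n.val)))
  (.seq (NV.j.put (.add (double (double (double (double (double NV.off.val))))) (.cst 32)))
  (.seq (NV.u.put NV.j.val) (.seq (NV.k.put (.cst 19)) (.seq (NV.v.put (.cst 1))
    (NV.w.put (.cst 32))))))))

/-- The deepest nesting is the triple loop of `closeCmd` inside the loop over paths or vertices;
this is the exponent of the time bound. -/
theorem depth_listCmd (θ : Params) (ρ : StartRule) (b₁ b₂ : ℝ) :
    (listCmd θ ρ b₁ b₂).depth = 4 := by
  cases ρ <;> rfl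

/-- The list of the family `F` is complete, and the scalars have the values that are needed for the
relocation. -/
structure Prepared (F : Set (Set (Fin n))) (N : ℕ) (s : St) : Prop where
  cnt : s.nat .cnt 0 = N
  off : s.nat .off 0 = N * n
  j : s.nat .j 0 = 32 * (N * n) + 32
  u : s.nat .u 0 = 32 * (N * n) + 32
  k : s.nat .k 0 = 19
  v : s.nat .v 0 = 1
  w : s.nat .w 0 = 32
  listing : ∃ Xs, Listing (s.nat .rows) N Xs ∧ Xs '' Set.Iio N = F

/-- There is no multiplication of naturals: `N * n` is obtained by repeated addition and the factor
32 by five doublings. -/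
theorem post_listCmd {θ : Params} {ρ : StartRule} {b₁ b₂ : ℝ} {F : Set (Set (Fin n))}
    (h : Post G B (blocksCmd θ ρ b₁ b₂) s fun s' => ∃ Xs N, s'.nat .n 0 = n ∧ s'.nat .cnt 0 = N ∧
      N ≤ B ∧ Listing (s'.nat .rows) N Xs ∧ Xs '' Set.Iio N = F) :
    Post G B (listCmd θ ρ b₁ b₂) s fun s' => ∃ N ≤ B, Prepared F N s' := by
  refine h.seq fun s1 h1 _ => Post.seq_setN ?_
  obtain ⟨Xs, N, hn, hN, hNB, hL, hX⟩ := h1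
  refine (Post.forUpto N (fun k s' => s'.nat .off 0 = k * n) hNB rfl ?_ ?_ ?_).seq
    fun s2 h2 hF2 => ?_
  · simp [St.setN_nat_of_ne, NExp.eval]
  · intro k s' hF _
    simp only [NExp.eval]
    rw [hF.nat .cnt rfl]
    simp [St.setN_nat_of_ne, hN]
  · intro k s' hk hF hr h
    refine Post.setN ?_
    have hn' : s'.nat .n 0 = n := by rw [hF.nat .n rfl]; simp [St.setN_nat_of_ne, hn]
    simp [St.setN_nat_of_ne, NExp.eval, h, hn', add_mul]
  · have hN2 : s2.nat .cnt 0 = N := by rw [hF2.nat .cnt rfl]; simp [St.setN_nat_of_ne, hN]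
    have hrows : s2.nat .rows = s1.nat .rows := by
      rw [hF2.nat .rows rfl]; simp [St.setN_nat_of_ne]
    refine Post.seq_setN (Post.seq_setN (Post.seq_setN (Post.seq_setN (Post.setN
      ⟨N, hNB, ⟨?_, ?_, ?_, ?_, ?_, ?_, ?_, ⟨Xs, ?_, hX⟩⟩⟩)))) <;>
    simp only [NExp.eval, ne_eq, reduceCtorEq, not_false_eq_true, St.setN_nat_of_ne,
      St.setN_nat_self, Function.update_self, h2, hN2, hrows, double]
    · omega
    · omega
    · exact hL

/-- Copies a number of cells at distance `32` to a contiguous block. -/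
def moveLoop : Prog :=
  .while (.nle (.dir 5) (.dir 10))
    (.seq (.op (.ncopy (.ind 2) (.ind 3))) (.seq (.op (.nadd (.dir 2) (.dir 2) (.dir 5)))
    (.seq (.op (.nadd (.dir 3) (.dir 3) (.dir 6))) (.op (.nsub (.dir 10) (.dir 10) (.dir 5))))))

/-- The compiled rows occupy every 32nd cell, while the output format wants consecutive cells. Cells
2, 3, 5, 6 and 10 hold the target, the source, the numbers 1 and 32, and the number of cells left.
By `q + 32 * M ≤ p` the target lies above all sources, so nothing is overwritten before it is read.
-/
theorem exec_moveLoop (M : ℕ) : ∀ (m : Mem) (p q : ℕ), m.nat 10 = M → m.nat 2 = p → m.nat 3 = q →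
    m.nat 5 = 1 → m.nat 6 = 32 → 32 ≤ p → q + 32 * M ≤ p →
    ∃ m', Exec G moveLoop m (5 * M + 1) m' ∧ (∀ x < M, m'.nat (p + x) = m.nat (q + 32 * x)) ∧
      ∀ y < p, y ≠ 2 → y ≠ 3 → y ≠ 10 → m'.nat y = m.nat y := by
  induction M with
  | zero =>
    intro m p q h10 h2 h3 h5 h6 hp hq
    refine ⟨m, Exec.while_false ?_, by omega, fun _ _ _ _ _ => rfl⟩
    simp [Test.Holds, Addr.eval, h5, h10]
  | succ M ih =>
    intro m p q h10 h2 h3 h5 h6 hp hq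
    obtain ⟨m1, e1, hm1⟩ : ∃ m1 : Mem, Exec G (.seq (.op (.ncopy (.ind 2) (.ind 3)))
        (.seq (.op (.nadd (.dir 2) (.dir 2) (.dir 5))) (.seq (.op (.nadd (.dir 3) (.dir 3) (.dir 6)))
        (.op (.nsub (.dir 10) (.dir 10) (.dir 5)))))) m (1 + (1 + (1 + 1))) m1 ∧
        ∀ y, m1.nat y = if y = 10 then M else if y = 3 then q + 32 else if y = 2 then p + 1 else
          if y = p then m.nat q else m.nat y := by
      refine ⟨_, .seq (.op _ _) (.seq (.op _ _) (.seq (.op _ _) (.op _ _))), fun y => ?_⟩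
      have a2 : (2 : ℕ) ≠ p := by omega
      have a3 : (3 : ℕ) ≠ p := by omega
      have a5 : (5 : ℕ) ≠ p := by omega
      have a6 : (6 : ℕ) ≠ p := by omega
      have a10 : (10 : ℕ) ≠ p := by omega
      simp [Op.run, Mem.setNat, Addr.eval, Function.update_apply, h2, h3, h5, h6, h10, a2, a3, a5,
        a6, a10]
    have hne : ∀ y, 32 ≤ y → y ≠ 10 ∧ y ≠ 3 ∧ y ≠ 2 := by omega
    obtain ⟨m', e', hc, hf⟩ := ih m1 (p + 1) (q + 32) (by rw [hm1]; rfl) (by rw [hm1]; rfl)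
      (by rw [hm1]; rfl) (by rw [hm1, if_neg (by omega), if_neg (by omega), if_neg (by omega),
        if_neg (by omega), h5]) (by rw [hm1, if_neg (by omega), if_neg (by omega), if_neg (by omega),
        if_neg (by omega), h6]) (by omega) (by omega)
    refine ⟨m', ?_, ?_, ?_⟩
    · have := Exec.while_true (b := .nle (.dir 5) (.dir 10)) (m := m)
        (by simp [Test.Holds, Addr.eval, h5, h10]) e1 e'
      convert! this using 1
      ring
    · intro x hx
      rcases x with _ | x
      · obtain ⟨b1, b2, b3⟩ := hne p hp
        rw [Nat.add_zero, hf p (by omega) b3 b2 b1, hm1, if_neg b1, if_neg b2, if_neg b3, if_pos rfl]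
        rfl
      · obtain ⟨b1, b2, b3⟩ := hne (q + 32 + 32 * x) (by omega)
        have h := hc x (by omega)
        rw [hm1, if_neg b1, if_neg b2, if_neg b3, if_neg (by omega)] at h
        convert! h using 2 <;> ring
    · intro y hy y2 y3 y10
      rw [hf y (by omega) y2 y3 y10, hm1, if_neg y10, if_neg y3, if_neg y2, if_neg (by omega)]

/-- The program that lists the blocks. -/
def program (θ : Params) (ρ : StartRule) (b₁ b₂ : ℝ) : Prog :=
  .seq (listCmd θ ρ b₁ b₂).compile (.seq moveLoop
    (.seq (.op (.ncopy (.dir 0) (.dir 12))) (.op (.ncopy (.dir 1) (.dir 4)))))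

theorem exec_move {F : Set (Set (Fin n))} {N : ℕ} (h : Prepared F N s) {m : Mem} (hm : Rep m s) :
    ∃ m', Exec G (.seq moveLoop (.seq (.op (.ncopy (.dir 0) (.dir 12)))
      (.op (.ncopy (.dir 1) (.dir 4))))) m (5 * (N * n) + 1 + (1 + 1)) m' ∧ Holds n m' F := by
  -- The array `rows` has index 19. Cells 12 and 4 belong to `cnt` and `u`; the latter keeps the
  -- initial target address, which the loop advances in `j`.
  obtain ⟨m1, e1, hc, hf⟩ := exec_moveLoop (G := G) (N * n) m (32 * (N * n) + 32) 19
    ((hm.nat .off 0).trans h.off) ((hm.nat .j 0).trans h.j) ((hm.nat .k 0).trans h.k)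
    ((hm.nat .v 0).trans h.v) ((hm.nat .w 0).trans h.w) (by omega) (by omega)
  have h12 : m1.nat 12 = N := by
    rw [hf 12 (by omega) (by omega) (by omega) (by omega)]
    exact (hm.nat .cnt 0).trans h.cnt
  have h4 : m1.nat 4 = 32 * (N * n) + 32 := by
    rw [hf 4 (by omega) (by omega) (by omega) (by omega)]
    exact (hm.nat .u 0).trans h.u
  obtain ⟨Xs, hL, rfl⟩ := h.listing
  refine ⟨_, .seq e1 (.seq (.op _ _) (.op _ _)), ?_⟩
  set m2 : Mem := Op.run G (Op.run G m1 (.ncopy (.dir 0) (.dir 12))) (.ncopy (.dir 1) (.dir 4))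
    with hm2
  have h20 : m2.nat 0 = N := by
    simp [hm2, Op.run, Mem.setNat, Addr.eval, h12]
  have h21 : m2.nat 1 = 32 * (N * n) + 32 := by
    simp [hm2, Op.run, Mem.setNat, Addr.eval, h4]
  have h2 : ∀ y, 2 ≤ y → m2.nat y = m1.nat y := by
    intro y hy
    have b0 : y ≠ 0 := by omega
    have b1 : y ≠ 1 := by omega
    simp [hm2, Op.run, Mem.setNat, Addr.eval, b0, b1]
  rw [Holds, h20]
  refine hL.injOn.bijOn_image.congr fun r hr => ?_
  ext v
  have hrn : r * n + v < N * n := by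
    have hr' : r < N := hr
    calc r * n + v < r * n + n := by omega
      _ = (r + 1) * n := by ring
      _ ≤ N * n := Nat.mul_le_mul_right _ hr'
  have h3 : m2.nat (m2.nat 1 + r * n + v) = s.nat .rows (r * n + v) := by
    rw [h21, add_assoc, h2 _ (by omega), hc _ hrn, ← hm.nat .rows]
    congr 1
    exact add_comm _ _
  have h4 := hL.marks r hr v
  simp only at h4
  rw [listedSet, Set.mem_ofPred_eq, h3, ← h4.2]
  omega

theorem rep_initMem (n : ℕ) : Rep (initMem n)
    (St.setN ⟨fun _ _ => 0, fun _ _ => 0⟩ .n 0 n) := by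
  have h : Rep ⟨fun _ => 0, fun _ => 0⟩ ⟨fun _ _ => 0, fun _ _ => 0⟩ :=
    ⟨fun _ _ => rfl, fun _ _ => rfl⟩
  exact h.setN .n 0 n

/-- A bound for the number of steps of the program in terms of the number of paths. -/
theorem constructs_program (θ : Params) (ρ : StartRule) (h : LargeDegree θ.α θ.γ θ.c θ.d) :
    ∃ (P : Prog) (K : ℕ), ∀ (n : ℕ) (G : SimpleGraph (Fin n)), ∃ t, Constructs P G t (blocks θ G ρ) ∧
      t ≤ K * (pathCount G ⌊4 * scale θ.d n⌋₊ + n + 1) ^ 4 := by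
  set b₁ := Real.exp (θ.d ^ ((2 : ℝ) / 5)) with hb₁
  set b₂ := Real.exp (Real.log θ.d ^ 5 / 4) with hb₂
  set C := listCmd θ ρ b₁ b₂ with hC
  refine ⟨program θ ρ b₁ b₂, C.cost * C.size + 8, fun n G => ?_⟩
  have hlog := h.one_le_log
  have hpos : 0 < Real.log θ.d ^ 5 / 4 := by positivity
  set Q := pathCount G ⌊4 * scale θ.d n⌋₊ with hQ
  -- Every loop runs over vertices, listed paths or rows, hence at most `Q + n` times; the summand 1
  -- makes `B` positive.
  set B := Q + n + 1 with hB
  have hcount : ∀ F : Finset (List (Fin n)), (∀ l ∈ F, IsShortPath G b₂ l) → F.card ≤ Q := by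
    refine card_le_pathCount fun k hn hk => Nat.le_floor ?_
    rw [hb₂, exp_pow_le_natCast_iff hpos hn] at hk
    rwa [scale, ← mul_div_assoc, mul_comm, ← div_div_eq_mul_div]
  have hpost := post_blocksCmd (G := G) (B := B) (b₁ := b₁) (b₂ := b₂)
    (s := St.setN ⟨fun _ _ => 0, fun _ _ => 0⟩ .n 0 n) θ ρ (by simp)
    (by simp [St.setN_nat_of_ne]) (by simp [St.setN_nat_of_ne]) (Real.one_le_exp hpos.le) hcount
    (by omega) (not_isBreakPoint_iff h) (cycleBlocks_eq h ρ)
  obtain ⟨t, s, e, ht, N, hNB, hP⟩ := post_listCmd hpost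
  obtain ⟨t', m, e', ht', hm⟩ := cmd_compile G e _ (rep_initMem n)
  obtain ⟨m', e'', hH⟩ := exec_move (G := G) hP hm
  refine ⟨_, ⟨m', .seq e' e'', hH⟩, ?_⟩
  have hB1 : 1 ≤ B := by omega
  have h1 : t ≤ C.size * B ^ 4 := by
    have := ht.trans (C.time_le hB1)
    rwa [hC, depth_listCmd] at this
  have h2 : N * n ≤ B * B := Nat.mul_le_mul hNB (by omega)
  have h3 : B * B ≤ B ^ 4 := by
    rw [← pow_two]
    exact Nat.pow_le_pow_right hB1 (by norm_num)
  have h4 : 1 ≤ B ^ 4 := Nat.one_le_pow _ _ hB1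
  have h5 : C.cost * t ≤ C.cost * (C.size * B ^ 4) := Nat.mul_le_mul_left _ h1
  calc t' + (5 * (N * n) + 1 + (1 + 1)) ≤ C.cost * (C.size * B ^ 4) + 8 * B ^ 4 := by
        have h6 : t' ≤ C.cost * t := ht'
        omega
    _ = (C.cost * C.size + 8) * B ^ 4 := by ring

end Program

end BlockCreation

end

theorem theorem4 :
    ∃ s : ℝ, 0 < s ∧
      ∀ α γ c : ℝ, 0 < α → α < 3 / 2 → 0 < γ → 0 < c →
        ∃ d₀ : ℝ, ∀ d : ℝ, d₀ ≤ d → ∀ ρ : StartRule,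
          ∃ P : Prog,
            (∀ (n : ℕ) (G : SimpleGraph (Fin n)), ∃ t : ℕ,
              Constructs P G t (blocks ⟨α, γ, c, d⟩ G ρ)) ∧
            ∃ K : ℝ, WHP d (fun n G =>
              (∃ t : ℕ, Constructs P G t (blocks ⟨α, γ, c, d⟩ G ρ) ∧ (t : ℝ) ≤ K * (n : ℝ) ^ s) ∧
              ∀ B ∈ blocks ⟨α, γ, c, d⟩ G ρ, (G.induce B).IsTree ∨ IsUnicyclic G B) := by
  -- Four nested loops, each of at most `3 n ^ 3` rounds in a typical graph.
  refine ⟨12, by norm_num, fun α γ c hα hα2 hγ hc => ?_⟩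
  obtain ⟨d₀, hd₀⟩ := eventually_atTop.1 (eventually_largeDegree hα hγ hc)
  refine ⟨d₀, fun d hd ρ => ?_⟩
  have h := hd₀ d hd
  obtain ⟨P, K, hP⟩ := constructs_program ⟨α, γ, c, d⟩ ρ h
  refine ⟨P, fun n G => (hP n G).imp fun t ht => ht.1, K * 3 ^ 4, ?_⟩
  -- For large `n` the desired event contains the typical graphs.
  refine tendsto_of_tendsto_of_tendsto_of_le_of_le' (whp_typical hα hα2 hγ hc h)
    tendsto_const_nhds ?_ (Eventually.of_forall fun n => MeasureTheory.prob_le_one)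
  have hscale : ∀ᶠ n : ℕ in atTop, 5 ≤ scale d n :=
    ((Real.tendsto_log_atTop.comp tendsto_natCast_atTop_atTop).atTop_div_const
      (pow_pos (zero_lt_one.trans_le h.one_le_log) 5)).eventually_ge_atTop 5
  filter_upwards [hscale, eventually_ge_atTop 1] with n hn hn1
  refine MeasureTheory.measure_mono fun G hG => ?_
  have hG : Typical ⟨α, γ, c, d⟩ G := hG
  refine ⟨?_, fun B hB => isTree_or_isUnicyclic_of_mem_blocks h hG hn hB⟩
  obtain ⟨t, ht, htK⟩ := hP n G
  refine ⟨t, ht, ?_⟩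
  have h1 : n ≤ n ^ 3 := Nat.le_self_pow (by norm_num) n
  have h2 : 1 ≤ n ^ 3 := Nat.one_le_pow _ _ hn1
  have h3 : pathCount G ⌊4 * scale d n⌋₊ + n + 1 ≤ 3 * n ^ 3 := by
    have := hG.2.2
    simp only at this
    omega
  have h4 : t ≤ K * (3 * n ^ 3) ^ 4 := htK.trans (Nat.mul_le_mul_left _ (Nat.pow_le_pow_left h3 4))
  have h5 : ((n : ℝ) ^ (12 : ℝ)) = (n : ℝ) ^ 12 := by
    exact_mod_cast Real.rpow_natCast (n : ℝ) 12
  rw [h5]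
  calc (t : ℝ) ≤ ((K * (3 * n ^ 3) ^ 4 : ℕ) : ℝ) := by exact_mod_cast h4
    _ = K * 3 ^ 4 * (n : ℝ) ^ 12 := by push_cast; ring
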